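/- **Definitions.** A series-parallel network is a single resistor (impedance $R$), inductor (impedance $Ls$) or capacitor (impedance $1/(Cs)$), with $R,L,C>0$, or a series connection (impedance $Z_1+Z_2$) or parallel connection (impedance $Z$ with $1/Z=1/Z_1+1/Z_2$) of two series-parallel networks with impedances $Z_1,Z_2$. Let $\mathcal Z_{m,n}\subset\mathbb R(s)$ be the set of impedances of series-parallel networks containing at most $m$ capacitors and at most $n$ inductors, and let $\mathcal Z_3=\bigcup_{m+n=3}\mathcal Z_{m,n}$. A function $Z\in\mathbb R(s)$ is *bicubic* if its McMillan degree (the larger of the degrees of numerator and denominator in lowest terms) is three. A set of real numbers is said to *have the same sign* if all are non-negative or all are non-positive. For $a(s)=\sum_{i=0}^3 a_is^i$, $b(s)=\sum_{i=0}^3 b_is^i$ with real coefficients, consider the forms $$\text{(F1)}\quad \frac{a_3s^3+a_2s^2+a_1s+a_0}{b_3s^3+b_2s^2+b_1s+b_0}\ \ (b_i>0\text{ for some }i),\qquad \text{(F2)}\quad \frac{b_0s^3+b_1s^2+b_2s+b_3}{a_0s^3+a_1s^2+a_2s+a_3}\ \ (a_i>0\text{ for some }i).$$ For polynomials $p,q$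 of formal degree three, $\mathcal B(q,p)$ is the $3\times3$ matrix with $\frac{q(z)p(w)-p(z)q(w)}{z-w}=\sum_{i,j=1}^{3}\mathcal B_{ij}z^{i-1}w^{j-1}$, and $R_k(p,q)$ $(k=0,1,2)$ is the determinant of the $2(3-k)\times2(3-k)$ Sylvester matrix formed by the first $2(3-k)$ columns of the rows $(q_3,q_2,q_1,q_0,0,\dots)$, $(p_3,p_2,p_1,p_0,0,\dots)$, $(0,q_3,q_2,q_1,q_0,0,\dots)$, $(0,p_3,p_2,p_1,p_0,0,\dots)$, and so on. Given $c_0,c_1,c_2,d_0,d_1,d_2$, let $$\alpha_1=c_1d_0-c_0d_1,\quad \alpha_2=c_2d_0-c_0d_2,\quad \alpha_3=c_2d_1-c_1d_2,$$ $$\lambda_1=d_1\alpha_1-d_0\alpha_2,\quad \lambda_2=c_1\alpha_3-c_2\alpha_2,\quad \lambda_3=d_2\alpha_2-d_1\alpha_3,\quad \lambda_4=c_0\alpha_2-c_1\alpha_1.$$ Let $x\ge0$. In (C1)–(C4): $[c_0\ c_1\ c_2]=[1\ {-x}\ x^2]\,\mathcal B(a,b)$, $c(s)=c_2s^2+c_1s+c_0$,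 $\tilde a=a(-x)$, $\tilde b=b(-x)$, $\tilde c=c(-x)$, $[d_0\ d_1\ d_2]=\tilde b\,[1\ {-x}\ x^2]\,\mathcal B(b,c)$. In (C5): $[c_0\ c_1\ c_2]=-[x^2\ {-x}\ 1]\,\mathcal B(a,b)$, $c(s)=c_2s^3+c_1s^2+c_0s$, $\tilde a=-a_0x^3+a_1x^2-a_2x+a_3$, $\tilde b=-b_0x^3+b_1x^2-b_2x+b_3$, $\tilde c=c_0x^2-c_1x+c_2$, $[d_0\ d_1\ d_2]=-\tilde b\,[x^2\ {-x}\ 1]\,\mathcal B(b,c)$. - (C1) $a_i,b_i\ge0$ for $i=0,1,2,3$; $\tilde a,\tilde b,c_0,c_1,c_2,d_0,d_1,d_2,\lambda_1$ have the same sign; $\tilde c,\alpha_2\ge0$; $R_0(a,b)>0$. - (C2) As (C1), with $\lambda_3$ in place of $\lambda_1$ and $-\alpha_2\ge0$ in place of $\alpha_2\ge0$. - (C3) As (C1), with $\lambda_4$ in place of $\lambda_1$ and $-\alpha_2\ge0$ in place of $\alpha_2\ge0$. - (C4) As (C1), with $\lambda_2$ in place of $\lambda_1$. - (C5) The same inequalities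 as in (C1), with the quantities defined for (C5). - (C6) $a_i,b_i\ge0$ for $i=0,1,2,3$, and $b_3,\ b_2,\ b_1,\ b_1b_2-b_0b_3,\ R_2(a,b),\ R_1(a,b),\ R_0(a,b)>0$. **Theorem.** Let $Z\in\mathbb R(s)$ be bicubic. Then $Z\in\mathcal Z_3$ if and only if at least one of the following holds. (i) There exist $x\ge0$ and $a,b$ such that $Z$ or $1/Z$ takes the form (F1) or (F2) and at least one of the following holds: (1) (C1) and ($x=0$ or $\lambda_1=0$ or $c_0=0$); (2) (C2) and ($x=0$ or $\lambda_3=0$ or $c_2=0$); (3) (C3) and ($x=0$ or $\lambda_4=0$ or $d_0=0$); (4) (C4) and ($x=0$ or $\lambda_2=0$ or $d_2=0$); (5) (C5) and ($x=0$ or $c_0=0$ or $d_2=0$). (ii) There exist $a,b$ such that $Z$ or $1/Z$ takes the form (F1) and (C6) holds. -/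

import Mathlib

noncomputable section

namespace SPImpedance

/-! ### Series-parallel networks and their impedances -/

/-- A series-parallel (two-terminal) network: a single resistor, inductor or capacitor (with a
positive element value), or a series or parallel connection of two series-parallel networks. -/
inductive Network : Type
  | resistor (R : ℝ) (hR : 0 < R) : Network
  | inductor (L : ℝ) (hL : 0 < L) : Network
  | capacitor (C : ℝ) (hC : 0 < C) : Network
  | series (N₁ N₂ : Network) : Network
  | parallel (N₁ N₂ : Network) : Network

namespace Network

/-- The impedance, an element of `ℝ(s)`: `R`, `L s`, `1 / (C s)` for the elements, `Z₁ + Z₂` for a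
series connection, and `Z` with `1 / Z = 1 / Z₁ + 1 / Z₂` for a parallel connection. -/
def impedance : Network → RatFunc ℝ
  | resistor R _ => RatFunc.C R
  | inductor L _ => RatFunc.C L * RatFunc.X
  | capacitor C _ => (RatFunc.C C * RatFunc.X)⁻¹
  | series N₁ N₂ => N₁.impedance + N₂.impedance
  | parallel N₁ N₂ => (N₁.impedance⁻¹ + N₂.impedance⁻¹)⁻¹

/-- Every impedance is a quotient of two polynomials that are positive on `(0, ∞)`. -/
theorem exists_pos_impedance_eq (N : Network) :
    ∃ p q : Polynomial ℝ, (∀ t : ℝ, 0 < t → 0 < p.eval t ∧ 0 < q.eval t) ∧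
      N.impedance = algebraMap (Polynomial ℝ) (RatFunc ℝ) p /
        algebraMap (Polynomial ℝ) (RatFunc ℝ) q := by
  have hne : ∀ p : Polynomial ℝ, 0 < p.eval 1 → algebraMap (Polynomial ℝ) (RatFunc ℝ) p ≠ 0 := by
    intro p hp h
    have h0 : p = 0 := RatFunc.algebraMap_injective ℝ (by simpa using h)
    simp [h0] at hp
  induction N with
  | resistor R hR =>
    exact ⟨Polynomial.C R, 1, fun t _ => by simp [hR], by simp [impedance]⟩
  | inductor L hL =>
    exact ⟨Polynomial.C L * Polynomial.X, 1, fun t ht => by simp [mul_pos hL ht],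
      by simp [impedance]⟩
  | capacitor C hC =>
    exact ⟨1, Polynomial.C C * Polynomial.X, fun t ht => by simp [mul_pos hC ht],
      by simp [impedance]⟩
  | series N₁ N₂ h₁ h₂ =>
    obtain ⟨p₁, q₁, hpos₁, e₁⟩ := h₁
    obtain ⟨p₂, q₂, hpos₂, e₂⟩ := h₂
    refine ⟨p₁ * q₂ + q₁ * p₂, q₁ * q₂, fun t ht => ?_, ?_⟩
    · obtain ⟨a₁, b₁⟩ := hpos₁ t ht
      obtain ⟨a₂, b₂⟩ := hpos₂ t ht
      simp only [Polynomial.eval_add, Polynomial.eval_mul]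
      constructor <;> positivity
    · have n₁ := hne q₁ (hpos₁ 1 one_pos).2
      have n₂ := hne q₂ (hpos₂ 1 one_pos).2
      simp only [impedance, e₁, e₂, map_add, map_mul]
      rw [div_add_div _ _ n₁ n₂]
  | parallel N₁ N₂ h₁ h₂ =>
    obtain ⟨p₁, q₁, hpos₁, e₁⟩ := h₁
    obtain ⟨p₂, q₂, hpos₂, e₂⟩ := h₂
    refine ⟨p₁ * p₂, q₁ * p₂ + p₁ * q₂, fun t ht => ?_, ?_⟩
    · obtain ⟨a₁, b₁⟩ := hpos₁ t ht
      obtain ⟨a₂, b₂⟩ := hpos₂ t ht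
      simp only [Polynomial.eval_add, Polynomial.eval_mul]
      constructor <;> positivity
    · have n₁ := hne p₁ (hpos₁ 1 one_pos).1
      have n₂ := hne p₂ (hpos₂ 1 one_pos).1
      simp only [impedance, e₁, e₂, map_add, map_mul]
      rw [inv_div, inv_div, div_add_div _ _ n₁ n₂, inv_div]

/-- An impedance is never zero, so that the inverses in `impedance` are genuine. -/
theorem impedance_ne_zero (N : Network) : N.impedance ≠ 0 := by
  obtain ⟨p, q, hpos, e⟩ := N.exists_pos_impedance_eq
  have h := hpos 1 one_pos
  rw [e]
  refine div_ne_zero (fun h0 => ?_) (fun h0 => ?_)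
  · have h1 : p = 0 := RatFunc.algebraMap_injective ℝ (by simpa using h0)
    simp [h1] at h
  · have h1 : q = 0 := RatFunc.algebraMap_injective ℝ (by simpa using h0)
    simp [h1] at h

/-- The number of capacitors in a network. -/
def numCapacitors : Network → ℕ
  | resistor _ _ => 0
  | inductor _ _ => 0
  | capacitor _ _ => 1
  | series N₁ N₂ => N₁.numCapacitors + N₂.numCapacitors
  | parallel N₁ N₂ => N₁.numCapacitors + N₂.numCapacitors

/-- The number of inductors in a network. -/
def numInductors : Network → ℕ
  | resistor _ _ => 0
  | inductor _ _ => 1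
  | capacitor _ _ => 0
  | series N₁ N₂ => N₁.numInductors + N₂.numInductors
  | parallel N₁ N₂ => N₁.numInductors + N₂.numInductors

end Network

/-- `𝒵_{m,n}`: the impedances of series-parallel networks with at most `m` capacitors and at most
`n` inductors (and any finite number of resistors). -/
def impedanceSet (m n : ℕ) : Set (RatFunc ℝ) :=
  {Z | ∃ N : Network, N.numCapacitors ≤ m ∧ N.numInductors ≤ n ∧ N.impedance = Z}

/-- `𝒵_M`, the union of the `𝒵_{m,n}` with `m + n = M`. -/
def storageSet (M : ℕ) : Set (RatFunc ℝ) :=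
  {Z | ∃ m n : ℕ, m + n = M ∧ Z ∈ impedanceSet m n}

/-- The McMillan degree of a rational function: the larger of the degrees of numerator and
denominator in lowest terms. -/
def mcMillanDegree (Z : RatFunc ℝ) : ℕ := max Z.num.natDegree Z.denom.natDegree

/-- A bicubic is a rational function of McMillan degree three. -/
def IsBicubic (Z : RatFunc ℝ) : Prop := mcMillanDegree Z = 3

/-! ### Cubics given by their coefficients; Bezoutian and Sylvester determinants -/

/-- The cubic `p₃ s³ + p₂ s² + p₁ s + p₀`, as an element of `ℝ(s)`. -/
def cubic (p : Fin 4 → ℝ) : RatFunc ℝ :=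
  RatFunc.C (p 3) * RatFunc.X ^ 3 + RatFunc.C (p 2) * RatFunc.X ^ 2
    + RatFunc.C (p 1) * RatFunc.X + RatFunc.C (p 0)

/-- `Z = (a₃ s³ + a₂ s² + a₁ s + a₀) / (b₃ s³ + b₂ s² + b₁ s + b₀)`, with some `bᵢ > 0`. -/
def FormOne (Z : RatFunc ℝ) (a b : Fin 4 → ℝ) : Prop :=
  (∃ i, 0 < b i) ∧ Z = cubic a / cubic b

/-- `Z = (b₀ s³ + b₁ s² + b₂ s + b₃) / (a₀ s³ + a₁ s² + a₂ s + a₃)`, with some `aᵢ > 0`. -/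
def FormTwo (Z : RatFunc ℝ) (a b : Fin 4 → ℝ) : Prop :=
  (∃ i, 0 < a i) ∧ Z = cubic ![b 3, b 2, b 1, b 0] / cubic ![a 3, a 2, a 1, a 0]

/-- The Bezoutian matrix `ℬ(q, p)` of two polynomials of formal degree three. -/
def bezoutian (q p : Fin 4 → ℝ) : Matrix (Fin 3) (Fin 3) ℝ :=
  !![q 1 * p 0 - p 1 * q 0, q 2 * p 0 - p 2 * q 0, q 3 * p 0 - p 3 * q 0;
     q 2 * p 0 - p 2 * q 0, (q 3 * p 0 - p 3 * q 0) + (q 2 * p 1 - p 2 * q 1),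
       q 3 * p 1 - p 3 * q 1;
     q 3 * p 0 - p 3 * q 0, q 3 * p 1 - p 3 * q 1, q 3 * p 2 - p 3 * q 2]

/-- The defining property of the Bezoutian:
`(q(z) p(w) - p(z) q(w)) / (z - w) = ∑ᵢⱼ ℬᵢⱼ zⁱ wʲ` (indices from zero). -/
theorem bezoutian_spec (q p : Fin 4 → ℝ) (z w : ℝ) :
    (∑ i, q i * z ^ (i : ℕ)) * (∑ i, p i * w ^ (i : ℕ))
        - (∑ i, p i * z ^ (i : ℕ)) * (∑ i, q i * w ^ (i : ℕ))
      = (z - w) * ∑ i : Fin 3, ∑ j : Fin 3, bezoutian q p i j * z ^ (i : ℕ) * w ^ (j : ℕ) := by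
  simp [bezoutian, Fin.sum_univ_succ]
  ring

/-- The Sylvester determinant `R₀(p, q)`. -/
def R₀ (p q : Fin 4 → ℝ) : ℝ :=
  Matrix.det !![q 3, q 2, q 1, q 0, 0, 0;
                p 3, p 2, p 1, p 0, 0, 0;
                0, q 3, q 2, q 1, q 0, 0;
                0, p 3, p 2, p 1, p 0, 0;
                0, 0, q 3, q 2, q 1, q 0;
                0, 0, p 3, p 2, p 1, p 0]

/-- The Sylvester determinant `R₁(p, q)`. -/
def R₁ (p q : Fin 4 → ℝ) : ℝ :=
  Matrix.det !![q 3, q 2, q 1, q 0;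
                p 3, p 2, p 1, p 0;
                0, q 3, q 2, q 1;
                0, p 3, p 2, p 1]

/-- The Sylvester determinant `R₂(p, q)`. -/
def R₂ (p q : Fin 4 → ℝ) : ℝ :=
  Matrix.det !![q 3, q 2;
                p 3, p 2]

/-! ### The quantities entering the conditions -/

/-- A set of real numbers has the same sign if all are non-negative or all are non-positive. -/
def SameSign (S : Set ℝ) : Prop := (∀ y ∈ S, 0 ≤ y) ∨ (∀ y ∈ S, y ≤ 0)

/-- `α₁ = c₁ d₀ - c₀ d₁`. -/
def α₁ (c d : Fin 3 → ℝ) : ℝ := c 1 * d 0 - c 0 * d 1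

/-- `α₂ = c₂ d₀ - c₀ d₂`. -/
def α₂ (c d : Fin 3 → ℝ) : ℝ := c 2 * d 0 - c 0 * d 2

/-- `α₃ = c₂ d₁ - c₁ d₂`. -/
def α₃ (c d : Fin 3 → ℝ) : ℝ := c 2 * d 1 - c 1 * d 2

/-- `λ₁ = d₁ α₁ - d₀ α₂`. -/
def lam₁ (c d : Fin 3 → ℝ) : ℝ := d 1 * α₁ c d - d 0 * α₂ c d

/-- `λ₂ = c₁ α₃ - c₂ α₂`. -/
def lam₂ (c d : Fin 3 → ℝ) : ℝ := c 1 * α₃ c d - c 2 * α₂ c d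

/-- `λ₃ = d₂ α₂ - d₁ α₃`. -/
def lam₃ (c d : Fin 3 → ℝ) : ℝ := d 2 * α₂ c d - d 1 * α₃ c d

/-- `λ₄ = c₀ α₂ - c₁ α₁`. -/
def lam₄ (c d : Fin 3 → ℝ) : ℝ := c 0 * α₂ c d - c 1 * α₁ c d

/-- The value `p(-x)` of a cubic `p`. -/
def evalNeg (p : Fin 4 → ℝ) (x : ℝ) : ℝ := p 0 + p 1 * (-x) + p 2 * (-x) ^ 2 + p 3 * (-x) ^ 3

/-- The value `-p₀ x³ + p₁ x² - p₂ x + p₃`. -/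
def evalNegRev (p : Fin 4 → ℝ) (x : ℝ) : ℝ := -p 0 * x ^ 3 + p 1 * x ^ 2 - p 2 * x + p 3

/-- `[c₀ c₁ c₂] = [1 -x x²] ℬ(a, b)`. -/
def cVec (a b : Fin 4 → ℝ) (x : ℝ) : Fin 3 → ℝ :=
  Matrix.vecMul ![1, -x, x ^ 2] (bezoutian a b)

/-- The polynomial `c(s) = c₂ s² + c₁ s + c₀`, as a cubic with leading coefficient zero. -/
def cPoly (a b : Fin 4 → ℝ) (x : ℝ) : Fin 4 → ℝ :=
  ![cVec a b x 0, cVec a b x 1, cVec a b x 2, 0]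

/-- `[d₀ d₁ d₂] = b(-x) [1 -x x²] ℬ(b, c)`. -/
def dVec (a b : Fin 4 → ℝ) (x : ℝ) : Fin 3 → ℝ :=
  evalNeg b x • Matrix.vecMul ![1, -x, x ^ 2] (bezoutian b (cPoly a b x))

/-- `[c₀ c₁ c₂] = -[x² -x 1] ℬ(a, b)`. -/
def cVec' (a b : Fin 4 → ℝ) (x : ℝ) : Fin 3 → ℝ :=
  -Matrix.vecMul ![x ^ 2, -x, 1] (bezoutian a b)

/-- The polynomial `c(s) = c₂ s³ + c₁ s² + c₀ s` belonging to `cVec'`. -/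
def cPoly' (a b : Fin 4 → ℝ) (x : ℝ) : Fin 4 → ℝ :=
  ![0, cVec' a b x 0, cVec' a b x 1, cVec' a b x 2]

/-- The value `c₀ x² - c₁ x + c₂` for `c = cVec'`. -/
def cTilde' (a b : Fin 4 → ℝ) (x : ℝ) : ℝ :=
  cVec' a b x 0 * x ^ 2 - cVec' a b x 1 * x + cVec' a b x 2

/-- `[d₀ d₁ d₂] = -b̃ [x² -x 1] ℬ(b, c)`, with `b̃ = -b₀ x³ + b₁ x² - b₂ x + b₃`
and `c = cPoly'`. -/
def dVec' (a b : Fin 4 → ℝ) (x : ℝ) : Fin 3 → ℝ :=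
  -(evalNegRev b x • Matrix.vecMul ![x ^ 2, -x, 1] (bezoutian b (cPoly' a b x)))

/-! ### The conditions -/

/-- The clauses common to `C1`, `C2`, `C3` and `C4`, with `l` one of `λ₁, λ₂, λ₃, λ₄` and `e` one of `±α₂`. -/
def CommonCond (a b : Fin 4 → ℝ) (x l e : ℝ) : Prop :=
  (∀ i, 0 ≤ a i ∧ 0 ≤ b i) ∧
  SameSign {evalNeg a x, evalNeg b x, cVec a b x 0, cVec a b x 1, cVec a b x 2,
    dVec a b x 0, dVec a b x 1, dVec a b x 2, l} ∧
  0 ≤ evalNeg (cPoly a b x) x ∧ 0 ≤ e ∧ 0 < R₀ a b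

/-- `CommonCond` with `λ₁` in the sign clause and `α₂ ≥ 0`. -/
def C1 (a b : Fin 4 → ℝ) (x : ℝ) : Prop :=
  CommonCond a b x (lam₁ (cVec a b x) (dVec a b x)) (α₂ (cVec a b x) (dVec a b x))

/-- `CommonCond` with `λ₃` in the sign clause and `-α₂ ≥ 0`. -/
def C2 (a b : Fin 4 → ℝ) (x : ℝ) : Prop :=
  CommonCond a b x (lam₃ (cVec a b x) (dVec a b x)) (-α₂ (cVec a b x) (dVec a b x))

/-- `CommonCond` with `λ₄` in the sign clause and `-α₂ ≥ 0`. -/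
def C3 (a b : Fin 4 → ℝ) (x : ℝ) : Prop :=
  CommonCond a b x (lam₄ (cVec a b x) (dVec a b x)) (-α₂ (cVec a b x) (dVec a b x))

/-- `CommonCond` with `λ₂` in the sign clause and `α₂ ≥ 0`. -/
def C4 (a b : Fin 4 → ℝ) (x : ℝ) : Prop :=
  CommonCond a b x (lam₂ (cVec a b x) (dVec a b x)) (α₂ (cVec a b x) (dVec a b x))

/-- The analogue of `C1` in which `c` and `d` are the reversed quantities `cVec'`, `dVec'`. -/
def C5 (a b : Fin 4 → ℝ) (x : ℝ) : Prop :=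
  (∀ i, 0 ≤ a i ∧ 0 ≤ b i) ∧
  SameSign {evalNegRev a x, evalNegRev b x, cVec' a b x 0, cVec' a b x 1, cVec' a b x 2,
    dVec' a b x 0, dVec' a b x 1, dVec' a b x 2, lam₁ (cVec' a b x) (dVec' a b x)} ∧
  0 ≤ cTilde' a b x ∧ 0 ≤ α₂ (cVec' a b x) (dVec' a b x) ∧ 0 < R₀ a b

/-- Non-negative coefficients, the Hurwitz inequalities, and positive Sylvester determinants. -/
def C6 (a b : Fin 4 → ℝ) : Prop :=
  (∀ i, 0 ≤ a i ∧ 0 ≤ b i) ∧ 0 < b 3 ∧ 0 < b 2 ∧ 0 < b 1 ∧ 0 < b 1 * b 2 - b 0 * b 3 ∧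
  0 < R₂ a b ∧ 0 < R₁ a b ∧ 0 < R₀ a b

/-- At least one of the five boundary conditions holds: one of `C1`, ..., `C5`, together with the
vanishing of `x` or of one of two further quantities. -/
def BoundaryCond (a b : Fin 4 → ℝ) (x : ℝ) : Prop :=
  (C1 a b x ∧ (x = 0 ∨ lam₁ (cVec a b x) (dVec a b x) = 0 ∨ cVec a b x 0 = 0)) ∨
  (C2 a b x ∧ (x = 0 ∨ lam₃ (cVec a b x) (dVec a b x) = 0 ∨ cVec a b x 2 = 0)) ∨
  (C3 a b x ∧ (x = 0 ∨ lam₄ (cVec a b x) (dVec a b x) = 0 ∨ dVec a b x 0 = 0)) ∨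
  (C4 a b x ∧ (x = 0 ∨ lam₂ (cVec a b x) (dVec a b x) = 0 ∨ dVec a b x 2 = 0)) ∨
  (C5 a b x ∧ (x = 0 ∨ cVec' a b x 0 = 0 ∨ dVec' a b x 2 = 0))

end SPImpedance

end

noncomputable section

namespace SPImpedance

/-! Mixed storage elements. Duality `Z ↦ 1/Z` and frequency inversion `s ↦ 1/s` (`freqInv`, which
reverses coefficients and so accounts for (F2)) reduce to one capacitor and two inductors and to `Z
= R + (1/Z₁ + 1/Z₂)⁻¹`, where `Z₁` has one storage element and `Z₂` has two. A conductance in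
parallel can be moved from `Z₁` to `Z₂`, which leaves `Z₁ = L(s + x)` or `Z₁ = (1 + xs)/(Ks)`, and
`Z₂ = c/d` with quadratics `c`, `d` having non-negative coefficients. This presents `Z` as `a/b`
with the explicit cubics `shuntNum`, `shuntDen` (or their primed versions).

The branch `Z₁` vanishes at `s = -x` (or `s = -1/x`). There `a = R b`, and the Bezoutian rows at
this point return `c` and `d` up to scalar factors (`cVec_shunt`, `dVec_shunt`); conversely `a` and
`b` are rebuilt from these rows (`shunt_eq`, `shunt'_eq`). Hence (C1)–(C4) express that the element
values have the right signs and that `c/d` is realizable with one inductor and one capacitor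
(`quad_div_mem_of_isRegular`); (C5) does the same for two inductors. The sign of `R₀` is that of
`α₂² - α₁α₃` for (C1)–(C4) and the opposite one for (C5).

The parameter `x` is not unique. For fixed `a`, `b` the admissible `x ≥ 0` form a closed set. At its
least element one of the equalities in (1)–(5) holds: otherwise the remaining inequalities are
strict, or are propagated by the monotonicity of `x ↦ a(-x)/b(-x)`, and a smaller `x` is admissible.

Elements of one kind. For three capacitors `-ℬ(a, b)` is positive definite, and `R₂`, `R₁`, `R₀` are
its trailing principal minors. Definiteness forces `b` to have three distinct real non-positive
roots and `a/b` to have positive residues, so a partial fraction expansion realizes `Z`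
(`mem_impedanceSet_of_C6`).

Necessity is a structural induction (`Network.networkClass`): to each pair of element counts belongs
a class of rational functions, compatible with inversion and series connection. The classes are
closed conditions and contain degenerate members. These are discarded by `Generic`: a bicubic has
non-zero resultant in every presentation by formal cubics. -/

/-! ### Sylvester determinants as Bezoutian minors -/

set_option maxHeartbeats 1000000 in
theorem R₀_eq (a b : Fin 4 → ℝ) : R₀ a b = - (bezoutian a b).det := by
  -- Cofactor expansions along the first column that keep only the entries not forced to vanish by
  -- the staircase shape of a Sylvester matrix.
  have h5 : ∀ (M : Matrix (Fin 6) (Fin 6) ℝ), M 2 0 = 0 → M 3 0 = 0 → M 4 0 = 0 → M 5 0 = 0 → 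
     M.det = M 0 0 * (M.submatrix (Fin.succAbove 0) Fin.succ).det - M 1 0 * (M.submatrix (Fin.succAbove 1) Fin.succ).det := by
    intro M h2 h3 h4 h5
    rw [Matrix.det_succ_column_zero]
    simp only [Fin.sum_univ_six, h2, h3, h4, h5]
    simp
    ring
  have h4 : ∀ (M : Matrix (Fin 5) (Fin 5) ℝ), M 3 0 = 0 → M 4 0 = 0 →
     M.det = M 0 0 * (M.submatrix (Fin.succAbove 0) Fin.succ).det - M 1 0 * (M.submatrix (Fin.succAbove 1) Fin.succ).det + M 2 0 * (M.submatrix (Fin.succAbove 2) Fin.succ).det := by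
    intro M h2 h3
    rw [Matrix.det_succ_column_zero]
    simp only [Fin.sum_univ_five, h2, h3]
    simp
    ring
  have h3 : ∀ (M : Matrix (Fin 4) (Fin 4) ℝ), 
     M.det = M 0 0 * (M.submatrix (Fin.succAbove 0) Fin.succ).det - M 1 0 * (M.submatrix (Fin.succAbove 1) Fin.succ).det + M 2 0 * (M.submatrix (Fin.succAbove 2) Fin.succ).det - M 3 0 * (M.submatrix (Fin.succAbove 3) Fin.succ).det := by
    intro M
    rw [Matrix.det_succ_column_zero]
    simp only [Fin.sum_univ_four]
    simp
    ring
  rw [R₀, h5 _ (by simp) (by simp) (by simp) (by simp), h4 _ (by simp) (by simp), h4 _ (by simp [Fin.succAbove]) (by simp [Fin.succAbove])]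
  simp only [h3, Matrix.det_fin_three]
  simp [Fin.succAbove, bezoutian]
  ring
-- `R₀`, `R₁` and `R₂` are the trailing principal minors of `-ℬ(a, b)` of orders three, two and one,
-- so their joint positivity is Sylvester's criterion for this matrix.
set_option maxHeartbeats 1000000 in
theorem R₁_eq (a b : Fin 4 → ℝ) : R₁ a b = bezoutian a b 1 1 * bezoutian a b 2 2 - bezoutian a b 1 2 * bezoutian a b 1 2 := by
  have h3 : ∀ (M : Matrix (Fin 4) (Fin 4) ℝ), 
     M.det = M 0 0 * (M.submatrix (Fin.succAbove 0) Fin.succ).det - M 1 0 * (M.submatrix (Fin.succAbove 1) Fin.succ).det + M 2 0 * (M.submatrix (Fin.succAbove 2) Fin.succ).det - M 3 0 * (M.submatrix (Fin.succAbove 3) Fin.succ).det := by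
    intro M
    rw [Matrix.det_succ_column_zero]
    simp only [Fin.sum_univ_four]
    simp
    ring
  simp only [R₁, h3, Matrix.det_fin_three]
  simp [Fin.succAbove, bezoutian]
  ring
theorem R₂_eq (a b : Fin 4 → ℝ) : R₂ a b = - bezoutian a b 2 2 := by
  simp [R₂, Matrix.det_fin_two, bezoutian, mul_comm]

/-- The numerator `c + L (s + x) d` of the admittance of `L (s + x)` in parallel with `c / d`. -/
def shuntDen (L x : ℝ) (c d : Fin 3 → ℝ) : Fin 4 → ℝ :=
  ![c 0 + L * (x * d 0), c 1 + L * (d 0 + x * d 1), c 2 + L * (d 1 + x * d 2), L * d 2]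

/-- The numerator of `R + (1 / (L (s + x)) + d / c)⁻¹` over `shuntDen L x c d`. -/
def shuntNum (R L x : ℝ) (c d : Fin 3 → ℝ) : Fin 4 → ℝ :=
  ![R * shuntDen L x c d 0 + L * (x * c 0), R * shuntDen L x c d 1 + L * (c 0 + x * c 1),
    R * shuntDen L x c d 2 + L * (c 1 + x * c 2), R * shuntDen L x c d 3 + L * c 2]

/-- The value `c(-x)` of a quadratic. -/
def quadNeg (c : Fin 3 → ℝ) (x : ℝ) : ℝ := c 0 - c 1 * x + c 2 * x ^ 2

/-! ### The branch `L(s + x)`: recovering element values from Bezoutian rows -/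

variable (R L x : ℝ) (c d : Fin 3 → ℝ) (a b : Fin 4 → ℝ)

theorem evalNeg_shuntDen : evalNeg (shuntDen L x c d) x = quadNeg c x := by
  simp [evalNeg, shuntDen, quadNeg]; ring

theorem evalNeg_shuntNum : evalNeg (shuntNum R L x c d) x = R * quadNeg c x := by
  simp [evalNeg, shuntDen, shuntNum, quadNeg]; ring

theorem cVec_apply (j : Fin 3) : cVec a b x j =
    bezoutian a b 0 j - x * bezoutian a b 1 j + x ^ 2 * bezoutian a b 2 j := by
  simp [cVec, Matrix.vecMul, dotProduct, Fin.sum_univ_three]; ring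

theorem dVec_apply (j : Fin 3) : dVec a b x j = evalNeg b x *
    (bezoutian b (cPoly a b x) 0 j - x * bezoutian b (cPoly a b x) 1 j
      + x ^ 2 * bezoutian b (cPoly a b x) 2 j) := by
  simp [dVec, Matrix.vecMul, dotProduct, Fin.sum_univ_three, -mul_eq_mul_left_iff]; ring

/-- The row `[1 -x x²]` of `ℬ(a, b)` is the polynomial `(b(-x) a(s) - a(-x) b(s)) / (s + x)`. Here
`b(-x) = c(-x)`, `a(-x) = R c(-x)` and `a - R b = L(s + x) c`. -/
theorem cVec_shunt : cVec (shuntNum R L x c d) (shuntDen L x c d) x = (quadNeg c x * L) • c := by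
  funext j
  rw [cVec_apply]
  fin_cases j <;> simp [bezoutian, shuntDen, shuntNum, quadNeg] <;> ring

theorem evalNeg_cPoly : evalNeg (cPoly a b x) x = quadNeg (cVec a b x) x := by
  simp [evalNeg, cPoly, quadNeg]; ring

theorem evalNeg_cPoly_shunt :
    evalNeg (cPoly (shuntNum R L x c d) (shuntDen L x c d) x) x = quadNeg c x ^ 2 * L := by
  rw [evalNeg_cPoly, cVec_shunt]; simp [quadNeg]; ring

/-- The mechanism of `cVec_shunt` applied to the pair `b`, `c`, using `b - c = L(s + x) d`. -/
theorem dVec_shunt : dVec (shuntNum R L x c d) (shuntDen L x c d) x =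
    (quadNeg c x ^ 3 * L ^ 2) • d := by
  funext j
  rw [dVec_apply, evalNeg_shuntDen, cPoly, cVec_shunt]
  fin_cases j <;> simp [bezoutian, shuntDen, quadNeg] <;> ring

/-- The numbers `α₁`, `α₂`, `α₃` are the Bezoutian entries of `c` and `d`. So `R₀ > 0` forces the
quadratic form `α₁v² + 2α₂vw + α₃w²` to be indefinite when `L > 0`. -/
theorem R₀_shunt : R₀ (shuntNum R L x c d) (shuntDen L x c d) =
    L ^ 5 * quadNeg c x ^ 2 * (α₂ c d ^ 2 - α₁ c d * α₃ c d) := by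
  rw [R₀_eq, Matrix.det_fin_three]
  simp [bezoutian, shuntDen, shuntNum, quadNeg, α₁, α₂, α₃]
  ring

theorem R₀_eq_zero_of_cVec_eq_zero (h : ∀ j, cVec a b x j = 0) : R₀ a b = 0 := by
  rw [R₀_eq, neg_eq_zero, ← Matrix.exists_vecMul_eq_zero_iff]
  refine ⟨![1, -x, x ^ 2], fun h0 => ?_, funext h⟩
  simpa using congrFun h0 0

/-- Coefficients of `b(-x) a(s) - a(-x) b(s) = (s + x) c(s)`, for arbitrary `a` and `b`. The next
lemma does the same for `b(-x) (c(-x) b(s) - b(-x) c(s)) = (s + x) d(s)`. -/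
theorem cVec_relation : 
    evalNeg b x * a 0 - evalNeg a x * b 0 = x * cVec a b x 0 ∧
    evalNeg b x * a 1 - evalNeg a x * b 1 = cVec a b x 0 + x * cVec a b x 1 ∧
    evalNeg b x * a 2 - evalNeg a x * b 2 = cVec a b x 1 + x * cVec a b x 2 ∧
    evalNeg b x * a 3 - evalNeg a x * b 3 = cVec a b x 2 := by
  simp only [cVec_apply]
  refine ⟨?_, ?_, ?_, ?_⟩ <;> simp [bezoutian, evalNeg] <;> ring

theorem dVec_relation : 
    evalNeg b x * (quadNeg (cVec a b x) x * b 0 - evalNeg b x * cVec a b x 0)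
      = x * dVec a b x 0 ∧
    evalNeg b x * (quadNeg (cVec a b x) x * b 1 - evalNeg b x * cVec a b x 1)
      = dVec a b x 0 + x * dVec a b x 1 ∧
    evalNeg b x * (quadNeg (cVec a b x) x * b 2 - evalNeg b x * cVec a b x 2)
      = dVec a b x 1 + x * dVec a b x 2 ∧
    evalNeg b x * (quadNeg (cVec a b x) x * b 3) = dVec a b x 2 := by
  simp only [dVec_apply]
  generalize hc : cVec a b x = c
  refine ⟨?_, ?_, ?_, ?_⟩ <;> simp [bezoutian, evalNeg, cPoly, quadNeg, hc, -mul_eq_mul_left_iff] <;> ring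

variable {R L x c d a b}

/-- Solving the two divided-difference relations for `b` and then for `a`. The scalars are dictated
by the shunt formulas: there `c(-x)` of `cVec` equals `b(-x)² L`, which yields `L`, and the factors
of `cVec_shunt` and `dVec_shunt` are then divided out. -/
theorem shunt_eq (hb : evalNeg b x ≠ 0) (hc : quadNeg (cVec a b x) x ≠ 0) :
    b = shuntDen (quadNeg (cVec a b x) x / evalNeg b x ^ 2) x
      ((evalNeg b x / quadNeg (cVec a b x) x) • cVec a b x)
      ((evalNeg b x / quadNeg (cVec a b x) x ^ 2) • dVec a b x) ∧
    a = shuntNum (evalNeg a x / evalNeg b x) (quadNeg (cVec a b x) x / evalNeg b x ^ 2) x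
      ((evalNeg b x / quadNeg (cVec a b x) x) • cVec a b x)
      ((evalNeg b x / quadNeg (cVec a b x) x ^ 2) • dVec a b x) := by
  obtain ⟨h0, h1, h2, h3⟩ := cVec_relation x a b
  obtain ⟨k0, k1, k2, k3⟩ := dVec_relation x a b
  generalize quadNeg (cVec a b x) x = q at *
  generalize evalNeg b x = k at *
  generalize evalNeg a x = l at *
  generalize cVec a b x = c at *
  generalize dVec a b x = d at *
  have key : b = shuntDen (q / k ^ 2) x ((k / q) • c) ((k / q ^ 2) • d) := by
    funext i
    fin_cases i <;> simp [shuntDen] <;> field_simp <;> linarith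
  refine ⟨key, ?_⟩
  funext i
  have e : ∀ i, shuntDen (q / k ^ 2) x ((k / q) • c) ((k / q ^ 2) • d) i = b i := 
    fun i => congrFun key.symm i
  fin_cases i <;> simp only [shuntNum, e] <;> simp <;> field_simp <;> linarith

/-! ### Homogeneity -/
variable (u v : ℝ)
theorem α₁_smul : α₁ (u • c) (v • d) = u * v * α₁ c d := by simp [α₁]; ring
theorem α₂_smul : α₂ (u • c) (v • d) = u * v * α₂ c d := by simp [α₂]; ring
theorem α₃_smul : α₃ (u • c) (v • d) = u * v * α₃ c d := by simp [α₃]; ring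
theorem lam₁_smul : lam₁ (u • c) (v • d) = u * v ^ 2 * lam₁ c d := by 
  simp [lam₁, α₁, α₂]; ring
theorem lam₂_smul : lam₂ (u • c) (v • d) = u ^ 2 * v * lam₂ c d := by
  simp [lam₂, α₃, α₂]; ring
theorem lam₃_smul : lam₃ (u • c) (v • d) = u * v ^ 2 * lam₃ c d := by
  simp [lam₃, α₃, α₂]; ring
theorem lam₄_smul : lam₄ (u • c) (v • d) = u ^ 2 * v * lam₄ c d := by
  simp [lam₄, α₁, α₂]; ring

/-! ### The reversed quantities -/

section Reversed

variable (R K x : ℝ) (c d : Fin 3 → ℝ) (a b : Fin 4 → ℝ)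

/-- The numerator `K s c + (1 + x s) d` of the admittance of `(1 + x s) / (K s)` in parallel with
`c / d`. -/
def shuntDen' (K x : ℝ) (c d : Fin 3 → ℝ) : Fin 4 → ℝ :=
  ![d 0, K * c 0 + (d 1 + x * d 0), K * c 1 + (d 2 + x * d 1), K * c 2 + x * d 2]

/-- The numerator of `R + (K s / (1 + x s) + d / c)⁻¹` over `shuntDen' K x c d`. -/
def shuntNum' (R K x : ℝ) (c d : Fin 3 → ℝ) : Fin 4 → ℝ :=
  ![R * shuntDen' K x c d 0 + c 0, R * shuntDen' K x c d 1 + (c 1 + x * c 0),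
    R * shuntDen' K x c d 2 + (c 2 + x * c 1), R * shuntDen' K x c d 3 + x * c 2]

/-- The value `c₀ x² - c₁ x + c₂`. -/
def quadNegRev (c : Fin 3 → ℝ) (x : ℝ) : ℝ := c 0 * x ^ 2 - c 1 * x + c 2

theorem evalNegRev_shuntDen' :
    evalNegRev (shuntDen' K x c d) x = K * quadNegRev c x := by
  simp [evalNegRev, shuntDen', quadNegRev]; ring

theorem evalNegRev_shuntNum' :
    evalNegRev (shuntNum' R K x c d) x = R * (K * quadNegRev c x) := by
  simp [evalNegRev, shuntDen', shuntNum', quadNegRev]; ring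

theorem cVec'_apply (j : Fin 3) : cVec' a b x j =
    -(x ^ 2 * bezoutian a b 0 j - x * bezoutian a b 1 j + bezoutian a b 2 j) := by
  simp [cVec', Matrix.vecMul, dotProduct, Fin.sum_univ_three]; ring

theorem dVec'_apply (j : Fin 3) : dVec' a b x j = -(evalNegRev b x *
    (x ^ 2 * bezoutian b (cPoly' a b x) 0 j - x * bezoutian b (cPoly' a b x) 1 j
      + bezoutian b (cPoly' a b x) 2 j)) := by
  simp [dVec', Matrix.vecMul, dotProduct, Fin.sum_univ_three, -mul_eq_mul_left_iff]; ring

/-- The branch `(1 + xs)/(Ks)` vanishes at `s = -1/x`. For `x > 0`, `evalNegRev p x` is `-x³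
p(-1/x)`; clearing the denominators keeps the case `x = 0` meaningful, as evaluation at infinity.
The argument is then that of `cVec_shunt`. -/
theorem cVec'_shunt : cVec' (shuntNum' R K x c d) (shuntDen' K x c d) x =
    (quadNegRev c x * K) • c := by
  funext j
  rw [cVec'_apply]
  fin_cases j <;> simp [bezoutian, shuntDen', shuntNum', quadNegRev] <;> ring

theorem cTilde'_eq : cTilde' a b x = quadNegRev (cVec' a b x) x := by
  simp [cTilde', quadNegRev]

theorem cTilde'_shunt :
    cTilde' (shuntNum' R K x c d) (shuntDen' K x c d) x = quadNegRev c x ^ 2 * K := by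
  rw [cTilde'_eq, cVec'_shunt]; simp [quadNegRev]; ring

theorem dVec'_shunt : dVec' (shuntNum' R K x c d) (shuntDen' K x c d) x =
    (quadNegRev c x ^ 3 * K ^ 2) • d := by
  funext j
  rw [dVec'_apply, evalNegRev_shuntDen', cPoly', cVec'_shunt]
  fin_cases j <;> simp [bezoutian, shuntDen', quadNegRev] <;> ring

/-- The sign is opposite to that in `R₀_shunt`: for `K > 0`, `R₀ > 0` now forces the form of `α₁`,
`α₂`, `α₃` to be definite. -/
theorem R₀_shunt' : R₀ (shuntNum' R K x c d) (shuntDen' K x c d) =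
    K * quadNegRev c x ^ 2 * (α₁ c d * α₃ c d - α₂ c d ^ 2) := by
  rw [R₀_eq, Matrix.det_fin_three]
  simp [bezoutian, shuntDen', shuntNum', quadNegRev, α₁, α₂, α₃]
  ring

theorem R₀_eq_zero_of_cVec'_eq_zero (h : ∀ j, cVec' a b x j = 0) : R₀ a b = 0 := by
  rw [R₀_eq, neg_eq_zero, ← Matrix.exists_vecMul_eq_zero_iff]
  refine ⟨![x ^ 2, -x, 1], fun h0 => ?_, funext fun j => ?_⟩
  · simpa using congrFun h0 2
  · simpa [cVec'] using h j

theorem cVec'_relation :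
    evalNegRev b x * a 0 - evalNegRev a x * b 0 = cVec' a b x 0 ∧
    evalNegRev b x * a 1 - evalNegRev a x * b 1 = cVec' a b x 1 + x * cVec' a b x 0 ∧
    evalNegRev b x * a 2 - evalNegRev a x * b 2 = cVec' a b x 2 + x * cVec' a b x 1 ∧
    evalNegRev b x * a 3 - evalNegRev a x * b 3 = x * cVec' a b x 2 := by
  simp only [cVec'_apply]
  refine ⟨?_, ?_, ?_, ?_⟩ <;> simp [bezoutian, evalNegRev] <;> ring

theorem dVec'_relation :
    evalNegRev b x * (quadNegRev (cVec' a b x) x * b 0) = dVec' a b x 0 ∧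
    evalNegRev b x * (quadNegRev (cVec' a b x) x * b 1 - evalNegRev b x * cVec' a b x 0)
      = dVec' a b x 1 + x * dVec' a b x 0 ∧
    evalNegRev b x * (quadNegRev (cVec' a b x) x * b 2 - evalNegRev b x * cVec' a b x 1)
      = dVec' a b x 2 + x * dVec' a b x 1 ∧
    evalNegRev b x * (quadNegRev (cVec' a b x) x * b 3 - evalNegRev b x * cVec' a b x 2)
      = x * dVec' a b x 2 := by
  simp only [dVec'_apply]
  generalize hc : cVec' a b x = c
  refine ⟨?_, ?_, ?_, ?_⟩ <;>
    simp [bezoutian, evalNegRev, cPoly', quadNegRev, hc, -mul_eq_mul_left_iff] <;> ring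

variable {R K x c d a b}

theorem shunt'_eq (hb : evalNegRev b x ≠ 0) (hc : quadNegRev (cVec' a b x) x ≠ 0) :
    b = shuntDen' (evalNegRev b x ^ 2 / quadNegRev (cVec' a b x) x) x
      ((1 / evalNegRev b x) • cVec' a b x)
      ((1 / (evalNegRev b x * quadNegRev (cVec' a b x) x)) • dVec' a b x) ∧
    a = shuntNum' (evalNegRev a x / evalNegRev b x)
      (evalNegRev b x ^ 2 / quadNegRev (cVec' a b x) x) x
      ((1 / evalNegRev b x) • cVec' a b x)
      ((1 / (evalNegRev b x * quadNegRev (cVec' a b x) x)) • dVec' a b x) := by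
  obtain ⟨h0, h1, h2, h3⟩ := cVec'_relation x a b
  obtain ⟨k0, k1, k2, k3⟩ := dVec'_relation x a b
  generalize quadNegRev (cVec' a b x) x = q at *
  generalize evalNegRev b x = k at *
  generalize evalNegRev a x = l at *
  generalize cVec' a b x = c at *
  generalize dVec' a b x = d at *
  have key : b = shuntDen' (k ^ 2 / q) x ((1 / k) • c) ((1 / (k * q)) • d) := by
    funext i
    fin_cases i <;> simp [shuntDen'] <;> field_simp <;> linarith
  refine ⟨key, ?_⟩
  funext i
  have e : ∀ i, shuntDen' (k ^ 2 / q) x ((1 / k) • c) ((1 / (k * q)) • d) i = b i :=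
    fun i => congrFun key.symm i
  fin_cases i <;> simp only [shuntNum', e] <;> simp <;> field_simp <;> linarith

end Reversed

/-! ### Consequences of the sign conditions -/

/-- "Same sign" is handled by comparison with a reference value `k`, always the value of `b` at the
zero of the branch. This turns the disjunction into inequalities `0 ≤ k * y`. -/
theorem sameSign_of_mul_nonneg {S : Set ℝ} {k : ℝ} (hk : k ≠ 0) (h : ∀ y ∈ S, 0 ≤ k * y) :
    SameSign S := by
  rcases lt_or_gt_of_ne hk with hk | hk
  · exact Or.inr fun y hy => nonpos_of_mul_nonneg_right (h y hy) hk
  · exact Or.inl fun y hy => nonneg_of_mul_nonneg_right (h y hy) hk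

theorem SameSign.mul_nonneg {S : Set ℝ} (h : SameSign S) {k y : ℝ} (hk : k ∈ S) (hy : y ∈ S) :
    0 ≤ k * y := by
  rcases h with h | h
  · exact _root_.mul_nonneg (h k hk) (h y hy)
  · exact mul_nonneg_of_nonpos_of_nonpos (h k hk) (h y hy)

section

variable {R L x l e : ℝ} {c d : Fin 3 → ℝ} {a b : Fin 4 → ℝ}

theorem commonCond_of_mul_nonneg {k : ℝ} (hab : ∀ i, 0 ≤ a i ∧ 0 ≤ b i) (hk : k ≠ 0)
    (ha : 0 ≤ k * evalNeg a x) (hb : 0 ≤ k * evalNeg b x) (hc : ∀ j, 0 ≤ k * cVec a b x j)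
    (hd : ∀ j, 0 ≤ k * dVec a b x j) (hl : 0 ≤ k * l) (hq : 0 ≤ quadNeg (cVec a b x) x)
    (he : 0 ≤ e) (h0 : 0 < R₀ a b) : CommonCond a b x l e := by
  refine ⟨hab, sameSign_of_mul_nonneg hk ?_, by rwa [evalNeg_cPoly], he, h0⟩
  simp only [Set.mem_insert_iff, Set.mem_singleton_iff, forall_eq_or_imp, forall_eq]
  exact ⟨ha, hb, hc 0, hc 1, hc 2, hd 0, hd 1, hd 2, hl⟩

/-- With reference value `k = c(-x)`, every quantity in the sign clause other than `l`, once
multiplied by `k`, is an even power of `k` times something non-negative. -/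
theorem commonCond_shunt (hx : 0 ≤ x) (hR : 0 ≤ R) (hL : 0 < L) (hc : ∀ j, 0 ≤ c j)
    (hd : ∀ j, 0 ≤ d j) (hk : quadNeg c x ≠ 0)
    (h0 : 0 < R₀ (shuntNum R L x c d) (shuntDen L x c d))
    (hl : 0 ≤ quadNeg c x * l) (he : 0 ≤ e) :
    CommonCond (shuntNum R L x c d) (shuntDen L x c d) x l e := by
  have hden : ∀ i, 0 ≤ shuntDen L x c d i := by
    have := hc 0; have := hc 1; have := hc 2; have := hd 0; have := hd 1; have := hd 2
    intro i; fin_cases i <;> simp [shuntDen] <;> positivity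
  have hnum : ∀ i, 0 ≤ shuntNum R L x c d i := by
    have := hc 0; have := hc 1; have := hc 2
    have := hden 0; have := hden 1; have := hden 2; have := hden 3
    intro i; fin_cases i <;> simp [shuntNum] <;> positivity
  refine commonCond_of_mul_nonneg (k := quadNeg c x) (fun i => ⟨hnum i, hden i⟩) hk ?_ ?_ ?_ ?_
    hl ?_ he h0
  · rw [evalNeg_shuntNum, mul_left_comm]; exact mul_nonneg hR (mul_self_nonneg _)
  · rw [evalNeg_shuntDen]; exact mul_self_nonneg _
  · intro j
    have := hc j
    rw [cVec_shunt, Pi.smul_apply, smul_eq_mul,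
      show quadNeg c x * (quadNeg c x * L * c j) = quadNeg c x ^ 2 * L * c j by ring]
    positivity
  · intro j
    have := hd j
    rw [dVec_shunt, Pi.smul_apply, smul_eq_mul,
      show quadNeg c x * (quadNeg c x ^ 3 * L ^ 2 * d j) = (quadNeg c x ^ 2) ^ 2 * L ^ 2 * d j by
        ring]
    positivity
  · rw [← evalNeg_cPoly, evalNeg_cPoly_shunt]; positivity

/-- A biquadratic `c / d` with non-negative coefficients is regular. -/
def IsRegular (c d : Fin 3 → ℝ) : Prop :=
  (0 ≤ lam₁ c d ∧ 0 ≤ α₂ c d) ∨ (0 ≤ lam₃ c d ∧ 0 ≤ -α₂ c d) ∨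
    (0 ≤ lam₄ c d ∧ 0 ≤ -α₂ c d) ∨ (0 ≤ lam₂ c d ∧ 0 ≤ α₂ c d)

/-- One of `C1`, `C2`, `C3`, `C4` holds. -/
def RegularCond (a b : Fin 4 → ℝ) (x : ℝ) : Prop :=
  C1 a b x ∨ C2 a b x ∨ C3 a b x ∨ C4 a b x

theorem regularCond_shunt (hx : 0 ≤ x) (hR : 0 ≤ R) (hL : 0 < L) (hc : ∀ j, 0 ≤ c j)
    (hd : ∀ j, 0 ≤ d j) (hreg : IsRegular c d) (hα : α₁ c d * α₃ c d ≤ α₂ c d ^ 2)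
    (h0 : R₀ (shuntNum R L x c d) (shuntDen L x c d) ≠ 0) :
    RegularCond (shuntNum R L x c d) (shuntDen L x c d) x := by
  have hk : quadNeg c x ≠ 0 := by
    intro h; apply h0; rw [R₀_shunt, h]; ring
  have hpos : 0 < R₀ (shuntNum R L x c d) (shuntDen L x c d) := by
    refine lt_of_le_of_ne ?_ h0.symm
    rw [R₀_shunt]
    have : 0 ≤ α₂ c d ^ 2 - α₁ c d * α₃ c d := by linarith
    positivity
  have hα₂ : ∀ s : ℝ, 0 ≤ s * α₂ c d →
      0 ≤ s * α₂ (cVec (shuntNum R L x c d) (shuntDen L x c d) x)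
        (dVec (shuntNum R L x c d) (shuntDen L x c d) x) := by
    intro s hs
    rw [cVec_shunt, dVec_shunt, α₂_smul, show s * (quadNeg c x * L * (quadNeg c x ^ 3 * L ^ 2) *
      α₂ c d) = (quadNeg c x ^ 2) ^ 2 * L ^ 3 * (s * α₂ c d) by ring]
    positivity
  have hα₂p := hα₂ 1
  have hα₂n := hα₂ (-1)
  simp only [one_mul, neg_one_mul] at hα₂p hα₂n
  have heven : ∀ (n m : ℕ) (y : ℝ), 0 ≤ y → 0 ≤ (quadNeg c x ^ n) ^ 2 * L ^ m * y :=
    fun n m y hy => by positivity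
  rcases hreg with ⟨h1, h2⟩ | ⟨h1, h2⟩ | ⟨h1, h2⟩ | ⟨h1, h2⟩
  · refine Or.inl (commonCond_shunt hx hR hL hc hd hk hpos ?_ (hα₂p h2))
    rw [cVec_shunt, dVec_shunt, lam₁_smul]
    refine (heven 4 5 _ h1).trans_eq (by ring)
  · refine Or.inr (Or.inl (commonCond_shunt hx hR hL hc hd hk hpos ?_ (hα₂n h2)))
    rw [cVec_shunt, dVec_shunt, lam₃_smul]
    refine (heven 4 5 _ h1).trans_eq (by ring)
  · refine Or.inr (Or.inr (Or.inl (commonCond_shunt hx hR hL hc hd hk hpos ?_ (hα₂n h2))))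
    rw [cVec_shunt, dVec_shunt, lam₄_smul]
    refine (heven 3 4 _ h1).trans_eq (by ring)
  · refine Or.inr (Or.inr (Or.inr (commonCond_shunt hx hR hL hc hd hk hpos ?_ (hα₂p h2))))
    rw [cVec_shunt, dVec_shunt, lam₂_smul]
    refine (heven 3 4 _ h1).trans_eq (by ring)

theorem CommonCond.nonneg_mul (h : CommonCond a b x l e) :
    0 ≤ evalNeg b x * evalNeg a x ∧ (∀ j, 0 ≤ evalNeg b x * cVec a b x j) ∧
      (∀ j, 0 ≤ evalNeg b x * dVec a b x j) ∧ 0 ≤ evalNeg b x * l := by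
  have hs := h.2.1
  refine ⟨hs.mul_nonneg ?_ ?_, fun j => ?_, fun j => ?_, hs.mul_nonneg ?_ ?_⟩
  iterate 2 simp
  · fin_cases j <;> exact hs.mul_nonneg (by simp) (by simp)
  · fin_cases j <;> exact hs.mul_nonneg (by simp) (by simp)
  iterate 2 simp

/-- If `b(-x) = 0`, then `-a(-x) b(s) = (s + x) c(s)`. Multiplied by `a(-x)`, the left side has
non-positive and the right side non-negative coefficients. Both vanish, so `c = 0`, which
contradicts `R₀ > 0`. -/
theorem CommonCond.evalNeg_ne_zero (h : CommonCond a b x l e) (hx : 0 ≤ x) :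
    evalNeg b x ≠ 0 := by
  intro hb
  have hs := h.2.1
  obtain ⟨h0, h1, h2, h3⟩ := cVec_relation x a b
  rw [hb] at h0 h1 h2 h3
  have k0 : 0 ≤ evalNeg a x * cVec a b x 0 := hs.mul_nonneg (by simp) (by simp)
  have k1 : 0 ≤ evalNeg a x * cVec a b x 1 := hs.mul_nonneg (by simp) (by simp)
  have k2 : 0 ≤ evalNeg a x * cVec a b x 2 := hs.mul_nonneg (by simp) (by simp)
  have b0 := (h.1 0).2
  have b1 := (h.1 1).2
  have b2 := (h.1 2).2
  have b3 := (h.1 3).2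
  have e0 : evalNeg a x * b 0 = 0 := by
    have : evalNeg a x * (evalNeg a x * b 0) = -(x * (evalNeg a x * cVec a b x 0)) := by
      linear_combination -evalNeg a x * h0
    have : 0 ≤ x * (evalNeg a x * cVec a b x 0) := by positivity
    have : 0 ≤ evalNeg a x ^ 2 * b 0 := by positivity
    have : evalNeg a x ^ 2 * b 0 = 0 := by nlinarith
    simpa using this
  have e1 : evalNeg a x * b 1 = 0 := by
    have : evalNeg a x * (evalNeg a x * b 1) = -(evalNeg a x * cVec a b x 0)
        - x * (evalNeg a x * cVec a b x 1) := by
      linear_combination -evalNeg a x * h1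
    have : 0 ≤ x * (evalNeg a x * cVec a b x 1) := by positivity
    have : 0 ≤ evalNeg a x ^ 2 * b 1 := by positivity
    have : evalNeg a x ^ 2 * b 1 = 0 := by nlinarith
    simpa using this
  have e2 : evalNeg a x * b 2 = 0 := by
    have : evalNeg a x * (evalNeg a x * b 2) = -(evalNeg a x * cVec a b x 1)
        - x * (evalNeg a x * cVec a b x 2) := by
      linear_combination -evalNeg a x * h2
    have : 0 ≤ x * (evalNeg a x * cVec a b x 2) := by positivity
    have : 0 ≤ evalNeg a x ^ 2 * b 2 := by positivity
    have : evalNeg a x ^ 2 * b 2 = 0 := by nlinarith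
    simpa using this
  have e3 : evalNeg a x * b 3 = 0 := by
    have : evalNeg a x * (evalNeg a x * b 3) = -(evalNeg a x * cVec a b x 2) := by
      linear_combination -evalNeg a x * h3
    have : 0 ≤ evalNeg a x ^ 2 * b 3 := by positivity
    have : evalNeg a x ^ 2 * b 3 = 0 := by nlinarith
    simpa using this
  have c2 : cVec a b x 2 = 0 := by linarith
  have c1 : cVec a b x 1 = 0 := by rw [c2] at h2; linarith
  have c0 : cVec a b x 0 = 0 := by rw [c1] at h1; linarith
  exact h.2.2.2.2.ne' (R₀_eq_zero_of_cVec_eq_zero x a b fun j => by fin_cases j <;> assumption)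

/-- If `c(-x) = 0`, the relation for `d` becomes `-b(-x)² c(s) = (s + x) d(s)`. The two sides have
opposite signs relative to `b(-x)`, so again `c = 0`. -/
theorem CommonCond.quadNeg_pos (h : CommonCond a b x l e) (hx : 0 ≤ x) :
    0 < quadNeg (cVec a b x) x := by
  have hb := h.evalNeg_ne_zero hx
  obtain ⟨-, hc, hd, -⟩ := h.nonneg_mul
  refine lt_of_le_of_ne (by simpa [evalNeg_cPoly] using h.2.2.1) fun hq => ?_
  obtain ⟨h0, h1, h2, h3⟩ := dVec_relation x a b
  rw [← hq] at h0 h1 h2 h3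
  have key : ∀ j, evalNeg b x ^ 2 * (evalNeg b x * cVec a b x j) ≤ 0 → cVec a b x j = 0 := by
    intro j hj
    have h2 : 0 < evalNeg b x ^ 2 := by positivity
    have h3 : evalNeg b x * cVec a b x j = 0 := le_antisymm (by nlinarith) (hc j)
    simpa [hb] using h3
  refine h.2.2.2.2.ne' (R₀_eq_zero_of_cVec_eq_zero x a b fun j => key j ?_)
  have d0 := hd 0
  have d1 := _root_.mul_nonneg hx (hd 1)
  have d1' := hd 1
  have d2 := _root_.mul_nonneg hx (hd 2)
  have d0' := _root_.mul_nonneg hx (hd 0)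
  fin_cases j
  · have : evalNeg b x ^ 2 * (evalNeg b x * cVec a b x 0) =
        -(x * (evalNeg b x * dVec a b x 0)) := by
      linear_combination -evalNeg b x * h0
    show evalNeg b x ^ 2 * (evalNeg b x * cVec a b x 0) ≤ 0
    linarith
  · have : evalNeg b x ^ 2 * (evalNeg b x * cVec a b x 1) =
        -(evalNeg b x * dVec a b x 0 + x * (evalNeg b x * dVec a b x 1)) := by
      linear_combination -evalNeg b x * h1
    show evalNeg b x ^ 2 * (evalNeg b x * cVec a b x 1) ≤ 0
    linarith
  · have : evalNeg b x ^ 2 * (evalNeg b x * cVec a b x 2) =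
        -(evalNeg b x * dVec a b x 1 + x * (evalNeg b x * dVec a b x 2)) := by
      linear_combination -evalNeg b x * h2
    show evalNeg b x ^ 2 * (evalNeg b x * cVec a b x 2) ≤ 0
    linarith

/-- `R₀ > 0` read through the shunt form of `a` and `b`; rescaling `c` and `d` multiplies both sides
by the same square. -/
theorem CommonCond.α_lt (h : CommonCond a b x l e) (hx : 0 ≤ x) :
    α₁ (cVec a b x) (dVec a b x) * α₃ (cVec a b x) (dVec a b x)
      < α₂ (cVec a b x) (dVec a b x) ^ 2 := by
  have hb := h.evalNeg_ne_zero hx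
  have hq := h.quadNeg_pos hx
  have h0 := h.2.2.2.2
  obtain ⟨eb, ea⟩ := shunt_eq hb hq.ne'
  have hR := R₀_shunt (evalNeg a x / evalNeg b x) (quadNeg (cVec a b x) x / evalNeg b x ^ 2) x
      ((evalNeg b x / quadNeg (cVec a b x) x) • cVec a b x)
      ((evalNeg b x / quadNeg (cVec a b x) x ^ 2) • dVec a b x)
  rw [← ea, ← eb, α₁_smul, α₂_smul, α₃_smul] at hR
  by_contra! hle
  refine absurd h0 (not_lt.2 ?_)
  generalize α₁ (cVec a b x) (dVec a b x) = A₁ at *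
  generalize α₂ (cVec a b x) (dVec a b x) = A₂ at *
  generalize α₃ (cVec a b x) (dVec a b x) = A₃ at *
  generalize quadNeg ((evalNeg b x / quadNeg (cVec a b x) x) • cVec a b x) x = r at *
  generalize evalNeg b x / quadNeg (cVec a b x) x ^ 2 = v at *
  have hL : 0 ≤ quadNeg (cVec a b x) x / evalNeg b x ^ 2 := by positivity
  generalize quadNeg (cVec a b x) x / evalNeg b x ^ 2 = L at *
  generalize evalNeg b x / quadNeg (cVec a b x) x = u at *
  have : 0 ≤ L ^ 5 * r ^ 2 * (u * v) ^ 2 * (A₁ * A₃ - A₂ ^ 2) :=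
    mul_nonneg (by positivity) (by linarith)
  rw [hR]
  linarith

/-! ### The realizability conditions in the open part of the parameter range -/

/-- Away from the equalities of clause (1), the inequalities for `c` and `d` are strict. The
exception is `α₂ ≥ 0`, but if `α₂ = 0` then `λ₃ > 0`, so the regularity test survives a perturbation
in either direction. -/
theorem regular_strict {c₀ c₁ c₂ d₀ d₁ d₂ : ℝ} (hc₀ : 0 ≤ c₀) (hc₁ : 0 ≤ c₁) (hd₀ : 0 ≤ d₀)
    (hd₁ : 0 ≤ d₁) (hd₂ : 0 ≤ d₂)
    (h₁ : 0 ≤ d₁ * (c₁ * d₀ - c₀ * d₁) - d₀ * (c₂ * d₀ - c₀ * d₂))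
    (h₂ : 0 ≤ c₂ * d₀ - c₀ * d₂)
    (hα : (c₁ * d₀ - c₀ * d₁) * (c₂ * d₁ - c₁ * d₂) < (c₂ * d₀ - c₀ * d₂) ^ 2)
    (hl : d₁ * (c₁ * d₀ - c₀ * d₁) - d₀ * (c₂ * d₀ - c₀ * d₂) ≠ 0) (hc : c₀ ≠ 0) :
    0 < c₀ ∧ 0 < c₁ ∧ 0 < c₂ ∧ 0 < d₀ ∧ 0 < d₁ ∧ 0 < d₂ ∧
      0 < d₁ * (c₁ * d₀ - c₀ * d₁) - d₀ * (c₂ * d₀ - c₀ * d₂) ∧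
      (0 < c₂ * d₀ - c₀ * d₂ ∨
        0 < d₂ * (c₂ * d₀ - c₀ * d₂) - d₁ * (c₂ * d₁ - c₁ * d₂)) := by
  have l₁ := lt_of_le_of_ne h₁ hl.symm
  have p₀ := lt_of_le_of_ne hc₀ hc.symm
  have hm : 0 ≤ d₀ * (c₂ * d₀ - c₀ * d₂) := mul_nonneg hd₀ h₂
  have q₁ : 0 < d₁ := by
    refine lt_of_le_of_ne hd₁ fun h => ?_
    rw [← h] at l₁
    linarith
  have a₁ : 0 < c₁ * d₀ - c₀ * d₁ := by
    by_contra! h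
    have := mul_nonpos_of_nonneg_of_nonpos hd₁ h
    linarith
  have hm' : 0 < c₁ * d₀ := by linarith [mul_pos p₀ q₁]
  have p₁ : 0 < c₁ := pos_of_mul_pos_left hm' hd₀
  have q₀ : 0 < d₀ := pos_of_mul_pos_right hm' hc₁
  -- If `d₂ = 0`, then `α₂λ₁ = d₀(α₁α₃ - α₂²)`; the left side is non-negative and the right side
  -- negative.
  have q₂ : 0 < d₂ := by
    refine lt_of_le_of_ne hd₂ fun h => ?_
    have k₁ := mul_nonneg h₂ l₁.le
    have k₂ := mul_pos q₀ (sub_pos.2 hα)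
    rw [← h] at k₁ k₂
    nlinarith
  have p₂ : 0 < c₂ := by
    have : 0 < c₂ * d₀ := by linarith [mul_pos p₀ q₂]
    exact pos_of_mul_pos_left this hd₀
  refine ⟨p₀, p₁, p₂, q₀, q₁, q₂, l₁, ?_⟩
  rcases h₂.lt_or_eq with h | h
  · exact Or.inl h
  · right
    -- With `α₂ = 0` the discriminant inequality reads `α₁α₃ < 0`. Since `α₁ > 0`, this gives `α₃ <
    -- 0` and `λ₃ = -d₁α₃ > 0`.
    rw [← h] at hα ⊢
    have : c₂ * d₁ - c₁ * d₂ < 0 := by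
      by_contra! h'
      linarith [mul_nonneg a₁.le h']
    have := mul_neg_of_pos_of_neg q₁ this
    linarith

/-- The strict form of the alternatives in `RegularCond`, as an open condition. -/
def StrictRegular (c d : Fin 3 → ℝ) : Prop :=
  (0 < lam₁ c d ∧ (0 < α₂ c d ∨ 0 < lam₃ c d)) ∨ (0 < lam₃ c d ∧ (0 < -α₂ c d ∨ 0 < lam₁ c d)) ∨
    (0 < lam₄ c d ∧ (0 < -α₂ c d ∨ 0 < lam₂ c d)) ∨ (0 < lam₂ c d ∧ (0 < α₂ c d ∨ 0 < lam₄ c d))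

/-- Whichever sign `α₂` has, each clause supplies a positive `λ` that matches it. -/
theorem StrictRegular.isRegular (h : StrictRegular c d) : IsRegular c d := by
  unfold StrictRegular at h
  unfold IsRegular
  rcases le_total 0 (α₂ c d) with h0 | h0
  · have h0' : ¬ 0 < -α₂ c d := by linarith
    simp only [h0', false_or] at h
    rcases h with h | h | h | h
    · exact Or.inl ⟨h.1.le, h0⟩
    · exact Or.inl ⟨h.2.le, h0⟩
    · exact Or.inr (Or.inr (Or.inr ⟨h.2.le, h0⟩))
    · exact Or.inr (Or.inr (Or.inr ⟨h.1.le, h0⟩))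
  · have h0' : ¬ 0 < α₂ c d := by linarith
    have h1 : 0 ≤ -α₂ c d := by linarith
    simp only [h0', false_or] at h
    rcases h with h | h | h | h
    · exact Or.inr (Or.inl ⟨h.2.le, h1⟩)
    · exact Or.inr (Or.inl ⟨h.1.le, h1⟩)
    · exact Or.inr (Or.inr (Or.inl ⟨h.1.le, h1⟩))
    · exact Or.inr (Or.inr (Or.inl ⟨h.2.le, h1⟩))

/-- Three symmetries reduce the four cases to `regular_strict`: reversing the indices exchanges `λ₁`
with `λ₃`, interchanging `c` and `d` exchanges `λ₁` with `λ₄`, and doing both exchanges `λ₁` with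
`λ₂`. Each of the first two changes the sign of `α₂`. -/
theorem strictRegular_of_alternatives (hc : ∀ j, 0 ≤ c j) (hd : ∀ j, 0 ≤ d j)
    (hα : α₁ c d * α₃ c d < α₂ c d ^ 2)
    (h : (0 ≤ lam₁ c d ∧ 0 ≤ α₂ c d ∧ lam₁ c d ≠ 0 ∧ c 0 ≠ 0) ∨
      (0 ≤ lam₃ c d ∧ 0 ≤ -α₂ c d ∧ lam₃ c d ≠ 0 ∧ c 2 ≠ 0) ∨
      (0 ≤ lam₄ c d ∧ 0 ≤ -α₂ c d ∧ lam₄ c d ≠ 0 ∧ d 0 ≠ 0) ∨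
      (0 ≤ lam₂ c d ∧ 0 ≤ α₂ c d ∧ lam₂ c d ≠ 0 ∧ d 2 ≠ 0)) :
    (∀ j, 0 < c j) ∧ (∀ j, 0 < d j) ∧ StrictRegular c d := by
  have hc0 := hc 0
  have hc1 := hc 1
  have hc2 := hc 2
  have hd0 := hd 0
  have hd1 := hd 1
  have hd2 := hd 2
  simp only [lam₁, lam₂, lam₃, lam₄, StrictRegular, α₁, α₂, α₃, Fin.forall_fin_succ,
    Fin.succ_zero_eq_one, Fin.succ_one_eq_two] at *
  generalize c 0 = c₀ at *
  generalize c 1 = c₁ at *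
  generalize c 2 = c₂ at *
  generalize d 0 = d₀ at *
  generalize d 1 = d₁ at *
  generalize d 2 = d₂ at *
  rcases h with ⟨h1, h2, h3, h4⟩ | ⟨h1, h2, h3, h4⟩ | ⟨h1, h2, h3, h4⟩ | ⟨h1, h2, h3, h4⟩
  · obtain ⟨p0, p1, p2, q0, q1, q2, hl, hr⟩ := regular_strict hc0 hc1 hd0 hd1 hd2 h1 h2 hα h3 h4
    exact ⟨by simp [*], by simp [*], Or.inl ⟨hl, hr⟩⟩
  · have e : d₁ * (c₁ * d₂ - c₂ * d₁) - d₂ * (c₀ * d₂ - c₂ * d₀) =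
      d₂ * (c₂ * d₀ - c₀ * d₂) - d₁ * (c₂ * d₁ - c₁ * d₂) := by ring
    obtain ⟨p2, p1, p0, q2, q1, q0, hl, hr⟩ := regular_strict (c₀ := c₂) (c₁ := c₁) (c₂ := c₀)
      (d₀ := d₂) (d₁ := d₁) (d₂ := d₀) hc2 hc1 hd2 hd1 hd0 (by rwa [e]) (by linarith)
      (by linarith) (by rwa [e]) h4
    exact ⟨by simp [*], by simp [*], Or.inr (Or.inl ⟨by rwa [← e],
      hr.imp (fun h => by linarith) (fun h => by linarith)⟩)⟩
  · have e : c₁ * (d₁ * c₀ - d₀ * c₁) - c₀ * (d₂ * c₀ - d₀ * c₂) =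
      c₀ * (c₂ * d₀ - c₀ * d₂) - c₁ * (c₁ * d₀ - c₀ * d₁) := by ring
    obtain ⟨q0, q1, q2, p0, p1, p2, hl, hr⟩ := regular_strict (c₀ := d₀) (c₁ := d₁) (c₂ := d₂)
      (d₀ := c₀) (d₁ := c₁) (d₂ := c₂) hd0 hd1 hc0 hc1 hc2 (by rwa [e]) (by linarith)
      (by linarith) (by rwa [e]) h4
    exact ⟨by simp [*], by simp [*], Or.inr (Or.inr (Or.inl ⟨by rwa [← e],
      hr.imp (fun h => by linarith) (fun h => by linarith)⟩))⟩
  · have e : c₁ * (d₁ * c₂ - d₂ * c₁) - c₂ * (d₀ * c₂ - d₂ * c₀) =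
      c₁ * (c₂ * d₁ - c₁ * d₂) - c₂ * (c₂ * d₀ - c₀ * d₂) := by ring
    obtain ⟨q2, q1, q0, p2, p1, p0, hl, hr⟩ := regular_strict (c₀ := d₂) (c₁ := d₁) (c₂ := d₀)
      (d₀ := c₂) (d₁ := c₁) (d₂ := c₀) hd2 hd1 hc2 hc1 hc0 (by rwa [e]) (by linarith)
      (by linarith) (by rwa [e]) h4
    exact ⟨by simp [*], by simp [*], Or.inr (Or.inr (Or.inr ⟨by rwa [← e],
      hr.imp (fun h => by linarith) (fun h => by linarith)⟩))⟩

end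

/-! ### Decreasing `x` to the boundary -/

section

variable {x l e : ℝ} {a b : Fin 4 → ℝ}

theorem isClosed_or {p q : ℝ → Prop} (hp : IsClosed {x | p x}) (hq : IsClosed {x | q x}) :
    IsClosed {x | p x ∨ q x} := hp.union hq

theorem isOpen_or {p q : ℝ → Prop} (hp : IsOpen {x | p x}) (hq : IsOpen {x | q x}) :
    IsOpen {x | p x ∨ q x} := hp.union hq

theorem continuous_evalNeg (p : Fin 4 → ℝ) : Continuous (evalNeg p) := by
  unfold evalNeg; fun_prop

theorem continuous_cVec (a b : Fin 4 → ℝ) (j : Fin 3) : Continuous fun x => cVec a b x j := by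
  simp only [cVec_apply]; fun_prop

theorem continuous_dVec (a b : Fin 4 → ℝ) (j : Fin 3) : Continuous fun x => dVec a b x j := by
  have h0 := continuous_cVec a b 0
  have h1 := continuous_cVec a b 1
  have h2 := continuous_cVec a b 2
  have hb := continuous_evalNeg b
  simp only [dVec_apply]
  fin_cases j <;> simp [bezoutian, cPoly] <;> fun_prop

theorem continuous_quadNeg (c : Fin 3 → ℝ) : Continuous (quadNeg c) := by
  unfold quadNeg; fun_prop

theorem continuous_quadNeg_cVec (a b : Fin 4 → ℝ) :
    Continuous fun x => quadNeg (cVec a b x) x := by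
  have h0 := continuous_cVec a b 0
  have h1 := continuous_cVec a b 1
  have h2 := continuous_cVec a b 2
  unfold quadNeg; fun_prop

section

variable {c d : ℝ → Fin 3 → ℝ}


theorem continuous_α₂ (hc : ∀ j, Continuous fun x => c x j)
    (hd : ∀ j, Continuous fun x => d x j) : Continuous fun x => α₂ (c x) (d x) := by
  have := hc 0; have := hc 2; have := hd 0; have := hd 2
  unfold α₂; fun_prop

theorem continuous_lam₁ (hc : ∀ j, Continuous fun x => c x j)
    (hd : ∀ j, Continuous fun x => d x j) : Continuous fun x => lam₁ (c x) (d x) := by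
  have := hc 0; have := hc 1; have := hc 2; have := hd 0; have := hd 1; have := hd 2
  unfold lam₁ α₁ α₂; fun_prop

theorem continuous_lam₂ (hc : ∀ j, Continuous fun x => c x j)
    (hd : ∀ j, Continuous fun x => d x j) : Continuous fun x => lam₂ (c x) (d x) := by
  have := hc 0; have := hc 1; have := hc 2; have := hd 0; have := hd 1; have := hd 2
  unfold lam₂ α₃ α₂; fun_prop

theorem continuous_lam₃ (hc : ∀ j, Continuous fun x => c x j)
    (hd : ∀ j, Continuous fun x => d x j) : Continuous fun x => lam₃ (c x) (d x) := by
  have := hc 0; have := hc 1; have := hc 2; have := hd 0; have := hd 1; have := hd 2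
  unfold lam₃ α₃ α₂; fun_prop

theorem continuous_lam₄ (hc : ∀ j, Continuous fun x => c x j)
    (hd : ∀ j, Continuous fun x => d x j) : Continuous fun x => lam₄ (c x) (d x) := by
  have := hc 0; have := hc 1; have := hc 2; have := hd 0; have := hd 1; have := hd 2
  unfold lam₄ α₁ α₂; fun_prop

end

theorem isClosed_commonCond {l e : ℝ → ℝ} (hl : Continuous l) (he : Continuous e) :
    IsClosed {x | CommonCond a b x (l x) (e x)} := by
  have ha := continuous_evalNeg a
  have hb := continuous_evalNeg b
  have hc := continuous_cVec a b
  have hd := continuous_dVec a b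
  have hq := continuous_quadNeg_cVec a b
  simp only [CommonCond, SameSign, Set.mem_insert_iff, Set.mem_singleton_iff, forall_eq_or_imp,
    forall_eq, evalNeg_cPoly]
  have hp : ∀ {f : ℝ → ℝ}, Continuous f → IsClosed {x | 0 ≤ f x} :=
    fun hf => isClosed_le continuous_const hf
  have hn : ∀ {f : ℝ → ℝ}, Continuous f → IsClosed {x | f x ≤ 0} :=
    fun hf => isClosed_le hf continuous_const
  refine isClosed_const.and ((isClosed_or ?_ ?_).and ((hp hq).and ((hp he).and isClosed_const)))
  · exact (hp ha).and ((hp hb).and ((hp (hc 0)).and ((hp (hc 1)).and ((hp (hc 2)).and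
      ((hp (hd 0)).and ((hp (hd 1)).and ((hp (hd 2)).and (hp hl))))))))
  · exact (hn ha).and ((hn hb).and ((hn (hc 0)).and ((hn (hc 1)).and ((hn (hc 2)).and
      ((hn (hd 0)).and ((hn (hd 1)).and ((hn (hd 2)).and (hn hl))))))))

theorem isClosed_regularCond (a b : Fin 4 → ℝ) : IsClosed {x | RegularCond a b x} := by
  have hc := continuous_cVec a b
  have hd := continuous_dVec a b
  exact isClosed_or (isClosed_commonCond (continuous_lam₁ hc hd) (continuous_α₂ hc hd))
    (isClosed_or (isClosed_commonCond (continuous_lam₃ hc hd) (continuous_α₂ hc hd).neg)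
    (isClosed_or (isClosed_commonCond (continuous_lam₄ hc hd) (continuous_α₂ hc hd).neg)
    (isClosed_commonCond (continuous_lam₂ hc hd) (continuous_α₂ hc hd))))

/-- The identity behind the monotonicity of `x ↦ a(-x) / b(-x)`. -/
theorem evalNeg_mul_sub (a b : Fin 4 → ℝ) (x y : ℝ) :
    evalNeg b x * evalNeg a y - evalNeg a x * evalNeg b y = (x - y) * quadNeg (cVec a b x) y := by
  simp only [quadNeg, cVec_apply]
  simp [bezoutian, evalNeg]
  ring

theorem strictRegular_smul {k : ℝ} (hk : k ≠ 0) (c d : Fin 3 → ℝ) :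
    StrictRegular (k • c) (k • d) ↔ 
    (0 < k * lam₁ c d ∧ (0 < α₂ c d ∨ 0 < k * lam₃ c d)) ∨
    (0 < k * lam₃ c d ∧ (0 < -α₂ c d ∨ 0 < k * lam₁ c d)) ∨
    (0 < k * lam₄ c d ∧ (0 < -α₂ c d ∨ 0 < k * lam₂ c d)) ∨
    (0 < k * lam₂ c d ∧ (0 < α₂ c d ∨ 0 < k * lam₄ c d)) := by
  have h2 : 0 < k ^ 2 := by positivity
  have e : ∀ y, 0 < k * k ^ 2 * y ↔ 0 < k * y := fun y => by
    rw [mul_comm k, mul_assoc, mul_pos_iff_of_pos_left h2]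
  have e' : ∀ y, 0 < k ^ 2 * k * y ↔ 0 < k * y := fun y => by
    rw [mul_assoc, mul_pos_iff_of_pos_left h2]
  have f : 0 < k * k * α₂ c d ↔ 0 < α₂ c d := by rw [← sq, mul_pos_iff_of_pos_left h2]
  have f' : 0 < -(k * k * α₂ c d) ↔ 0 < -α₂ c d := by
    rw [← sq, ← mul_neg, mul_pos_iff_of_pos_left h2]
  simp only [StrictRegular, lam₁_smul, lam₂_smul, lam₃_smul, lam₄_smul, α₂_smul, e, e', f, f']

theorem regularCond_of_strictRegular {k : ℝ} (hab : ∀ i, 0 ≤ a i ∧ 0 ≤ b i) (hk : k ≠ 0)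
    (ha : 0 ≤ k * evalNeg a x) (hb : 0 ≤ k * evalNeg b x) (hc : ∀ j, 0 ≤ k * cVec a b x j)
    (hd : ∀ j, 0 ≤ k * dVec a b x j) (hq : 0 ≤ quadNeg (cVec a b x) x)
    (hs : StrictRegular (k • cVec a b x) (k • dVec a b x)) (h0 : 0 < R₀ a b) :
    RegularCond a b x := by
  have h2 : 0 < k ^ 2 := by positivity
  have e : ∀ y, 0 ≤ k * k ^ 2 * y → 0 ≤ k * y := fun y h => by
    rwa [mul_comm k, mul_assoc, mul_nonneg_iff_of_pos_left h2] at h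
  have e' : ∀ y, 0 ≤ k ^ 2 * k * y → 0 ≤ k * y := fun y h => by
    rwa [mul_assoc, mul_nonneg_iff_of_pos_left h2] at h
  have hr := hs.isRegular
  simp only [IsRegular, lam₁_smul, lam₂_smul, lam₃_smul, lam₄_smul, α₂_smul] at hr
  have f : ∀ y, 0 ≤ k * k * y → 0 ≤ y := fun y h => by
    rwa [← sq, mul_nonneg_iff_of_pos_left h2] at h
  have f' : ∀ y, 0 ≤ -(k * k * y) → 0 ≤ -y := fun y h => by
    rwa [← sq, ← mul_neg, mul_nonneg_iff_of_pos_left h2] at h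
  rcases hr with h | h | h | h
  · exact Or.inl (commonCond_of_mul_nonneg hab hk ha hb hc hd (e _ h.1) hq (f _ h.2) h0)
  · exact Or.inr (Or.inl
      (commonCond_of_mul_nonneg hab hk ha hb hc hd (e _ h.1) hq (f' _ h.2) h0))
  · exact Or.inr (Or.inr (Or.inl
      (commonCond_of_mul_nonneg hab hk ha hb hc hd (e' _ h.1) hq (f' _ h.2) h0)))
  · exact Or.inr (Or.inr (Or.inr
      (commonCond_of_mul_nonneg hab hk ha hb hc hd (e' _ h.1) hq (f _ h.2) h0)))

/-- Strict inequalities persist at nearby `y < x` by continuity. The one inequality that may be an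
equality at `x` is the sign of `a(-x)`, which is carried by `evalNeg_mul_sub`. -/
theorem CommonCond.exists_lt (h : CommonCond a b x l e) (hx : 0 < x)
    (hs : (∀ j, 0 < (evalNeg b x • cVec a b x) j) ∧ (∀ j, 0 < (evalNeg b x • dVec a b x) j) ∧
      StrictRegular (evalNeg b x • cVec a b x) (evalNeg b x • dVec a b x)) :
    ∃ y, 0 ≤ y ∧ y < x ∧ RegularCond a b y := by
  obtain ⟨hc, hd, hr⟩ := hs
  have hb := h.evalNeg_ne_zero hx.le
  have hq := h.quadNeg_pos hx.le
  obtain ⟨ha, -, -, -⟩ := h.nonneg_mul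
  set k := evalNeg b x with hk
  have hC := continuous_cVec a b
  have hD := continuous_dVec a b
  have hop : ∀ {f : ℝ → ℝ}, Continuous f → IsOpen {x | 0 < f x} :=
    fun hf => isOpen_lt continuous_const hf
  have hα := continuous_α₂ hC hD
  have h1 := (continuous_lam₁ hC hD).const_mul k
  have h2 := (continuous_lam₂ hC hD).const_mul k
  have h3 := (continuous_lam₃ hC hD).const_mul k
  have h4 := (continuous_lam₄ hC hD).const_mul k
  have hSR : IsOpen {y | StrictRegular (k • cVec a b y) (k • dVec a b y)} := by
    simp only [strictRegular_smul hb]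
    exact isOpen_or ((hop h1).and (isOpen_or (hop hα) (hop h3)))
      (isOpen_or ((hop h3).and (isOpen_or (hop hα.neg) (hop h1)))
      (isOpen_or ((hop h4).and (isOpen_or (hop hα.neg) (hop h2)))
      ((hop h2).and (isOpen_or (hop hα) (hop h4)))))
  have ev : ∀ᶠ y in nhds x, 0 < y ∧ 0 < k * evalNeg b y ∧ 0 < quadNeg (cVec a b x) y ∧
      (∀ j, 0 < k * cVec a b y j) ∧ (∀ j, 0 < k * dVec a b y j) ∧
      0 < quadNeg (cVec a b y) y ∧ StrictRegular (k • cVec a b y) (k • dVec a b y) := by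
    refine (eventually_gt_nhds hx).and (.and ?_ (.and ?_ (.and ?_ (.and ?_ (.and ?_ ?_)))))
    · exact (hop ((continuous_evalNeg b).const_mul k)).mem_nhds (mul_self_pos.2 hb)
    · exact (hop (continuous_quadNeg _)).mem_nhds hq
    · exact Filter.eventually_all.2 fun j => (hop ((hC j).const_mul k)).mem_nhds (hc j)
    · exact Filter.eventually_all.2 fun j => (hop ((hD j).const_mul k)).mem_nhds (hd j)
    · exact (hop (continuous_quadNeg_cVec a b)).mem_nhds hq
    · exact hSR.mem_nhds hr
  obtain ⟨y, ⟨hy0, hy1, hy2, hy3, hy4, hy5, hy6⟩, hyx⟩ :=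
    ((ev.filter_mono nhdsWithin_le_nhds).and (self_mem_nhdsWithin (s := Set.Iio x))).exists
  refine ⟨y, hy0.le, hyx, regularCond_of_strictRegular h.1 hb ?_ hy1.le (fun j => (hy3 j).le)
    (fun j => (hy4 j).le) hy5.le hy6 h.2.2.2.2⟩
  -- Here `k a(-y) = a(-x) b(-y) + (x - y) c(-y)`, and the last term is positive precisely because
  -- `y` lies to the left of `x`.
  have hid := evalNeg_mul_sub a b x y
  have h5 : 0 < (x - y) * quadNeg (cVec a b x) y := mul_pos (sub_pos.2 hyx) hy2
  have h6 : 0 ≤ evalNeg a x * evalNeg b y := by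
    have : 0 ≤ k ^ 2 * (evalNeg a x * evalNeg b y) := by
      have := mul_nonneg ha hy1.le
      linarith
    exact (mul_nonneg_iff_of_pos_left (by positivity)).1 this
  rw [← hk] at hid
  linarith

theorem CommonCond.strictRegular_of_alternatives (h : CommonCond a b x l e) (hx : 0 ≤ x)
    (hs : ∀ k : ℝ, 0 ≤ k * l → k ≠ 0 → 
      (0 ≤ k * k ^ 2 * lam₁ (cVec a b x) (dVec a b x) ∧ 0 ≤ k * k * α₂ (cVec a b x) (dVec a b x)
        ∧ k * k ^ 2 * lam₁ (cVec a b x) (dVec a b x) ≠ 0 ∧ k * cVec a b x 0 ≠ 0) ∨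
      (0 ≤ k * k ^ 2 * lam₃ (cVec a b x) (dVec a b x) ∧ 0 ≤ -(k * k * α₂ (cVec a b x) (dVec a b x))
        ∧ k * k ^ 2 * lam₃ (cVec a b x) (dVec a b x) ≠ 0 ∧ k * cVec a b x 2 ≠ 0) ∨
      (0 ≤ k ^ 2 * k * lam₄ (cVec a b x) (dVec a b x) ∧ 0 ≤ -(k * k * α₂ (cVec a b x) (dVec a b x))
        ∧ k ^ 2 * k * lam₄ (cVec a b x) (dVec a b x) ≠ 0 ∧ k * dVec a b x 0 ≠ 0) ∨
      (0 ≤ k ^ 2 * k * lam₂ (cVec a b x) (dVec a b x) ∧ 0 ≤ k * k * α₂ (cVec a b x) (dVec a b x)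
        ∧ k ^ 2 * k * lam₂ (cVec a b x) (dVec a b x) ≠ 0 ∧ k * dVec a b x 2 ≠ 0)) :
    (∀ j, 0 < (evalNeg b x • cVec a b x) j) ∧ (∀ j, 0 < (evalNeg b x • dVec a b x) j) ∧
      StrictRegular (evalNeg b x • cVec a b x) (evalNeg b x • dVec a b x) := by
  have hb := h.evalNeg_ne_zero hx
  obtain ⟨-, hc, hd, hl⟩ := h.nonneg_mul
  refine SPImpedance.strictRegular_of_alternatives hc hd ?_ ?_
  · have := h.α_lt hx
    rw [α₁_smul, α₂_smul, α₃_smul]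
    have h4 : 0 < (evalNeg b x * evalNeg b x) ^ 2 := by positivity
    have := mul_lt_mul_of_pos_left this h4
    linarith
  · rw [lam₁_smul, lam₂_smul, lam₃_smul, lam₄_smul, α₂_smul]
    exact hs _ hl hb

/-- The four conditions are treated together, since a step to the left may change which of them
holds; the least `x` satisfying any of them lies on the boundary. -/
theorem exists_boundaryCond_of_regularCond (hx : 0 ≤ x) (h : RegularCond a b x) :
    ∃ y, 0 ≤ y ∧ BoundaryCond a b y := by
  set S := {y | 0 ≤ y ∧ RegularCond a b y} with hS
  have hcl : IsClosed S := isClosed_Ici.inter (isClosed_regularCond a b)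
  have hbdd : BddBelow S := ⟨0, fun y hy => hy.1⟩
  have hmem : sInf S ∈ S := hcl.csInf_mem ⟨x, hx, h⟩ hbdd
  have hmin : ∀ z, 0 ≤ z → z < sInf S → ¬ RegularCond a b z := fun z hz hlt hz' =>
    absurd (csInf_le hbdd ⟨hz, hz'⟩) (not_le.2 hlt)
  generalize sInf S = y at *
  refine ⟨y, hmem.1, ?_⟩
  have hstep : ∀ {l e}, CommonCond a b y l e → 0 < y → ¬ ((∀ j, 0 < (evalNeg b y • cVec a b y) j) ∧
      (∀ j, 0 < (evalNeg b y • dVec a b y) j) ∧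
      StrictRegular (evalNeg b y • cVec a b y) (evalNeg b y • dVec a b y)) := by
    intro l e hC hy hs
    obtain ⟨z, hz, hzy, hzR⟩ := hC.exists_lt hy hs
    exact hmin z hz hzy hzR
  have key : ∀ k A : ℝ, 0 ≤ k * A → 0 ≤ k * k ^ 2 * A ∧ 0 ≤ k ^ 2 * k * A := fun k A h => by
    have := mul_nonneg (sq_nonneg k) h
    constructor <;> linarith
  by_contra hcon
  simp only [BoundaryCond, not_or, not_and] at hcon
  obtain ⟨g1, g2, g3, g4, -⟩ := hcon
  rcases hmem.2 with hC | hC | hC | hC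
  · obtain ⟨i1, i2, i3⟩ := g1 hC
    refine hstep hC (lt_of_le_of_ne hmem.1 (Ne.symm i1))
      (hC.strictRegular_of_alternatives hmem.1 fun k hk h0 => Or.inl ⟨(key _ _ hk).1, ?_, ?_, ?_⟩)
    · exact mul_nonneg (mul_self_nonneg _) hC.2.2.2.1
    · exact mul_ne_zero (by positivity) i2
    · exact mul_ne_zero h0 i3
  · obtain ⟨i1, i2, i3⟩ := g2 hC
    refine hstep hC (lt_of_le_of_ne hmem.1 (Ne.symm i1))
      (hC.strictRegular_of_alternatives hmem.1 fun k hk h0 =>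
        Or.inr (Or.inl ⟨(key _ _ hk).1, ?_, ?_, ?_⟩))
    · rw [← mul_neg]; exact mul_nonneg (mul_self_nonneg _) hC.2.2.2.1
    · exact mul_ne_zero (by positivity) i2
    · exact mul_ne_zero h0 i3
  · obtain ⟨i1, i2, i3⟩ := g3 hC
    refine hstep hC (lt_of_le_of_ne hmem.1 (Ne.symm i1))
      (hC.strictRegular_of_alternatives hmem.1 fun k hk h0 =>
        Or.inr (Or.inr (Or.inl ⟨(key _ _ hk).2, ?_, ?_, ?_⟩)))
    · rw [← mul_neg]; exact mul_nonneg (mul_self_nonneg _) hC.2.2.2.1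
    · exact mul_ne_zero (by positivity) i2
    · exact mul_ne_zero h0 i3
  · obtain ⟨i1, i2, i3⟩ := g4 hC
    refine hstep hC (lt_of_le_of_ne hmem.1 (Ne.symm i1))
      (hC.strictRegular_of_alternatives hmem.1 fun k hk h0 =>
        Or.inr (Or.inr (Or.inr ⟨(key _ _ hk).2, ?_, ?_, ?_⟩)))
    · exact mul_nonneg (mul_self_nonneg _) hC.2.2.2.1
    · exact mul_ne_zero (by positivity) i2
    · exact mul_ne_zero h0 i3

end

/-! ### The condition `C5` -/

section

variable {R K x : ℝ} {c d : Fin 3 → ℝ} {a b : Fin 4 → ℝ}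

theorem C5_of_mul_nonneg {k : ℝ} (hab : ∀ i, 0 ≤ a i ∧ 0 ≤ b i) (hk : k ≠ 0)
    (ha : 0 ≤ k * evalNegRev a x) (hb : 0 ≤ k * evalNegRev b x) (hc : ∀ j, 0 ≤ k * cVec' a b x j)
    (hd : ∀ j, 0 ≤ k * dVec' a b x j) (hl : 0 ≤ k * lam₁ (cVec' a b x) (dVec' a b x))
    (hq : 0 ≤ quadNegRev (cVec' a b x) x) (he : 0 ≤ α₂ (cVec' a b x) (dVec' a b x))
    (h0 : 0 < R₀ a b) : C5 a b x := by
  refine ⟨hab, sameSign_of_mul_nonneg hk ?_, by rwa [cTilde'_eq], he, h0⟩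
  simp only [Set.mem_insert_iff, Set.mem_singleton_iff, forall_eq_or_imp, forall_eq]
  exact ⟨ha, hb, hc 0, hc 1, hc 2, hd 0, hd 1, hd 2, hl⟩

theorem C5_shunt' (hx : 0 ≤ x) (hR : 0 ≤ R) (hK : 0 < K) (hc : ∀ j, 0 ≤ c j)
    (hd : ∀ j, 0 ≤ d j) (h₁ : 0 ≤ lam₁ c d) (h₂ : 0 ≤ α₂ c d)
    (hα : α₂ c d ^ 2 ≤ α₁ c d * α₃ c d)
    (h0 : R₀ (shuntNum' R K x c d) (shuntDen' K x c d) ≠ 0) :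
    C5 (shuntNum' R K x c d) (shuntDen' K x c d) x := by
  have hk : quadNegRev c x ≠ 0 := by
    intro h; apply h0; rw [R₀_shunt', h]; ring
  have hpos : 0 < R₀ (shuntNum' R K x c d) (shuntDen' K x c d) := by
    refine lt_of_le_of_ne ?_ h0.symm
    rw [R₀_shunt']
    have : 0 ≤ α₁ c d * α₃ c d - α₂ c d ^ 2 := by linarith
    positivity
  have hden : ∀ i, 0 ≤ shuntDen' K x c d i := by
    have := hc 0; have := hc 1; have := hc 2; have := hd 0; have := hd 1; have := hd 2
    intro i; fin_cases i <;> simp [shuntDen'] <;> positivity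
  have hnum : ∀ i, 0 ≤ shuntNum' R K x c d i := by
    have := hc 0; have := hc 1; have := hc 2
    have := hden 0; have := hden 1; have := hden 2; have := hden 3
    intro i; fin_cases i <;> simp [shuntNum'] <;> positivity
  have heven : ∀ (n m : ℕ) (y : ℝ), 0 ≤ y → 0 ≤ (quadNegRev c x ^ n) ^ 2 * K ^ m * y :=
    fun n m y hy => by positivity
  refine C5_of_mul_nonneg (k := quadNegRev c x) (fun i => ⟨hnum i, hden i⟩) hk ?_ ?_ ?_ ?_
    ?_ ?_ ?_ hpos
  · rw [evalNegRev_shuntNum']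
    exact (heven 1 1 _ hR).trans_eq (by ring)
  · rw [evalNegRev_shuntDen']
    exact (heven 1 1 _ zero_le_one).trans_eq (by ring)
  · intro j
    rw [cVec'_shunt, Pi.smul_apply, smul_eq_mul]
    exact (heven 1 1 _ (hc j)).trans_eq (by ring)
  · intro j
    rw [dVec'_shunt, Pi.smul_apply, smul_eq_mul]
    exact (heven 2 2 _ (hd j)).trans_eq (by ring)
  · rw [cVec'_shunt, dVec'_shunt, lam₁_smul]
    exact (heven 4 5 _ h₁).trans_eq (by ring)
  · rw [← cTilde'_eq, cTilde'_shunt]; positivity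
  · rw [cVec'_shunt, dVec'_shunt, α₂_smul]
    exact (heven 2 3 _ h₂).trans_eq (by ring)

theorem C5.nonneg_mul (h : C5 a b x) :
    0 ≤ evalNegRev b x * evalNegRev a x ∧ (∀ j, 0 ≤ evalNegRev b x * cVec' a b x j) ∧
      (∀ j, 0 ≤ evalNegRev b x * dVec' a b x j) ∧
      0 ≤ evalNegRev b x * lam₁ (cVec' a b x) (dVec' a b x) := by
  have hs := h.2.1
  refine ⟨hs.mul_nonneg ?_ ?_, fun j => ?_, fun j => ?_, hs.mul_nonneg ?_ ?_⟩
  iterate 2 simp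
  · fin_cases j <;> exact hs.mul_nonneg (by simp) (by simp)
  · fin_cases j <;> exact hs.mul_nonneg (by simp) (by simp)
  iterate 2 simp

theorem C5.evalNegRev_ne_zero (h : C5 a b x) (hx : 0 ≤ x) : evalNegRev b x ≠ 0 := by
  intro hb
  have hs := h.2.1
  obtain ⟨h0, h1, h2, h3⟩ := cVec'_relation x a b
  rw [hb] at h0 h1 h2 h3
  have k0 : 0 ≤ evalNegRev a x * cVec' a b x 0 := hs.mul_nonneg (by simp) (by simp)
  have k1 : 0 ≤ evalNegRev a x * cVec' a b x 1 := hs.mul_nonneg (by simp) (by simp)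
  have k2 : 0 ≤ evalNegRev a x * cVec' a b x 2 := hs.mul_nonneg (by simp) (by simp)
  have key : ∀ i, ∀ t, evalNegRev a x * (evalNegRev a x * b i) = -t → 0 ≤ t →
      evalNegRev a x * b i = 0 := by
    intro i t ht h0
    have hbi := (h.1 i).2
    have : 0 ≤ evalNegRev a x ^ 2 * b i := by positivity
    have : evalNegRev a x ^ 2 * b i = 0 := by nlinarith
    simpa using this
  have e0 := key 0 _ (show _ = -(evalNegRev a x * cVec' a b x 0) by
    linear_combination -evalNegRev a x * h0) k0
  have e1 := key 1 _ (show _ = -(evalNegRev a x * cVec' a b x 1 +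
    x * (evalNegRev a x * cVec' a b x 0)) by
      linear_combination -evalNegRev a x * h1) (by positivity)
  have e2 := key 2 _ (show _ = -(evalNegRev a x * cVec' a b x 2 +
    x * (evalNegRev a x * cVec' a b x 1)) by
      linear_combination -evalNegRev a x * h2) (by positivity)
  have c0 : cVec' a b x 0 = 0 := by linarith
  have c1 : cVec' a b x 1 = 0 := by rw [c0] at h1; linarith
  have c2 : cVec' a b x 2 = 0 := by rw [c1] at h2; linarith
  exact h.2.2.2.2.ne' (R₀_eq_zero_of_cVec'_eq_zero x a b fun j => by fin_cases j <;> assumption)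

theorem C5.quadNegRev_pos (h : C5 a b x) (hx : 0 ≤ x) : 0 < quadNegRev (cVec' a b x) x := by
  have hb := h.evalNegRev_ne_zero hx
  obtain ⟨-, hc, hd, -⟩ := h.nonneg_mul
  refine lt_of_le_of_ne (by simpa [cTilde'_eq] using h.2.2.1) fun hq => ?_
  obtain ⟨h0, h1, h2, h3⟩ := dVec'_relation x a b
  rw [← hq] at h0 h1 h2 h3
  have key : ∀ j, ∀ t, evalNegRev b x ^ 2 * (evalNegRev b x * cVec' a b x j) = -t → 0 ≤ t →
      cVec' a b x j = 0 := by
    intro j t ht ht0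
    have h2 : 0 < evalNegRev b x ^ 2 := by positivity
    have h3 : evalNegRev b x * cVec' a b x j = 0 := le_antisymm (by nlinarith) (hc j)
    simpa [hb] using h3
  have d0 := hd 0
  have d1 := hd 1
  have d2 := hd 2
  have e0 := key 0 _ (show _ = -(evalNegRev b x * dVec' a b x 1 +
    x * (evalNegRev b x * dVec' a b x 0)) by
      linear_combination -evalNegRev b x * h1) (by positivity)
  have e1 := key 1 _ (show _ = -(evalNegRev b x * dVec' a b x 2 +
    x * (evalNegRev b x * dVec' a b x 1)) by
      linear_combination -evalNegRev b x * h2) (by positivity)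
  have e2 := key 2 _ (show _ = -(x * (evalNegRev b x * dVec' a b x 2)) by
      linear_combination -evalNegRev b x * h3) (by positivity)
  exact h.2.2.2.2.ne' (R₀_eq_zero_of_cVec'_eq_zero x a b fun j => by fin_cases j <;> assumption)

theorem C5.α_lt (h : C5 a b x) (hx : 0 ≤ x) :
    α₂ (cVec' a b x) (dVec' a b x) ^ 2 <
      α₁ (cVec' a b x) (dVec' a b x) * α₃ (cVec' a b x) (dVec' a b x) := by
  have hb := h.evalNegRev_ne_zero hx
  have hq := h.quadNegRev_pos hx
  have h0 := h.2.2.2.2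
  obtain ⟨eb, ea⟩ := shunt'_eq hb hq.ne'
  have hR := R₀_shunt' (evalNegRev a x / evalNegRev b x)
      (evalNegRev b x ^ 2 / quadNegRev (cVec' a b x) x) x
      ((1 / evalNegRev b x) • cVec' a b x)
      ((1 / (evalNegRev b x * quadNegRev (cVec' a b x) x)) • dVec' a b x)
  rw [← ea, ← eb, α₁_smul, α₂_smul, α₃_smul] at hR
  by_contra! hle
  refine absurd h0 (not_lt.2 ?_)
  generalize α₁ (cVec' a b x) (dVec' a b x) = A₁ at *
  generalize α₂ (cVec' a b x) (dVec' a b x) = A₂ at *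
  generalize α₃ (cVec' a b x) (dVec' a b x) = A₃ at *
  have hK : 0 ≤ evalNegRev b x ^ 2 / quadNegRev (cVec' a b x) x := by positivity
  generalize evalNegRev b x ^ 2 / quadNegRev (cVec' a b x) x = K at *
  generalize 1 / (evalNegRev b x * quadNegRev (cVec' a b x) x) = v at *
  generalize quadNegRev ((1 / evalNegRev b x) • cVec' a b x) x = r at *
  generalize 1 / evalNegRev b x = u at *
  have : 0 ≤ K * r ^ 2 * (u * v) ^ 2 * (A₂ ^ 2 - A₁ * A₃) :=
    mul_nonneg (by positivity) (by linarith)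
  rw [hR]
  linarith

/-- In the definite case `λ₁ > 0` and `α₂ > 0` follow once `c₀` and `d₂` are non-zero. This is why
(5) lists only `x`, `c₀` and `d₂`. -/
theorem coeff_pos_of_α_lt (hc : ∀ j, 0 ≤ c j) (hd : ∀ j, 0 ≤ d j) (h₁ : 0 ≤ lam₁ c d)
    (h₂ : 0 ≤ α₂ c d) (hα : α₂ c d ^ 2 < α₁ c d * α₃ c d) (h0 : c 0 ≠ 0) (h2 : d 2 ≠ 0) :
    (∀ j, 0 < c j) ∧ (∀ j, 0 < d j) ∧ 0 < lam₁ c d ∧ 0 < α₂ c d := by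
  have hc0 := hc 0
  have hc1 := hc 1
  have hc2 := hc 2
  have hd0 := hd 0
  have hd1 := hd 1
  have hd2 := hd 2
  simp only [lam₁, α₁, α₂, α₃, Fin.forall_fin_succ,
    Fin.succ_zero_eq_one, Fin.succ_one_eq_two] at *
  generalize c 0 = c₀ at *
  generalize c 1 = c₁ at *
  generalize c 2 = c₂ at *
  generalize d 0 = d₀ at *
  generalize d 1 = d₁ at *
  generalize d 2 = d₂ at *
  have p0 := lt_of_le_of_ne hc0 h0.symm
  have q2 := lt_of_le_of_ne hd2 h2.symm
  have hm := mul_nonneg hd0 h₂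
  have hpos : 0 < (c₁ * d₀ - c₀ * d₁) * (c₂ * d₁ - c₁ * d₂) := lt_of_le_of_lt (sq_nonneg _) hα
  -- Definiteness makes `α₁` and `α₃` non-zero and of the same sign. A negative `α₁` would force `d₁
  -- = 0` through `λ₁ ≥ 0`, and then `α₁ = c₁d₀ ≥ 0`.
  have a1 : 0 < c₁ * d₀ - c₀ * d₁ := by
    refine lt_of_le_of_ne ?_ fun h => ?_
    · by_contra! h
      have h3 := mul_nonpos_of_nonneg_of_nonpos hd1 h.le
      have h4 : d₁ * (c₁ * d₀ - c₀ * d₁) = 0 := by linarith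
      rcases mul_eq_zero.1 h4 with h5 | h5
      · rw [h5] at h
        linarith [mul_nonneg hc1 hd0]
      · exact h.ne h5
    · rw [← h] at hpos; simp at hpos
  have a3 : 0 < c₂ * d₁ - c₁ * d₂ := pos_of_mul_pos_right hpos a1.le
  have m1 : 0 < c₁ * d₀ := by linarith [mul_nonneg hc0 hd1]
  have p1 := pos_of_mul_pos_left m1 hd0
  have q0 := pos_of_mul_pos_right m1 hc1
  have m2 : 0 < c₂ * d₁ := by linarith [mul_pos p1 q2]
  have p2 := pos_of_mul_pos_left m2 hd1
  have q1 := pos_of_mul_pos_right m2 hc2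
  have a2 : 0 < c₂ * d₀ - c₀ * d₂ := by
    -- The identity is `c₁α₂ = c₂α₁ + c₀α₃`.
    have : 0 < c₁ * (c₂ * d₀ - c₀ * d₂) := by
      linarith [mul_pos p2 a1, mul_pos p0 a3]
    exact pos_of_mul_pos_right this p1.le
  have l1 : 0 < d₁ * (c₁ * d₀ - c₀ * d₁) - d₀ * (c₂ * d₀ - c₀ * d₂) := by
    -- The identity `d₁α₂ = d₀α₃ + d₂α₁` gives `α₃λ₁ = d₁(α₁α₃ - α₂²) + d₂α₁α₂`.
    have : 0 < (c₂ * d₁ - c₁ * d₂) *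
        (d₁ * (c₁ * d₀ - c₀ * d₁) - d₀ * (c₂ * d₀ - c₀ * d₂)) := by
      have e1 := mul_pos q1 (sub_pos.2 hα)
      have e2 := mul_pos (mul_pos a2 q2) a1
      nlinarith
    exact pos_of_mul_pos_right this a3.le
  simp [*]

/-- For a positive definite form the clauses of (C5) on `λ₁` and `α₂` are automatic, by the
identities used in `coeff_pos_of_α_lt`. -/
theorem lam₁_nonneg_of_α_lt (hc : ∀ j, 0 ≤ c j) (hd : ∀ j, 0 ≤ d j)
    (h₃ : 0 ≤ α₃ c d) (hα : α₂ c d ^ 2 < α₁ c d * α₃ c d) :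
    0 ≤ lam₁ c d ∧ 0 ≤ α₂ c d := by
  have hc0 := hc 0
  have hc1 := hc 1
  have hc2 := hc 2
  have hd0 := hd 0
  have hd1 := hd 1
  have hd2 := hd 2
  simp only [lam₁, α₁, α₂, α₃] at *
  generalize c 0 = c₀ at *
  generalize c 1 = c₁ at *
  generalize c 2 = c₂ at *
  generalize d 0 = d₀ at *
  generalize d 1 = d₁ at *
  generalize d 2 = d₂ at *
  have hpos : 0 < (c₁ * d₀ - c₀ * d₁) * (c₂ * d₁ - c₁ * d₂) := lt_of_le_of_lt (sq_nonneg _) hα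
  have a1 : 0 < c₁ * d₀ - c₀ * d₁ := pos_of_mul_pos_left hpos h₃
  have a3 : 0 < c₂ * d₁ - c₁ * d₂ := pos_of_mul_pos_right hpos a1.le
  have m1 : 0 < c₁ * d₀ := by linarith [mul_nonneg hc0 hd1]
  have p1 := pos_of_mul_pos_left m1 hd0
  have a2 : 0 ≤ c₂ * d₀ - c₀ * d₂ := by
    have : 0 ≤ c₁ * (c₂ * d₀ - c₀ * d₂) := by
      linarith [mul_nonneg hc2 a1.le, mul_nonneg hc0 a3.le]
    exact nonneg_of_mul_nonneg_right this p1
  refine ⟨?_, a2⟩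
  have : 0 ≤ (c₂ * d₁ - c₁ * d₂) *
      (d₁ * (c₁ * d₀ - c₀ * d₁) - d₀ * (c₂ * d₀ - c₀ * d₂)) := by
    have e1 := mul_nonneg hd1 (sub_pos.2 hα).le
    have e2 := mul_nonneg (mul_nonneg a2 hd2) a1.le
    nlinarith
  exact nonneg_of_mul_nonneg_right this a3

theorem continuous_evalNegRev (p : Fin 4 → ℝ) : Continuous (evalNegRev p) := by
  unfold evalNegRev; fun_prop

theorem continuous_cVec' (a b : Fin 4 → ℝ) (j : Fin 3) : Continuous fun x => cVec' a b x j := by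
  simp only [cVec'_apply]; fun_prop

theorem continuous_dVec' (a b : Fin 4 → ℝ) (j : Fin 3) : Continuous fun x => dVec' a b x j := by
  have h0 := continuous_cVec' a b 0
  have h1 := continuous_cVec' a b 1
  have h2 := continuous_cVec' a b 2
  have hb := continuous_evalNegRev b
  simp only [dVec'_apply]
  fin_cases j <;> simp [bezoutian, cPoly'] <;> fun_prop

theorem continuous_quadNegRev (c : Fin 3 → ℝ) : Continuous (quadNegRev c) := by
  unfold quadNegRev; fun_prop

theorem continuous_quadNegRev_cVec' (a b : Fin 4 → ℝ) :
    Continuous fun x => quadNegRev (cVec' a b x) x := by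
  have h0 := continuous_cVec' a b 0
  have h1 := continuous_cVec' a b 1
  have h2 := continuous_cVec' a b 2
  unfold quadNegRev; fun_prop

theorem isClosed_C5 (a b : Fin 4 → ℝ) : IsClosed {x | C5 a b x} := by
  have ha := continuous_evalNegRev a
  have hb := continuous_evalNegRev b
  have hc := continuous_cVec' a b
  have hd := continuous_dVec' a b
  have hq := continuous_quadNegRev_cVec' a b
  have hl := continuous_lam₁ hc hd
  have he := continuous_α₂ hc hd
  simp only [C5, SameSign, Set.mem_insert_iff, Set.mem_singleton_iff, forall_eq_or_imp,
    forall_eq, cTilde'_eq]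
  have hp : ∀ {f : ℝ → ℝ}, Continuous f → IsClosed {x | 0 ≤ f x} :=
    fun hf => isClosed_le continuous_const hf
  have hn : ∀ {f : ℝ → ℝ}, Continuous f → IsClosed {x | f x ≤ 0} :=
    fun hf => isClosed_le hf continuous_const
  refine isClosed_const.and ((isClosed_or ?_ ?_).and ((hp hq).and ((hp he).and isClosed_const)))
  · exact (hp ha).and ((hp hb).and ((hp (hc 0)).and ((hp (hc 1)).and ((hp (hc 2)).and
      ((hp (hd 0)).and ((hp (hd 1)).and ((hp (hd 2)).and (hp hl))))))))
  · exact (hn ha).and ((hn hb).and ((hn (hc 0)).and ((hn (hc 1)).and ((hn (hc 2)).and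
      ((hn (hd 0)).and ((hn (hd 1)).and ((hn (hd 2)).and (hn hl))))))))

theorem evalNegRev_mul_sub (a b : Fin 4 → ℝ) (x y : ℝ) :
    evalNegRev b x * evalNegRev a y - evalNegRev a x * evalNegRev b y
      = (x - y) * quadNegRev (cVec' a b x) y := by
  simp only [quadNegRev, cVec'_apply]
  simp [bezoutian, evalNegRev]
  ring

theorem C5.exists_lt (h : C5 a b x) (hx : 0 < x) (h0 : cVec' a b x 0 ≠ 0)
    (h2 : dVec' a b x 2 ≠ 0) : ∃ y, 0 ≤ y ∧ y < x ∧ C5 a b y := by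
  have hb := h.evalNegRev_ne_zero hx.le
  have hq := h.quadNegRev_pos hx.le
  have hα := h.α_lt hx.le
  obtain ⟨ha, hc, hd, hl⟩ := h.nonneg_mul
  have he := h.2.2.2.1
  set k := evalNegRev b x with hk
  have hk2 : 0 < k ^ 2 := by positivity
  have hpos := coeff_pos_of_α_lt (c := k • cVec' a b x) (d := k • dVec' a b x) hc hd
    (by rw [lam₁_smul, mul_comm k, mul_assoc]; positivity)
    (by rw [α₂_smul, ← sq]; positivity)
    (by
      rw [α₁_smul, α₂_smul, α₃_smul]
      have h4 : 0 < (k * k) ^ 2 := by positivity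
      have := mul_lt_mul_of_pos_left hα h4
      linarith) (mul_ne_zero hb h0) (mul_ne_zero hb h2)
  obtain ⟨hc', hd', hl', he'⟩ := hpos
  rw [lam₁_smul, mul_comm k, mul_assoc, mul_pos_iff_of_pos_left hk2] at hl'
  rw [α₂_smul, ← sq, mul_pos_iff_of_pos_left hk2] at he'
  have hC := continuous_cVec' a b
  have hD := continuous_dVec' a b
  have hop : ∀ {f : ℝ → ℝ}, Continuous f → IsOpen {x | 0 < f x} :=
    fun hf => isOpen_lt continuous_const hf
  have ev : ∀ᶠ y in nhds x, 0 < y ∧ 0 < k * evalNegRev b y ∧ 0 < quadNegRev (cVec' a b x) y ∧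
      (∀ j, 0 < k * cVec' a b y j) ∧ (∀ j, 0 < k * dVec' a b y j) ∧
      0 < quadNegRev (cVec' a b y) y ∧ 0 < k * lam₁ (cVec' a b y) (dVec' a b y) ∧
      0 < α₂ (cVec' a b y) (dVec' a b y) := by
    refine (eventually_gt_nhds hx).and (.and ?_ (.and ?_ (.and ?_ (.and ?_ (.and ?_ (.and ?_ ?_))))))
    · exact (hop ((continuous_evalNegRev b).const_mul k)).mem_nhds (mul_self_pos.2 hb)
    · exact (hop (continuous_quadNegRev _)).mem_nhds hq
    · exact Filter.eventually_all.2 fun j => (hop ((hC j).const_mul k)).mem_nhds (hc' j)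
    · exact Filter.eventually_all.2 fun j => (hop ((hD j).const_mul k)).mem_nhds (hd' j)
    · exact (hop (continuous_quadNegRev_cVec' a b)).mem_nhds hq
    · exact (hop ((continuous_lam₁ hC hD).const_mul k)).mem_nhds hl'
    · exact (hop (continuous_α₂ hC hD)).mem_nhds he'
  obtain ⟨y, ⟨hy0, hy1, hy2, hy3, hy4, hy5, hy6, hy7⟩, hyx⟩ :=
    ((ev.filter_mono nhdsWithin_le_nhds).and (self_mem_nhdsWithin (s := Set.Iio x))).exists
  refine ⟨y, hy0.le, hyx, C5_of_mul_nonneg h.1 hb ?_ hy1.le (fun j => (hy3 j).le)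
    (fun j => (hy4 j).le) hy6.le hy5.le hy7.le h.2.2.2.2⟩
  have hid := evalNegRev_mul_sub a b x y
  have h5 : 0 < (x - y) * quadNegRev (cVec' a b x) y := mul_pos (sub_pos.2 hyx) hy2
  have h6 : 0 ≤ evalNegRev a x * evalNegRev b y := by
    have : 0 ≤ k ^ 2 * (evalNegRev a x * evalNegRev b y) := by
      have := mul_nonneg ha hy1.le
      linarith
    exact (mul_nonneg_iff_of_pos_left (by positivity)).1 this
  rw [← hk] at hid
  linarith

theorem exists_boundaryCond_of_C5 (hx : 0 ≤ x) (h : C5 a b x) :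
    ∃ y, 0 ≤ y ∧ BoundaryCond a b y := by
  set S := {y | 0 ≤ y ∧ C5 a b y} with hS
  have hcl : IsClosed S := isClosed_Ici.inter (isClosed_C5 a b)
  have hbdd : BddBelow S := ⟨0, fun y hy => hy.1⟩
  have hmem : sInf S ∈ S := hcl.csInf_mem ⟨x, hx, h⟩ hbdd
  refine ⟨sInf S, hmem.1, Or.inr (Or.inr (Or.inr (Or.inr ⟨hmem.2, ?_⟩)))⟩
  by_contra! hcon
  obtain ⟨i1, i2, i3⟩ := hcon
  obtain ⟨z, hz, hzy, hzC⟩ := hmem.2.exists_lt (lt_of_le_of_ne hmem.1 (Ne.symm i1)) i2 i3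
  exact absurd (csInf_le hbdd ⟨hz, hzC⟩) (not_le.2 hzy)

end

/-! ### Formal cubics, resultants and genericity -/

open Polynomial in
/-- The polynomial with coefficients `p`. -/
def cubicPoly (p : Fin 4 → ℝ) : ℝ[X] := C (p 3) * X ^ 3 + C (p 2) * X ^ 2 + C (p 1) * X + C (p 0)

theorem algebraMap_cubicPoly (p : Fin 4 → ℝ) :
    algebraMap (Polynomial ℝ) (RatFunc ℝ) (cubicPoly p) = cubic p := by
  simp [cubicPoly, cubic]

theorem coeff_cubicPoly (p : Fin 4 → ℝ) (i : Fin 4) : (cubicPoly p).coeff i = p i := by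
  fin_cases i <;> simp [cubicPoly, Polynomial.coeff_X, Polynomial.coeff_C]

theorem cubicPoly_ne_zero {p : Fin 4 → ℝ} {i : Fin 4} (h : p i ≠ 0) : cubicPoly p ≠ 0 := by
  intro h0
  rw [← coeff_cubicPoly p i, h0] at h
  simp at h

theorem cubic_ne_zero {p : Fin 4 → ℝ} {i : Fin 4} (h : p i ≠ 0) : cubic p ≠ 0 := by
  rw [← algebraMap_cubicPoly]
  exact RatFunc.algebraMap_ne_zero (cubicPoly_ne_zero h)

theorem natDegree_cubicPoly_le (p : Fin 4 → ℝ) : (cubicPoly p).natDegree ≤ 3 := by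
  unfold cubicPoly; compute_degree

/-- A left kernel vector of the Sylvester matrix is a relation `U b + W a = 0` with `U`, `W` of
degree at most two. Coprimality makes `a` divide `U` and `b` divide `W`; the degree-three polynomial
among them kills one factor, hence both. -/
theorem R₀_ne_zero_of_isCoprime {a b : Fin 4 → ℝ} (h : IsCoprime (cubicPoly a) (cubicPoly b))
    (hdeg : (cubicPoly a).natDegree = 3 ∨ (cubicPoly b).natDegree = 3) : R₀ a b ≠ 0 := by
  intro h0
  obtain ⟨v, hv, hM⟩ := Matrix.exists_vecMul_eq_zero_iff.2 h0
  have e := fun j => congrFun hM j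
  simp only [Matrix.vecMul, dotProduct, Fin.sum_univ_six, Fin.forall_fin_succ] at e
  simp at e
  obtain ⟨e5, e4, e3, e2, e1, e0⟩ := e
  have E : ∀ t : ℝ, t = 0 → Polynomial.C t = 0 := fun t ht => by simp [ht]
  have E5 := E _ e5
  have E4 := E _ e4
  have E3 := E _ e3
  have E2 := E _ e2
  have E1 := E _ e1
  have E0 := E _ e0
  simp only [map_add, map_mul] at E5 E4 E3 E2 E1 E0
  -- The rows of `b` and `a` alternate, so the even entries of `v` are the coefficients of `U` and
  -- the odd ones those of `W`, leading coefficients first.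
  have hUW : cubicPoly ![v 4, v 2, v 0, 0] * cubicPoly b +
      cubicPoly ![v 5, v 3, v 1, 0] * cubicPoly a = 0 := by
    simp [cubicPoly]
    linear_combination Polynomial.X ^ 5 * E5 + Polynomial.X ^ 4 * E4 + Polynomial.X ^ 3 * E3 +
      Polynomial.X ^ 2 * E2 + Polynomial.X * E1 + E0
  have hlow : ∀ r s t : ℝ, (cubicPoly ![r, s, t, 0]).natDegree < 3 := by
    intro r s t
    have : (cubicPoly ![r, s, t, 0]).natDegree ≤ 2 := by
      simp [cubicPoly]; compute_degree
    omega
  have hzero : cubicPoly ![v 4, v 2, v 0, 0] = 0 ∧ cubicPoly ![v 5, v 3, v 1, 0] = 0 := by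
    rcases hdeg with hd | hd
    · have hU : cubicPoly ![v 4, v 2, v 0, 0] = 0 := by
        refine Polynomial.eq_zero_of_dvd_of_natDegree_lt (p := cubicPoly a) ?_ (by rw [hd]; exact hlow _ _ _)
        exact h.dvd_of_dvd_mul_right (Dvd.intro_left (-cubicPoly ![v 5, v 3, v 1, 0])
          (by linear_combination -hUW))
      refine ⟨hU, ?_⟩
      rw [hU, zero_mul, zero_add] at hUW
      exact (mul_eq_zero.1 hUW).resolve_right (by intro h; rw [h] at hd; simp at hd)
    · have hW : cubicPoly ![v 5, v 3, v 1, 0] = 0 := by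
        refine Polynomial.eq_zero_of_dvd_of_natDegree_lt (p := cubicPoly b) ?_ (by rw [hd]; exact hlow _ _ _)
        exact h.symm.dvd_of_dvd_mul_right (Dvd.intro_left (-cubicPoly ![v 4, v 2, v 0, 0])
          (by linear_combination -hUW))
      refine ⟨?_, hW⟩
      rw [hW, zero_mul, add_zero] at hUW
      exact (mul_eq_zero.1 hUW).resolve_right (by intro h; rw [h] at hd; simp at hd)
  apply hv
  have hc : ∀ p : Fin 4 → ℝ, cubicPoly p = 0 → ∀ i, p i = 0 := fun p hp i => by
    rw [← coeff_cubicPoly p i, hp, Polynomial.coeff_zero]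
  have c1 := hc _ hzero.1
  have c2 := hc _ hzero.2
  have c10 := c1 0
  have c11 := c1 1
  have c12 := c1 2
  have c20 := c2 0
  have c21 := c2 1
  have c22 := c2 2
  simp at c10 c11 c12 c20 c21 c22
  funext i
  fin_cases i <;> simpa

/-- A rational function is generic if every presentation as a quotient of two formal cubics
has a non-vanishing resultant. -/
def Generic (Z : RatFunc ℝ) : Prop := ∀ a b : Fin 4 → ℝ, Z = cubic a / cubic b → R₀ a b ≠ 0

/-- The pair `a`, `b` is a common multiple `k` of numerator and denominator in lowest terms. These
already reach degree three, so `k` is constant. -/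
theorem IsBicubic.generic {Z : RatFunc ℝ} (hZ : IsBicubic Z) : Generic Z := by
  intro a b h
  unfold IsBicubic mcMillanDegree at hZ
  have hZ0 : Z ≠ 0 := by
    rintro rfl
    simp at hZ
  have hb : cubicPoly b ≠ 0 := by
    intro h0
    rw [← algebraMap_cubicPoly b, h0] at h
    simp at h
    exact hZ0 h
  have ha : cubicPoly a ≠ 0 := by
    intro h0
    rw [← algebraMap_cubicPoly a, h0] at h
    simp at h
    exact hZ0 h
  have hcop := RatFunc.isCoprime_num_denom Z
  have heq : cubicPoly a * Z.denom = Z.num * cubicPoly b := by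
    apply RatFunc.algebraMap_injective ℝ
    have hd := RatFunc.algebraMap_ne_zero Z.denom_ne_zero
    have hb' := RatFunc.algebraMap_ne_zero hb
    have h2 := RatFunc.num_div_denom Z
    rw [h, ← algebraMap_cubicPoly, ← algebraMap_cubicPoly, div_eq_div_iff] at h2
    · rw [map_mul, map_mul, h, ← algebraMap_cubicPoly, ← algebraMap_cubicPoly]
      exact h2.symm
    · rwa [algebraMap_cubicPoly, algebraMap_cubicPoly, ← h]
    · exact hb'
  obtain ⟨k, hk⟩ : Z.denom ∣ cubicPoly b :=
    hcop.symm.dvd_of_dvd_mul_left (Dvd.intro_left _ heq)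
  have hk' : cubicPoly a = Z.num * k := by
    have : cubicPoly a * Z.denom = Z.num * k * Z.denom := by rw [heq, hk]; ring
    exact mul_right_cancel₀ Z.denom_ne_zero this
  have hk0 : k ≠ 0 := by rintro rfl; simp at hk; exact hb hk
  have hn0 : Z.num ≠ 0 := RatFunc.num_ne_zero hZ0
  have d1 : (cubicPoly b).natDegree = Z.denom.natDegree + k.natDegree := by
    rw [hk, Polynomial.natDegree_mul Z.denom_ne_zero hk0]
  have d2 : (cubicPoly a).natDegree = Z.num.natDegree + k.natDegree := by
    rw [hk', Polynomial.natDegree_mul hn0 hk0]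
  have l1 := natDegree_cubicPoly_le a
  have l2 := natDegree_cubicPoly_le b
  have hkd : k.natDegree = 0 := by omega
  have hku : IsUnit k := by
    rw [Polynomial.isUnit_iff_degree_eq_zero, Polynomial.degree_eq_natDegree hk0, hkd]; rfl
  refine R₀_ne_zero_of_isCoprime ?_ (by omega)
  rw [hk, hk']
  exact (isCoprime_mul_unit_right hku _ _).2 hcop

theorem R₀_swap (a b : Fin 4 → ℝ) : R₀ b a = -R₀ a b := by
  rw [R₀_eq, R₀_eq, Matrix.det_fin_three, Matrix.det_fin_three]
  simp [bezoutian]; ring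

theorem R₀_reverse (a b : Fin 4 → ℝ) :
    R₀ ![b 3, b 2, b 1, b 0] ![a 3, a 2, a 1, a 0] = R₀ a b := by
  rw [R₀_eq, R₀_eq, Matrix.det_fin_three, Matrix.det_fin_three]
  simp [bezoutian]; ring

theorem Generic.inv {Z : RatFunc ℝ} (hZ : Generic Z) : Generic Z⁻¹ := by
  intro a b h
  have := hZ b a (by rw [← inv_inv Z, h, inv_div])
  rw [R₀_swap] at this
  exact neg_ne_zero.1 this

/-! ### The substitution `s ↦ 1 / s` -/

/-- Up to a power of `X`, the value `p(1/X)` is the reversed polynomial at `X`. -/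
theorem eval₂_inv_X_ne_zero {p : Polynomial ℝ} (hp : p ≠ 0) :
    p.eval₂ (RatFunc.C (K := ℝ)) (RatFunc.X)⁻¹ ≠ 0 := by
  intro h
  have hX : (RatFunc.X : RatFunc ℝ) ≠ 0 := RatFunc.X_ne_zero
  let _ : Invertible (RatFunc.X : RatFunc ℝ)⁻¹ := invertibleOfNonzero (inv_ne_zero hX)
  have := (Polynomial.eval₂_reverse_eq_zero_iff (RatFunc.C (K := ℝ)) (RatFunc.X)⁻¹ p).2 h
  rw [invOf_eq_inv, inv_inv] at this
  have h2 : ∀ q : Polynomial ℝ, q.eval₂ (RatFunc.C (K := ℝ)) RatFunc.X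
      = algebraMap (Polynomial ℝ) (RatFunc ℝ) q := fun q => by
    rw [← RatFunc.algebraMap_X, ← RatFunc.algebraMap_comp_C, ← Polynomial.hom_eval₂]
    simp
  rw [h2] at this
  exact RatFunc.algebraMap_ne_zero (by simpa using hp) this

/-- The substitution `s ↦ 1 / s` on rational functions. -/
def freqInv : RatFunc ℝ →+* RatFunc ℝ :=
  RatFunc.liftRingHom (Polynomial.eval₂RingHom RatFunc.C (RatFunc.X)⁻¹) fun p hp => by
    rw [Submonoid.mem_comap, mem_nonZeroDivisors_iff_ne_zero]
    exact eval₂_inv_X_ne_zero (mem_nonZeroDivisors_iff_ne_zero.1 hp)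

@[simp] theorem freqInv_C (r : ℝ) : freqInv (RatFunc.C r) = RatFunc.C r := by
  rw [← RatFunc.algebraMap_C, freqInv, RatFunc.liftRingHom_algebraMap]; simp

@[simp] theorem freqInv_X : freqInv RatFunc.X = (RatFunc.X)⁻¹ := by
  rw [← RatFunc.algebraMap_X, freqInv, RatFunc.liftRingHom_algebraMap]; simp

@[simp] theorem freqInv_freqInv (Z : RatFunc ℝ) : freqInv (freqInv Z) = Z := by
  have : freqInv.comp freqInv = RingHom.id _ := by
    refine IsLocalization.ringHom_ext (nonZeroDivisors (Polynomial ℝ)) ?_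
    refine Polynomial.ringHom_ext (fun r => ?_) ?_
    · simp
    · simp
  exact RingHom.congr_fun this Z

theorem freqInv_cubic (p : Fin 4 → ℝ) :
    freqInv (cubic p) = cubic ![p 3, p 2, p 1, p 0] / RatFunc.X ^ 3 := by
  have hX : (RatFunc.X : RatFunc ℝ) ≠ 0 := RatFunc.X_ne_zero
  simp [cubic]
  field_simp
  ring

theorem freqInv_cubic_div (a b : Fin 4 → ℝ) : freqInv (cubic a / cubic b) =
    cubic ![a 3, a 2, a 1, a 0] / cubic ![b 3, b 2, b 1, b 0] := by
  have hX : (RatFunc.X : RatFunc ℝ) ≠ 0 := RatFunc.X_ne_zero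
  rw [map_div₀, freqInv_cubic, freqInv_cubic, div_div_div_cancel_right₀ (pow_ne_zero 3 hX)]

theorem Generic.freqInv {Z : RatFunc ℝ} (hZ : Generic Z) : Generic (freqInv Z) := by
  intro a b h
  have := hZ _ _ (by rw [← freqInv_freqInv Z, h, freqInv_cubic_div])
  rw [R₀_reverse b a, R₀_swap] at this
  exact neg_ne_zero.1 this

/-! ### Closure properties of the impedance sets -/

namespace Network

/-- The dual network. -/
def dual : Network → Network
  | resistor R h => resistor R⁻¹ (inv_pos.2 h)
  | inductor L h => capacitor L h
  | capacitor C h => inductor C h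
  | series N₁ N₂ => parallel N₁.dual N₂.dual
  | parallel N₁ N₂ => series N₁.dual N₂.dual

/-- The network obtained by the substitution `s ↦ 1 / s`. -/
def exchange : Network → Network
  | resistor R h => resistor R h
  | inductor L h => capacitor L⁻¹ (inv_pos.2 h)
  | capacitor C h => inductor C⁻¹ (inv_pos.2 h)
  | series N₁ N₂ => series N₁.exchange N₂.exchange
  | parallel N₁ N₂ => parallel N₁.exchange N₂.exchange

theorem dual_spec (N : Network) : N.dual.impedance = N.impedance⁻¹ ∧
    N.dual.numCapacitors = N.numInductors ∧ N.dual.numInductors = N.numCapacitors := by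
  induction N with
  | series N₁ N₂ h₁ h₂ | parallel N₁ N₂ h₁ h₂ =>
    simp [dual, impedance, numCapacitors, numInductors, h₁, h₂]
  | _ => simp [dual, impedance, numCapacitors, numInductors]

theorem exchange_spec (N : Network) : N.exchange.impedance = freqInv N.impedance ∧
    N.exchange.numCapacitors = N.numInductors ∧ N.exchange.numInductors = N.numCapacitors := by
  induction N with
  | series N₁ N₂ h₁ h₂ | parallel N₁ N₂ h₁ h₂ =>
    simp [exchange, impedance, numCapacitors, numInductors, h₁, h₂]
  | _ => simp [exchange, impedance, numCapacitors, numInductors, mul_comm]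

end Network

variable {m n m' n' : ℕ} {Z W : RatFunc ℝ}

theorem inv_mem_impedanceSet (h : Z ∈ impedanceSet m n) : Z⁻¹ ∈ impedanceSet n m := by
  obtain ⟨N, h1, h2, rfl⟩ := h
  obtain ⟨e, e1, e2⟩ := N.dual_spec
  exact ⟨N.dual, e1 ▸ h2, e2 ▸ h1, e⟩

theorem freqInv_mem_impedanceSet (h : Z ∈ impedanceSet m n) : freqInv Z ∈ impedanceSet n m := by
  obtain ⟨N, h1, h2, rfl⟩ := h
  obtain ⟨e, e1, e2⟩ := N.exchange_spec
  exact ⟨N.exchange, e1 ▸ h2, e2 ▸ h1, e⟩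

theorem add_mem_impedanceSet (h : Z ∈ impedanceSet m n) (h' : W ∈ impedanceSet m' n') :
    Z + W ∈ impedanceSet (m + m') (n + n') := by
  obtain ⟨N, h1, h2, rfl⟩ := h
  obtain ⟨N', h1', h2', rfl⟩ := h'
  exact ⟨N.series N', add_le_add h1 h1', add_le_add h2 h2', rfl⟩

theorem parallel_mem_impedanceSet (h : Z ∈ impedanceSet m n) (h' : W ∈ impedanceSet m' n') :
    (Z⁻¹ + W⁻¹)⁻¹ ∈ impedanceSet (m + m') (n + n') := by
  obtain ⟨N, h1, h2, rfl⟩ := h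
  obtain ⟨N', h1', h2', rfl⟩ := h'
  exact ⟨N.parallel N', add_le_add h1 h1', add_le_add h2 h2', rfl⟩

/-- `R = 0` stands for the absence of a resistor, so degenerate element values need no separate
treatment later. -/
theorem C_add_mem_impedanceSet {R : ℝ} (hR : 0 ≤ R) (h : Z ∈ impedanceSet m n) :
    RatFunc.C R + Z ∈ impedanceSet m n := by
  rcases hR.eq_or_lt with rfl | hR
  · simpa using h
  · have : RatFunc.C R ∈ impedanceSet 0 0 := ⟨.resistor R hR, le_rfl, le_rfl, rfl⟩
    simpa using add_mem_impedanceSet this h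

theorem C_parallel_mem_impedanceSet {g : ℝ} (hg : 0 ≤ g) (h : Z ∈ impedanceSet m n) :
    (RatFunc.C g + Z⁻¹)⁻¹ ∈ impedanceSet m n :=
  inv_mem_impedanceSet (C_add_mem_impedanceSet hg (inv_mem_impedanceSet h))

theorem inductor_mem_impedanceSet {L : ℝ} (hL : 0 < L) :
    RatFunc.C L * RatFunc.X ∈ impedanceSet 0 1 := ⟨.inductor L hL, le_rfl, le_rfl, rfl⟩

theorem capacitor_mem_impedanceSet {C : ℝ} (hC : 0 < C) :
    (RatFunc.C C * RatFunc.X)⁻¹ ∈ impedanceSet 1 0 := ⟨.capacitor C hC, le_rfl, le_rfl, rfl⟩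

/-! ### Realization of the conditions -/

/-- The quadratic `c₂ s² + c₁ s + c₀`, as an element of `ℝ(s)`. -/
def quad (c : Fin 3 → ℝ) : RatFunc ℝ :=
  RatFunc.C (c 2) * RatFunc.X ^ 2 + RatFunc.C (c 1) * RatFunc.X + RatFunc.C (c 0)

/-- The affine function `p s + q`, as an element of `ℝ(s)`. -/
def lin (p q : ℝ) : RatFunc ℝ := RatFunc.C p * RatFunc.X + RatFunc.C q

theorem quad_eq_cubic (c : Fin 3 → ℝ) : quad c = cubic ![c 0, c 1, c 2, 0] := by
  simp [quad, cubic]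

theorem quad_ne_zero {c : Fin 3 → ℝ} {j : Fin 3} (h : c j ≠ 0) : quad c ≠ 0 := by
  rw [quad_eq_cubic]
  fin_cases j
  · exact cubic_ne_zero (i := 0) h
  · exact cubic_ne_zero (i := 1) h
  · exact cubic_ne_zero (i := 2) h

theorem lin_eq_cubic (p q : ℝ) : lin p q = cubic ![q, p, 0, 0] := by
  simp [lin, cubic]

theorem lin_ne_zero {p q : ℝ} (h : p ≠ 0 ∨ q ≠ 0) : lin p q ≠ 0 := by
  rw [lin_eq_cubic]
  rcases h with h | h
  · exact cubic_ne_zero (i := 1) h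
  · exact cubic_ne_zero (i := 0) h

theorem C_ne_zero' {r : ℝ} (h : r ≠ 0) : RatFunc.C r ≠ 0 := by simpa using h

theorem freqInv_quad_div (c d : Fin 3 → ℝ) : freqInv (quad c / quad d) =
    quad ![c 2, c 1, c 0] / quad ![d 2, d 1, d 0] := by
  have hX : (RatFunc.X : RatFunc ℝ) ≠ 0 := RatFunc.X_ne_zero
  have h : ∀ c : Fin 3 → ℝ, freqInv (quad c) = quad ![c 2, c 1, c 0] / RatFunc.X ^ 2 := fun c => by
    simp [quad]; field_simp; ring
  rw [map_div₀, h, h, div_div_div_cancel_right₀ (pow_ne_zero 2 hX)]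

theorem lin_div_mem_of_lt {p q t u : ℝ} (hp : 0 ≤ p) (hq : 0 ≤ q) (hu : 0 ≤ u)
    (h : p * u < t * q) : lin p q / lin t u ∈ impedanceSet 1 0 := by
  have hD : 0 < t * q - p * u := sub_pos.2 h
  have htq : 0 < t * q := lt_of_le_of_lt (by positivity) h
  have ht' : 0 < t := pos_of_mul_pos_left htq hq
  have h1 := capacitor_mem_impedanceSet (C := t ^ 2 / (t * q - p * u)) (by positivity)
  have h2 := C_parallel_mem_impedanceSet (g := t * u / (t * q - p * u)) (by positivity) h1
  have h3 := C_add_mem_impedanceSet (R := p / t) (by positivity) h2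
  convert h3 using 1
  have n1 := C_ne_zero' ht'.ne'
  have n2 := C_ne_zero' hD.ne'
  have n3 : lin t u ≠ 0 := lin_ne_zero (Or.inl ht'.ne')
  rw [inv_inv]
  have e : RatFunc.C (t * u / (t * q - p * u)) + RatFunc.C (t ^ 2 / (t * q - p * u)) * RatFunc.X
      = RatFunc.C t * lin t u / RatFunc.C (t * q - p * u) := by
    simp only [lin, map_div₀]
    field_simp
    simp only [map_mul, map_pow]
    ring
  rw [e, map_div₀, inv_div]
  field_simp
  simp only [lin, map_sub, map_mul]
  ring

theorem lin_div_mem_of_gt {p q t u : ℝ} (hq : 0 ≤ q) (ht : 0 ≤ t) (hu : 0 ≤ u)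
    (h : t * q < p * u) : lin p q / lin t u ∈ impedanceSet 0 1 := by
  rw [← inv_div]
  exact inv_mem_impedanceSet (lin_div_mem_of_lt ht hu hq (by linarith))

section

variable {c d : Fin 3 → ℝ}

/-- Subtracting the value at `s = 0` leaves `c/d - c₀/d₀ = s(α₂s + α₁)/(d₀ d)`. Its admittance has a
pole at `0`, realized by the inductor `α₁/d₀²`, and the remainder is the reciprocal of a bilinear
function. The determinant of the latter has the sign of `α₂² - α₁α₃`, up to orientation, which
decides between capacitor and inductor. -/
theorem quad_div_mem_of_lam₁_nonneg {m n : ℕ} (hc : ∀ j, 0 ≤ c j) (hd : ∀ j, 0 ≤ d j)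
    (h₁ : 0 ≤ lam₁ c d) (h₂ : 0 ≤ α₂ c d) (hα : α₁ c d * α₃ c d ≠ α₂ c d ^ 2)
    (h : (α₁ c d * α₃ c d < α₂ c d ^ 2 → m = 1 ∧ n = 0) ∧
      (α₂ c d ^ 2 < α₁ c d * α₃ c d → m = 0 ∧ n = 1)) :
    quad c / quad d ∈ impedanceSet m (1 + n) := by
  have hc0 := hc 0
  have hc1 := hc 1
  have hc2 := hc 2
  have hd0 := hd 0
  have hd1 := hd 1
  have hd2 := hd 2
  have q0 : 0 < d 0 := by
    refine lt_of_le_of_ne hd0 fun h0 => hα ?_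
    simp only [lam₁, α₁, α₂, α₃, ← h0] at *
    have e1 : c 0 * d 2 = 0 := le_antisymm (by linarith) (by positivity)
    have e2 : c 0 * d 1 ^ 2 = 0 := le_antisymm (by linarith) (by positivity)
    have e2' : c 0 * d 1 = 0 := by simpa using e2
    rw [e1, e2']
    ring
  have a1 : 0 < α₁ c d := by
    have hle : 0 ≤ d 1 * α₁ c d := by
      have : 0 ≤ d 0 * α₂ c d := by positivity
      unfold lam₁ at h₁
      linarith
    have h0 : 0 ≤ α₁ c d := by
      by_contra! hneg
      have hd10 : d 1 = 0 := le_antisymm (nonpos_of_mul_nonneg_left hle hneg) hd1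
      have : 0 ≤ c 1 * d 0 := by positivity
      simp only [α₁, hd10] at hneg
      linarith
    refine lt_of_le_of_ne h0 fun h0 => hα ?_
    have : d 0 * α₂ c d = 0 := by
      refine le_antisymm ?_ (by positivity)
      unfold lam₁ at h₁
      rw [← h0] at h₁
      linarith
    rw [(mul_eq_zero.1 this).resolve_left q0.ne', ← h0]
    ring
  have hG : lin (α₁ c d * α₂ c d) (α₁ c d ^ 2) / lin (d 0 * α₁ c d * d 2) (d 0 * lam₁ c d)
      ∈ impedanceSet m n := by
    have e : d 0 * α₁ c d * d 2 * α₁ c d ^ 2 - α₁ c d * α₂ c d * (d 0 * lam₁ c d) =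
        α₁ c d * d 0 ^ 2 * (α₂ c d ^ 2 - α₁ c d * α₃ c d) := by
      simp only [lam₁, α₁, α₂, α₃]; ring
    have hpos : 0 < α₁ c d * d 0 ^ 2 := by positivity
    rcases lt_or_gt_of_ne hα with hlt | hlt
    · obtain ⟨rfl, rfl⟩ := h.1 hlt
      refine lin_div_mem_of_lt (by positivity) (by positivity) (by positivity) ?_
      have := mul_pos hpos (sub_pos.2 hlt)
      linarith
    · obtain ⟨rfl, rfl⟩ := h.2 hlt
      refine lin_div_mem_of_gt (by positivity) (by positivity) (by positivity) ?_
      have := mul_pos hpos (sub_pos.2 hlt)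
      linarith
  have h1 := inductor_mem_impedanceSet (L := α₁ c d / d 0 ^ 2) (by positivity)
  have h3 := C_add_mem_impedanceSet (R := c 0 / d 0) (by positivity)
    (parallel_mem_impedanceSet h1 hG)
  rw [zero_add] at h3
  convert h3 using 1
  have n0 := C_ne_zero' q0.ne'
  have n1 := C_ne_zero' a1.ne'
  have n2 : quad d ≠ 0 := quad_ne_zero q0.ne'
  have nX : (RatFunc.X : RatFunc ℝ) ≠ 0 := RatFunc.X_ne_zero
  have n3 : lin (α₂ c d) (α₁ c d) ≠ 0 := lin_ne_zero (Or.inr a1.ne')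
  have e1 : lin (α₁ c d * α₂ c d) (α₁ c d ^ 2) =
      RatFunc.C (α₁ c d) * lin (α₂ c d) (α₁ c d) := by
    simp only [lin, map_mul, map_pow]; ring
  have e2 : lin (d 0 * α₁ c d * d 2) (d 0 * lam₁ c d) =
      RatFunc.C (d 0) * lin (α₁ c d * d 2) (lam₁ c d) := by
    simp only [lin, map_mul]; ring
  have e3 : (RatFunc.C (α₁ c d / d 0 ^ 2) * RatFunc.X)⁻¹ +
      (lin (α₁ c d * α₂ c d) (α₁ c d ^ 2) / lin (d 0 * α₁ c d * d 2) (d 0 * lam₁ c d))⁻¹ =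
      RatFunc.C (d 0) * quad d / (RatFunc.X * lin (α₂ c d) (α₁ c d)) := by
    rw [e1, e2, inv_div, map_div₀, map_pow]
    field_simp
    simp only [lin, quad, lam₁, map_mul, map_sub]
    ring
  rw [e3, inv_div, map_div₀]
  field_simp
  simp only [lin, quad, α₁, α₂, map_mul, map_sub]
  ring

/-- Frequency inversion, duality and their composite carry the cases `λ₃`, `λ₄` and `λ₂` to `λ₁`;
all three preserve the count of one capacitor and one inductor. -/
theorem quad_div_mem_of_isRegular (hc : ∀ j, 0 ≤ c j) (hd : ∀ j, 0 ≤ d j)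
    (hreg : IsRegular c d) (hα : α₁ c d * α₃ c d < α₂ c d ^ 2) :
    quad c / quad d ∈ impedanceSet 1 1 := by
  have key : ∀ c d : Fin 3 → ℝ, (∀ j, 0 ≤ c j) → (∀ j, 0 ≤ d j) → 0 ≤ lam₁ c d → 0 ≤ α₂ c d →
      α₁ c d * α₃ c d < α₂ c d ^ 2 → quad c / quad d ∈ impedanceSet 1 1 :=
    fun c d hc hd h₁ h₂ hα => quad_div_mem_of_lam₁_nonneg (n := 0) hc hd h₁ h₂ hα.ne
      ⟨fun _ => ⟨rfl, rfl⟩, fun h => absurd h hα.not_gt⟩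
  have hrev : ∀ c : Fin 3 → ℝ, (∀ j, 0 ≤ c j) → ∀ j, 0 ≤ (![c 2, c 1, c 0] : Fin 3 → ℝ) j := by
    intro c hc j
    fin_cases j
    exacts [hc 2, hc 1, hc 0]
  have hrr : ∀ c : Fin 3 → ℝ, ![c 2, c 1, c 0] 2 = c 0 ∧ ![c 2, c 1, c 0] 1 = c 1 ∧
    ![c 2, c 1, c 0] 0 = c 2 := fun c => ⟨rfl, rfl, rfl⟩
  rcases hreg with ⟨h1, h2⟩ | ⟨h1, h2⟩ | ⟨h1, h2⟩ | ⟨h1, h2⟩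
  · exact key c d hc hd h1 h2 hα
  · rw [← freqInv_freqInv (quad c / quad d), freqInv_quad_div]
    refine freqInv_mem_impedanceSet (key _ _ (hrev c hc) (hrev d hd) ?_ ?_ ?_) <;>
      simp only [lam₁, lam₃, α₁, α₂, α₃, hrr] at * <;> linarith
  · rw [← inv_div]
    refine inv_mem_impedanceSet (key _ _ hd hc ?_ ?_ ?_) <;>
      simp only [lam₁, lam₄, α₁, α₂, α₃] at * <;> linarith
  · rw [← inv_div, ← freqInv_freqInv (quad d / quad c), freqInv_quad_div]
    refine inv_mem_impedanceSet (freqInv_mem_impedanceSet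
      (key _ _ (hrev d hd) (hrev c hc) ?_ ?_ ?_)) <;>
      simp only [lam₁, lam₂, α₁, α₂, α₃, hrr] at * <;> linarith

theorem exists_pos_of_α_ne (hc : ∀ j, 0 ≤ c j) (hd : ∀ j, 0 ≤ d j)
    (hα : α₁ c d * α₃ c d ≠ α₂ c d ^ 2) : (∃ j, 0 < c j) ∧ ∃ j, 0 < d j := by
  constructor
  · by_contra! h
    have h0 : ∀ j, c j = 0 := fun j => le_antisymm (h j) (hc j)
    exact hα (by simp [α₁, α₂, α₃, h0])
  · by_contra! h
    have h0 : ∀ j, d j = 0 := fun j => le_antisymm (h j) (hd j)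
    exact hα (by simp [α₁, α₂, α₃, h0])

variable {R L K x : ℝ} {a b : Fin 4 → ℝ}

theorem shuntDen_ne_zero (hx : 0 ≤ x) (hL : 0 < L) (hc : ∀ j, 0 ≤ c j) (hd : ∀ j, 0 ≤ d j)
    (hd' : ∃ j, 0 < d j) : ∃ i, 0 < shuntDen L x c d i := by
  have hc0 := hc 0
  have hc1 := hc 1
  have hc2 := hc 2
  have hd0 := hd 0
  have hd1 := hd 1
  have hd2 := hd 2
  obtain ⟨j, hj⟩ := hd'
  fin_cases j
  · refine ⟨1, ?_⟩
    have : 0 < d 0 := hj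
    simp only [shuntDen, Matrix.cons_val]
    positivity
  · refine ⟨2, ?_⟩
    have : 0 < d 1 := hj
    simp only [shuntDen, Matrix.cons_val]
    positivity
  · refine ⟨3, ?_⟩
    have : 0 < d 2 := hj
    simp only [shuntDen, Matrix.cons_val]
    positivity

theorem shuntDen'_ne_zero (hx : 0 ≤ x) (hK : 0 < K) (hc : ∀ j, 0 ≤ c j) (hd : ∀ j, 0 ≤ d j)
    (hd' : ∃ j, 0 < d j) : ∃ i, 0 < shuntDen' K x c d i := by
  have hc0 := hc 0
  have hc1 := hc 1
  have hc2 := hc 2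
  have hd0 := hd 0
  have hd1 := hd 1
  have hd2 := hd 2
  obtain ⟨j, hj⟩ := hd'
  fin_cases j
  · refine ⟨0, ?_⟩
    have : 0 < d 0 := hj
    simp only [shuntDen', Matrix.cons_val]
    positivity
  · refine ⟨1, ?_⟩
    have : 0 < d 1 := hj
    simp only [shuntDen', Matrix.cons_val]
    positivity
  · refine ⟨2, ?_⟩
    have : 0 < d 2 := hj
    simp only [shuntDen', Matrix.cons_val]
    positivity

theorem cubic_shunt (hx : 0 ≤ x) (hL : 0 < L) (hc : ∀ j, 0 ≤ c j) (hd : ∀ j, 0 ≤ d j)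
    (hc' : ∃ j, 0 < c j) (hd' : ∃ j, 0 < d j) :
    cubic (shuntNum R L x c d) / cubic (shuntDen L x c d) =
      RatFunc.C R + ((RatFunc.C (L * x) + RatFunc.C L * RatFunc.X)⁻¹ + (quad c / quad d)⁻¹)⁻¹ := by
  obtain ⟨i, hi⟩ := shuntDen_ne_zero hx hL hc hd hd'
  obtain ⟨j, hj⟩ := hc'
  obtain ⟨k, hk⟩ := hd'
  have n1 := cubic_ne_zero hi.ne'
  have n2 := quad_ne_zero hj.ne'
  have n3 := quad_ne_zero hk.ne'
  have n4 : RatFunc.C (L * x) + RatFunc.C L * RatFunc.X ≠ 0 := by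
    rw [add_comm]; exact lin_ne_zero (Or.inl hL.ne')
  have e : (RatFunc.C (L * x) + RatFunc.C L * RatFunc.X)⁻¹ + (quad c / quad d)⁻¹ =
      cubic (shuntDen L x c d) / ((RatFunc.C (L * x) + RatFunc.C L * RatFunc.X) * quad c) := by
    rw [inv_div]
    field_simp
    simp [cubic, shuntDen, quad]
    ring
  rw [e, inv_div]
  field_simp
  simp [cubic, shuntNum, shuntDen, quad]
  ring

theorem cubic_shunt' (hx : 0 ≤ x) (hK : 0 < K) (hc : ∀ j, 0 ≤ c j) (hd : ∀ j, 0 ≤ d j)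
    (hc' : ∃ j, 0 < c j) (hd' : ∃ j, 0 < d j) :
    cubic (shuntNum' R K x c d) / cubic (shuntDen' K x c d) =
      RatFunc.C R + ((RatFunc.C (x / K) + (RatFunc.C K * RatFunc.X)⁻¹)⁻¹
        + (quad c / quad d)⁻¹)⁻¹ := by
  obtain ⟨i, hi⟩ := shuntDen'_ne_zero hx hK hc hd hd'
  obtain ⟨j, hj⟩ := hc'
  obtain ⟨k, hk⟩ := hd'
  have n1 := cubic_ne_zero hi.ne'
  have n2 := quad_ne_zero hj.ne'
  have n3 := quad_ne_zero hk.ne'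
  have n5 := C_ne_zero' hK.ne'
  have nX : (RatFunc.X : RatFunc ℝ) ≠ 0 := RatFunc.X_ne_zero
  have n4 : lin x 1 ≠ 0 := lin_ne_zero (Or.inr one_ne_zero)
  have e0 : RatFunc.C (x / K) + (RatFunc.C K * RatFunc.X)⁻¹ =
      lin x 1 / (RatFunc.C K * RatFunc.X) := by
    rw [map_div₀]
    field_simp
    simp [lin]
  have e : (RatFunc.C (x / K) + (RatFunc.C K * RatFunc.X)⁻¹)⁻¹ + (quad c / quad d)⁻¹ =
      cubic (shuntDen' K x c d) / (lin x 1 * quad c) := by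
    rw [e0, inv_div, inv_div]
    field_simp
    simp [cubic, shuntDen', quad, lin]
    ring
  rw [e, inv_div]
  field_simp
  simp [cubic, shuntNum', shuntDen', quad, lin]
  ring

/-- `shunt_eq` supplies the element values: `R` in series with the parallel connection of `L(s + x)`
and `c/d`. The rest checks that the signs are right after rescaling. -/
theorem mem_impedanceSet_of_regularCond (hx : 0 ≤ x) (h : RegularCond a b x) :
    cubic a / cubic b ∈ impedanceSet 1 2 := by
  have main : ∀ {l e}, CommonCond a b x l e → IsRegular
      ((evalNeg b x / quadNeg (cVec a b x) x) • cVec a b x)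
      ((evalNeg b x / quadNeg (cVec a b x) x ^ 2) • dVec a b x) →
      cubic a / cubic b ∈ impedanceSet 1 2 := by
    intro l e h hreg
    have hb := h.evalNeg_ne_zero hx
    have hq := h.quadNeg_pos hx
    obtain ⟨ha, hc, hd, -⟩ := h.nonneg_mul
    obtain ⟨eb, ea⟩ := shunt_eq hb hq.ne'
    have hα := h.α_lt hx
    have hL : 0 < quadNeg (cVec a b x) x / evalNeg b x ^ 2 := by positivity
    have hR : 0 ≤ evalNeg a x / evalNeg b x := by
      rw [← mul_div_mul_left _ _ hb]
      exact div_nonneg ha (mul_self_nonneg _)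
    have hc' : ∀ j, 0 ≤ ((evalNeg b x / quadNeg (cVec a b x) x) • cVec a b x) j := fun j => by
      rw [Pi.smul_apply, smul_eq_mul, div_mul_eq_mul_div]
      exact div_nonneg (hc j) hq.le
    have hd' : ∀ j, 0 ≤ ((evalNeg b x / quadNeg (cVec a b x) x ^ 2) • dVec a b x) j := fun j => by
      rw [Pi.smul_apply, smul_eq_mul, div_mul_eq_mul_div]
      exact div_nonneg (hd j) (by positivity)
    have hα' : α₁ ((evalNeg b x / quadNeg (cVec a b x) x) • cVec a b x)
        ((evalNeg b x / quadNeg (cVec a b x) x ^ 2) • dVec a b x) *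
        α₃ ((evalNeg b x / quadNeg (cVec a b x) x) • cVec a b x)
        ((evalNeg b x / quadNeg (cVec a b x) x ^ 2) • dVec a b x) <
        α₂ ((evalNeg b x / quadNeg (cVec a b x) x) • cVec a b x)
        ((evalNeg b x / quadNeg (cVec a b x) x ^ 2) • dVec a b x) ^ 2 := by
      rw [α₁_smul, α₂_smul, α₃_smul]
      have : 0 < (evalNeg b x / quadNeg (cVec a b x) x *
          (evalNeg b x / quadNeg (cVec a b x) x ^ 2)) ^ 2 := by positivity
      have := mul_lt_mul_of_pos_left hα this
      linarith
    obtain ⟨pc, pd⟩ := exists_pos_of_α_ne hc' hd' hα'.ne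
    have e := cubic_shunt (R := evalNeg a x / evalNeg b x) hx hL hc' hd' pc pd
    rw [← ea, ← eb] at e
    rw [e]
    refine C_add_mem_impedanceSet hR (parallel_mem_impedanceSet (m := 0) (n := 1) (m' := 1)
      (n' := 1) (C_add_mem_impedanceSet (by positivity) (inductor_mem_impedanceSet hL))
      (quad_div_mem_of_isRegular hc' hd' hreg hα'))
  have hpos : ∀ {l e}, CommonCond a b x l e →
      (∀ y, 0 ≤ evalNeg b x * y → 0 ≤ evalNeg b x / quadNeg (cVec a b x) x *
        (evalNeg b x / quadNeg (cVec a b x) x ^ 2) ^ 2 * y) ∧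
      (∀ y, 0 ≤ evalNeg b x * y → 0 ≤ (evalNeg b x / quadNeg (cVec a b x) x) ^ 2 *
        (evalNeg b x / quadNeg (cVec a b x) x ^ 2) * y) ∧
      (∀ y, 0 ≤ y → 0 ≤ evalNeg b x / quadNeg (cVec a b x) x *
        (evalNeg b x / quadNeg (cVec a b x) x ^ 2) * y) := by
    intro l e h
    have hq := h.quadNeg_pos hx
    generalize quadNeg (cVec a b x) x = q at *
    generalize evalNeg b x = k at *
    refine ⟨fun y hy => ?_, fun y hy => ?_, fun y hy => ?_⟩
    · rw [show k / q * (k / q ^ 2) ^ 2 * y = (k / q ^ 2) ^ 2 / q * (k * y) by ring]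
      positivity
    · rw [show (k / q) ^ 2 * (k / q ^ 2) * y = (k / q) ^ 2 / q ^ 2 * (k * y) by ring]
      positivity
    · rw [show k / q * (k / q ^ 2) * y = (k / q) ^ 2 / q * y by ring]
      positivity
  rcases h with h | h | h | h
  · refine main h (Or.inl ?_)
    rw [lam₁_smul, α₂_smul]
    exact ⟨(hpos h).1 _ h.nonneg_mul.2.2.2, (hpos h).2.2 _ h.2.2.2.1⟩
  · refine main h (Or.inr (Or.inl ?_))
    rw [lam₃_smul, α₂_smul, ← mul_neg]
    exact ⟨(hpos h).1 _ h.nonneg_mul.2.2.2, (hpos h).2.2 _ h.2.2.2.1⟩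
  · refine main h (Or.inr (Or.inr (Or.inl ?_)))
    rw [lam₄_smul, α₂_smul, ← mul_neg]
    exact ⟨(hpos h).2.1 _ h.nonneg_mul.2.2.2, (hpos h).2.2 _ h.2.2.2.1⟩
  · refine main h (Or.inr (Or.inr (Or.inr ?_)))
    rw [lam₂_smul, α₂_smul]
    exact ⟨(hpos h).2.1 _ h.nonneg_mul.2.2.2, (hpos h).2.2 _ h.2.2.2.1⟩

theorem mem_impedanceSet_of_C5 (hx : 0 ≤ x) (h : C5 a b x) :
    cubic a / cubic b ∈ impedanceSet 1 2 := by
  have hb := h.evalNegRev_ne_zero hx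
  have hq := h.quadNegRev_pos hx
  obtain ⟨ha, hc, hd, hl⟩ := h.nonneg_mul
  have he := h.2.2.2.1
  obtain ⟨eb, ea⟩ := shunt'_eq hb hq.ne'
  have hα := h.α_lt hx
  have hK : 0 < evalNegRev b x ^ 2 / quadNegRev (cVec' a b x) x := by positivity
  have hR : 0 ≤ evalNegRev a x / evalNegRev b x := by
    rw [← mul_div_mul_left _ _ hb]
    exact div_nonneg ha (mul_self_nonneg _)
  generalize evalNegRev a x / evalNegRev b x = R at *
  generalize evalNegRev b x ^ 2 / quadNegRev (cVec' a b x) x = K at *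
  have hu : ∃ u, 1 / evalNegRev b x = u * evalNegRev b x ∧ 0 < u :=
    ⟨1 / evalNegRev b x ^ 2, by field_simp, by positivity⟩
  have hv : ∃ v, 1 / (evalNegRev b x * quadNegRev (cVec' a b x) x) = v * evalNegRev b x ∧ 0 < v :=
    ⟨1 / (evalNegRev b x ^ 2 * quadNegRev (cVec' a b x) x), by field_simp, by positivity⟩
  obtain ⟨u, hu, hu0⟩ := hu
  obtain ⟨v, hv, hv0⟩ := hv
  rw [hu, hv] at eb ea
  generalize evalNegRev b x = k at *
  generalize cVec' a b x = c at *
  generalize dVec' a b x = d at *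
  have hc' : ∀ j, 0 ≤ ((u * k) • c) j := fun j => by
    rw [Pi.smul_apply, smul_eq_mul, mul_assoc]
    exact mul_nonneg hu0.le (hc j)
  have hd' : ∀ j, 0 ≤ ((v * k) • d) j := fun j => by
    rw [Pi.smul_apply, smul_eq_mul, mul_assoc]
    exact mul_nonneg hv0.le (hd j)
  have hα' : α₂ ((u * k) • c) ((v * k) • d) ^ 2 <
      α₁ ((u * k) • c) ((v * k) • d) * α₃ ((u * k) • c) ((v * k) • d) := by
    rw [α₁_smul, α₂_smul, α₃_smul]
    have : 0 < (u * k * (v * k)) ^ 2 := by positivity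
    have := mul_lt_mul_of_pos_left hα this
    linarith
  have h₁ : 0 ≤ lam₁ ((u * k) • c) ((v * k) • d) := by
    rw [lam₁_smul, show u * k * (v * k) ^ 2 * lam₁ c d = u * (v * k) ^ 2 * (k * lam₁ c d) by ring]
    positivity
  have h₂ : 0 ≤ α₂ ((u * k) • c) ((v * k) • d) := by
    rw [α₂_smul, show u * k * (v * k) * α₂ c d = u * v * k ^ 2 * α₂ c d by ring]
    positivity
  obtain ⟨pc, pd⟩ := exists_pos_of_α_ne hc' hd' hα'.ne'
  rw [ea, eb, cubic_shunt' hx hK hc' hd' pc pd]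
  exact C_add_mem_impedanceSet hR (parallel_mem_impedanceSet (m := 1) (n := 0) (m' := 0)
      (n' := 2) (C_add_mem_impedanceSet (by positivity) (capacitor_mem_impedanceSet hK))
      (quad_div_mem_of_lam₁_nonneg (n := 1) hc' hd' h₁ h₂ hα'.ne'
        ⟨fun h => absurd h hα'.not_gt, fun _ => ⟨rfl, rfl⟩⟩))

theorem mem_impedanceSet_of_boundaryCond (hx : 0 ≤ x) (h : BoundaryCond a b x) :
    cubic a / cubic b ∈ impedanceSet 1 2 := by
  rcases h with h | h | h | h | h
  · exact mem_impedanceSet_of_regularCond hx (Or.inl h.1)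
  · exact mem_impedanceSet_of_regularCond hx (Or.inr (Or.inl h.1))
  · exact mem_impedanceSet_of_regularCond hx (Or.inr (Or.inr (Or.inl h.1)))
  · exact mem_impedanceSet_of_regularCond hx (Or.inr (Or.inr (Or.inr h.1)))
  · exact mem_impedanceSet_of_C5 hx h.1

theorem mem_storageSet_of_boundaryCond {Z Y : RatFunc ℝ} (hx : 0 ≤ x) (hY : Y = Z ∨ Y = 1 / Z)
    (hf : FormOne Y a b ∨ FormTwo Y a b) (h : BoundaryCond a b x) : Z ∈ storageSet 3 := by
  have hm := mem_impedanceSet_of_boundaryCond hx h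
  have hYm : Y ∈ impedanceSet 1 2 := by
    rcases hf with ⟨-, rfl⟩ | ⟨-, rfl⟩
    · exact hm
    · rw [← freqInv_cubic_div, ← inv_div, map_inv₀]
      exact inv_mem_impedanceSet (freqInv_mem_impedanceSet hm)
  rcases hY with rfl | rfl
  · exact ⟨1, 2, rfl, hYm⟩
  · refine ⟨2, 1, rfl, ?_⟩
    have := inv_mem_impedanceSet hYm
    rwa [one_div, inv_inv] at this

end

/-! ### Resistor-capacitor networks -/

/-- The quadratic form of the matrix `-ℬ(a, b)`. -/
def bezForm (a b : Fin 4 → ℝ) (v₀ v₁ v₂ : ℝ) : ℝ :=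
  -(bezoutian a b 0 0 * v₀ ^ 2 + bezoutian a b 1 1 * v₁ ^ 2 + bezoutian a b 2 2 * v₂ ^ 2
    + 2 * bezoutian a b 0 1 * v₀ * v₁ + 2 * bezoutian a b 0 2 * v₀ * v₂
    + 2 * bezoutian a b 1 2 * v₁ * v₂)

section

variable {a b : Fin 4 → ℝ}

theorem bezoutian_isHermitian (a b : Fin 4 → ℝ) : (-bezoutian a b).IsHermitian := by
  ext i j
  fin_cases i <;> fin_cases j <;> simp [bezoutian]

theorem dotProduct_bezoutian (v : Fin 3 → ℝ) :
    star v ⬝ᵥ (-bezoutian a b).mulVec v = bezForm a b (v 0) (v 1) (v 2) := by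
  simp [bezForm, Matrix.mulVec, dotProduct, Fin.sum_univ_three, bezoutian]
  ring

theorem posDef_of_bezForm_nonneg (h : ∀ v₀ v₁ v₂, 0 ≤ bezForm a b v₀ v₁ v₂) (h0 : R₀ a b ≠ 0) :
    (-bezoutian a b).PosDef := by
  have hs : (-bezoutian a b).PosSemidef :=
    Matrix.PosSemidef.of_dotProduct_mulVec_nonneg (bezoutian_isHermitian a b) fun v => by
      rw [dotProduct_bezoutian]; exact h _ _ _
  rw [hs.posDef_iff_isUnit, Matrix.isUnit_iff_isUnit_det, isUnit_iff_ne_zero, Matrix.det_neg]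
  rw [R₀_eq] at h0
  simpa using h0

/-- Sylvester's criterion by completing squares, starting from the last variable; the coefficient
left on `v₀²` is a multiple of `R₀`. -/
theorem bezForm_pos_of_R_pos (h2 : 0 < R₂ a b) (h1 : 0 < R₁ a b) (h0 : 0 < R₀ a b)
    {v₀ v₁ v₂ : ℝ} (hv : v₀ ≠ 0) : 0 < bezForm a b v₀ v₁ v₂ := by
  rw [R₀_eq, Matrix.det_fin_three] at h0
  rw [R₁_eq] at h1
  rw [R₂_eq] at h2
  have s01 : bezoutian a b 1 0 = bezoutian a b 0 1 := by simp [bezoutian]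
  have s02 : bezoutian a b 2 0 = bezoutian a b 0 2 := by simp [bezoutian]
  have s12 : bezoutian a b 2 1 = bezoutian a b 1 2 := by simp [bezoutian]
  rw [s01, s02, s12] at h0
  unfold bezForm
  generalize bezoutian a b 0 0 = p at *
  generalize bezoutian a b 0 1 = q at *
  generalize bezoutian a b 0 2 = r at *
  generalize bezoutian a b 1 1 = s at *
  generalize bezoutian a b 1 2 = t at *
  generalize bezoutian a b 2 2 = u at *
  have hm : 0 < (-u) * (s * u - t * t) := mul_pos h2 h1
  have key : (-u) * (s * u - t * t) * -(p * v₀ ^ 2 + s * v₁ ^ 2 + u * v₂ ^ 2 + 2 * q * v₀ * v₁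
      + 2 * r * v₀ * v₂ + 2 * t * v₁ * v₂) =
      (s * u - t * t) * (u * v₂ + r * v₀ + t * v₁) ^ 2 +
      ((s * u - t * t) * v₁ + (q * u - r * t) * v₀) ^ 2 +
      (-u) * -(p * s * u - p * t * t - q * q * u + q * t * r + r * q * t - r * s * r) * v₀ ^ 2 := by
    ring
  have hpos : 0 < (-u) * -(p * s * u - p * t * t - q * q * u + q * t * r + r * q * t - r * s * r)
      * v₀ ^ 2 := by
    have : 0 < v₀ ^ 2 := by positivity
    exact mul_pos (mul_pos h2 h0) this
  have : 0 < (-u) * (s * u - t * t) * -(p * v₀ ^ 2 + s * v₁ ^ 2 + u * v₂ ^ 2 + 2 * q * v₀ * v₁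
      + 2 * r * v₀ * v₂ + 2 * t * v₁ * v₂) := by
    rw [key]
    have := mul_nonneg h1.le (sq_nonneg (u * v₂ + r * v₀ + t * v₁))
    have := sq_nonneg ((s * u - t * t) * v₁ + (q * u - r * t) * v₀)
    linarith
  exact pos_of_mul_pos_right this hm.le

/-- At a zero `ζ` of `b` the Hermitian extension of the Bezoutian form, evaluated at `(1, ζ, ζ²)`,
vanishes if `ζ` is non-real or a multiple root. Positivity therefore makes all zeros real and
simple, and non-negative coefficients place them at `-x`, `-y`, `-z` with `x`, `y`, `z ≥ 0`. -/
theorem exists_roots (hb : ∀ i, 0 ≤ b i) (hb3 : 0 < b 3)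
    (hpos : ∀ v₁ v₂, 0 < bezForm a b 1 v₁ v₂)
    (hnn : ∀ v₁ v₂, 0 ≤ bezForm a b 0 v₁ v₂) :
    ∃ x y z : ℝ, 0 ≤ x ∧ 0 ≤ y ∧ 0 ≤ z ∧ x ≠ y ∧ y ≠ z ∧ x ≠ z ∧
      b 0 = b 3 * (x * y * z) ∧ b 1 = b 3 * (x * y + y * z + x * z) ∧ b 2 = b 3 * (x + y + z) := by
  have hb0 := hb 0
  have hb1 := hb 1
  have hb2 := hb 2
  have hneg : ∀ t, evalNeg b t = 0 → 0 ≤ t := by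
    intro t ht
    by_contra! h
    have h' : 0 < -t := by linarith
    have : 0 < evalNeg b t := by unfold evalNeg; positivity
    linarith
  obtain ⟨x, hx⟩ : ∃ x, evalNeg b x = 0 := by
    -- `N` is chosen so that `N ≥ 1` and `b₃N` exceeds `b₀ + b₂`; then the cubic term dominates and
    -- `b(-N) ≤ 0`.
    set N := (b 0 + b 2) / b 3 + 1 with hN
    have hN1 : 1 ≤ N := by
      have : 0 ≤ (b 0 + b 2) / b 3 := by positivity
      linarith
    have hN2 : b 3 * N = b 0 + b 2 + b 3 := by rw [hN]; field_simp
    have hlt : evalNeg b N ≤ 0 := by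
      have e : evalNeg b N = -(b 1 * N) - b 0 * (N ^ 2 - 1) - N ^ 2 * (b 3 * N - b 0 - b 2) := by
        unfold evalNeg; ring
      have h1 : 0 ≤ b 1 * N := by positivity
      have h2 : 0 ≤ b 0 * (N ^ 2 - 1) := mul_nonneg hb0 (by nlinarith)
      have h3 : 0 ≤ N ^ 2 * (b 3 * N - b 0 - b 2) := by rw [hN2]; ring_nf; positivity
      linarith
    have hgt : 0 ≤ evalNeg b 0 := by simpa [evalNeg] using hb0
    obtain ⟨x, -, hx⟩ := intermediate_value_Icc' (by linarith : (0 : ℝ) ≤ N)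
      (continuous_evalNeg b).continuousOn ⟨hlt, hgt⟩
    exact ⟨x, hx⟩
  have hx0 := hneg x hx
  set e₁ := b 2 - x * b 3 with he₁
  set e₀ := b 1 - x * e₁ with he₀
  have h2 : b 2 = e₁ + x * b 3 := by rw [he₁]; ring
  have h1 : b 1 = e₀ + x * e₁ := by rw [he₀]; ring
  have h0 : b 0 = x * e₀ := by
    have : evalNeg b x = b 0 - x * e₀ := by rw [he₀, he₁]; unfold evalNeg; ring
    linarith
  clear_value e₁ e₀
  have hdisc : 0 < e₁ ^ 2 - 4 * b 3 * e₀ := by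
    by_contra! hle
    set u := -e₁ / (2 * b 3) with hu
    set w := (4 * b 3 * e₀ - e₁ ^ 2) / (4 * b 3 ^ 2) with hw
    have hw0 : 0 ≤ w := div_nonneg (by linarith) (by positivity)
    have hu' : e₁ = -(2 * b 3 * u) := by rw [hu]; field_simp
    have hw' : e₀ = b 3 * (u ^ 2 + w) := by rw [hu, hw]; field_simp; ring
    -- The quadratic factor has zeros `ζ = u ± i√w`. The real part of `(1, ζ, ζ²)` is `(1, u, u² -
    -- w)` and the imaginary part is `±√w (0, 1, 2u)`, so the sum is the Hermitian form at that
    -- vector. The case `w = 0` covers a double root.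
    have hsum : bezForm a b 1 u (u ^ 2 - w) + w * bezForm a b 0 1 (2 * u) = 0 := by
      simp only [bezForm, bezoutian, Matrix.of_apply, Matrix.cons_val]
      rw [h0, h1, h2, hu', hw']
      ring
    have := hpos u (u ^ 2 - w)
    have := mul_nonneg hw0 (hnn 1 (2 * u))
    linarith
  set D := Real.sqrt (e₁ ^ 2 - 4 * b 3 * e₀) with hD
  have hD0 : 0 < D := Real.sqrt_pos.2 hdisc
  have hD2 : D ^ 2 = e₁ ^ 2 - 4 * b 3 * e₀ := Real.sq_sqrt hdisc.le
  set y := (e₁ + D) / (2 * b 3) with hy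
  set z := (e₁ - D) / (2 * b 3) with hz
  have hyz : y - z = D / b 3 := by rw [hy, hz]; field_simp; ring
  have hs : e₁ = b 3 * (y + z) := by rw [hy, hz]; field_simp; ring
  have hp : e₀ = b 3 * (y * z) := by
    rw [hy, hz]; field_simp; linarith
  clear_value y z
  have hne : ∀ t, evalNeg b t = 0 → b 3 * 3 * t ^ 2 - 2 * b 2 * t + b 1 ≠ 0 := by
    intro t ht h'
    have := hpos (-t) (t ^ 2)
    have e : bezForm a b 1 (-t) (t ^ 2) = evalNeg a t * (b 3 * 3 * t ^ 2 - 2 * b 2 * t + b 1)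
        - (a 3 * 3 * t ^ 2 - 2 * a 2 * t + a 1) * evalNeg b t := by
      simp only [bezForm, bezoutian, Matrix.of_apply, Matrix.cons_val, evalNeg]
      ring
    rw [e, ht, h'] at this
    linarith
  have hy0 : evalNeg b y = 0 := by
    unfold evalNeg; rw [h0, h1, h2, hs, hp]; ring
  have hz0 : evalNeg b z = 0 := by
    unfold evalNeg; rw [h0, h1, h2, hs, hp]; ring
  refine ⟨x, y, z, hx0, hneg y hy0, hneg z hz0, ?_, ?_, ?_, ?_, ?_, ?_⟩
  · rintro rfl
    apply hne x hx; rw [h1, h2, hs, hp]; ring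
  · rintro rfl
    have : 0 < D / b 3 := by positivity
    linarith
  · rintro rfl
    apply hne x hx; rw [h1, h2, hs, hp]; ring
  · rw [h0, hp]; ring
  · rw [h1, hs, hp]; ring
  · rw [h2, hs]; ring

theorem pole_mem_impedanceSet {k x : ℝ} (hk : 0 < k) (hx : 0 ≤ x) :
    RatFunc.C k / lin 1 x ∈ impedanceSet 1 0 := by
  have h := C_parallel_mem_impedanceSet (g := x / k) (by positivity)
    (capacitor_mem_impedanceSet (C := 1 / k) (by positivity))
  convert h using 1
  have n1 := C_ne_zero' hk.ne'
  rw [inv_inv, ← inv_div]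
  congr 1
  simp only [lin, map_div₀, map_one]
  field_simp
  ring

/-- Foster's synthesis: `a/b` is `a₃/b₃` plus three simple fractions. The form at `(1, -t, t²)`,
with `-t` a root of `b`, is the product of `a(-t)` and `b'(-t)`, whose quotient is the residue;
hence the residues are positive. -/
theorem mem_impedanceSet_of_C6 (h : C6 a b) : cubic a / cubic b ∈ impedanceSet 3 0 := by
  obtain ⟨hab, hb3, -, -, -, h2, h1, h0⟩ := h
  have hpos : ∀ v₁ v₂, 0 < bezForm a b 1 v₁ v₂ :=
    fun v₁ v₂ => bezForm_pos_of_R_pos h2 h1 h0 one_ne_zero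
  have hnn : ∀ v₁ v₂, 0 ≤ bezForm a b 0 v₁ v₂ := by
    intro v₁ v₂
    have hlim : Filter.Tendsto (fun t : ℝ => bezForm a b t v₁ v₂) (nhdsWithin 0 (Set.Ioi 0))
        (nhds (bezForm a b 0 v₁ v₂)) := by
      have : Continuous fun t : ℝ => bezForm a b t v₁ v₂ := by unfold bezForm; fun_prop
      exact this.continuousAt.tendsto.mono_left nhdsWithin_le_nhds
    refine ge_of_tendsto hlim (Filter.eventually_of_mem self_mem_nhdsWithin fun t ht => ?_)
    exact (bezForm_pos_of_R_pos h2 h1 h0 (ne_of_gt ht)).le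
  obtain ⟨x, y, z, hx, hy, hz, hxy, hyz, hxz, e0, e1, e2⟩ :=
    exists_roots (fun i => (hab i).2) hb3 hpos hnn
  have hres : ∀ t u v, b 0 = b 3 * (t * u * v) → b 1 = b 3 * (t * u + u * v + t * v) →
      b 2 = b 3 * (t + u + v) → 0 < evalNeg a t / (b 3 * ((u - t) * (v - t))) := by
    intro t u v e0 e1 e2
    have := hpos (-t) (t ^ 2)
    have e : bezForm a b 1 (-t) (t ^ 2) = evalNeg a t * (b 3 * ((u - t) * (v - t))) := by
      simp only [bezForm, bezoutian, Matrix.of_apply, Matrix.cons_val, evalNeg]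
      rw [e0, e1, e2]
      ring
    rw [e] at this
    rcases mul_pos_iff.1 this with h | h
    · exact div_pos h.1 h.2
    · exact div_pos_of_neg_of_neg h.1 h.2
  have kx := hres x y z e0 e1 e2
  have ky := hres y x z (by rw [e0]; ring) (by rw [e1]; ring) (by rw [e2]; ring)
  have kz := hres z x y (by rw [e0]; ring) (by rw [e1]; ring) (by rw [e2]; ring)
  have ha3 := (hab 3).1
  have hm := C_add_mem_impedanceSet (R := a 3 / b 3) (by positivity)
    (add_mem_impedanceSet (add_mem_impedanceSet (pole_mem_impedanceSet kx hx)
      (pole_mem_impedanceSet ky hy)) (pole_mem_impedanceSet kz hz))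
  have hyx' : y - x ≠ 0 := sub_ne_zero.2 hxy.symm
  have hzx' : z - x ≠ 0 := sub_ne_zero.2 hxz.symm
  have hzy' : z - y ≠ 0 := sub_ne_zero.2 hyz.symm
  have hxy' : x - y ≠ 0 := sub_ne_zero.2 hxy
  have hxz' : x - z ≠ 0 := sub_ne_zero.2 hxz
  have hyz' : y - z ≠ 0 := sub_ne_zero.2 hyz
  set p := evalNeg a x / (b 3 * ((y - x) * (z - x))) with hp
  set q := evalNeg a y / (b 3 * ((x - y) * (z - y))) with hq
  set r := evalNeg a z / (b 3 * ((x - z) * (y - z))) with hr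
  set s := a 3 / b 3 with hs
  have b3' := hb3.ne'
  have a3 : a 3 = b 3 * s := by rw [hs]; field_simp
  have a2 : a 2 = b 3 * (s * (x + y + z) + p + q + r) := by
    rw [hp, hq, hr, hs]; unfold evalNeg
    rw [show x - y = -(y - x) by ring, show x - z = -(z - x) by ring,
      show y - z = -(z - y) by ring]
    field_simp
    ring
  have a1 : a 1 = b 3 * (s * (x * y + y * z + x * z) + p * (y + z) + q * (x + z)
      + r * (x + y)) := by
    rw [hp, hq, hr, hs]; unfold evalNeg
    rw [show x - y = -(y - x) by ring, show x - z = -(z - x) by ring,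
      show y - z = -(z - y) by ring]
    field_simp
    ring
  have a0 : a 0 = b 3 * (s * (x * y * z) + p * (y * z) + q * (x * z) + r * (x * y)) := by
    rw [hp, hq, hr, hs]; unfold evalNeg
    rw [show x - y = -(y - x) by ring, show x - z = -(z - x) by ring,
      show y - z = -(z - y) by ring]
    field_simp
    ring
  clear_value p q r s
  convert hm using 1
  have nx : lin 1 x ≠ 0 := lin_ne_zero (Or.inl one_ne_zero)
  have ny : lin 1 y ≠ 0 := lin_ne_zero (Or.inl one_ne_zero)
  have nz : lin 1 z ≠ 0 := lin_ne_zero (Or.inl one_ne_zero)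
  have nb := C_ne_zero' b3'
  have eb : cubic b = RatFunc.C (b 3) * (lin 1 x * lin 1 y * lin 1 z) := by
    simp only [cubic, lin, e0, e1, e2, map_mul, map_add, map_one]
    ring
  rw [eb]
  field_simp
  simp only [cubic, lin, a0, a1, a2, a3, map_mul, map_add, map_one]
  ring

/-- A non-zero resultant upgrades semidefinite to definite, which gives the positive minors. The
Hurwitz inequalities come from the roots of `b`, through `b₁b₂ - b₀b₃ = b₃²(x + y)(y + z)(x + z)`.
-/
theorem C6_of_bezForm_nonneg (hab : ∀ i, 0 ≤ a i ∧ 0 ≤ b i)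
    (h : ∀ v₀ v₁ v₂, 0 ≤ bezForm a b v₀ v₁ v₂) (h0 : R₀ a b ≠ 0) : C6 a b := by
  have hpd := posDef_of_bezForm_nonneg h h0
  have hR0 : 0 < R₀ a b := by
    have := hpd.det_pos
    rw [Matrix.det_neg, Fintype.card_fin] at this
    rw [R₀_eq]
    linarith
  have hR2 : 0 < R₂ a b := by
    have := hpd.diag_pos (i := 2)
    rw [R₂_eq]
    simpa using this
  have hR1 : 0 < R₁ a b := by
    have := (hpd.submatrix (e := Fin.succ) (Fin.succ_injective 2)).det_pos
    rw [Matrix.det_fin_two] at this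
    rw [R₁_eq]
    have s12 : bezoutian a b 2 1 = bezoutian a b 1 2 := by simp [bezoutian]
    simp [s12] at this
    linarith
  have hb3 : 0 < b 3 := by
    refine lt_of_le_of_ne (hab 3).2 fun h3 => ?_
    have e : R₂ a b = b 3 * a 2 - a 3 * b 2 := by
      rw [R₂_eq]; simp [bezoutian]
    rw [e, ← h3] at hR2
    have := mul_nonneg (hab 3).1 (hab 2).2
    linarith
  obtain ⟨x, y, z, hx, hy, hz, hxy, hyz, hxz, e0, e1, e2⟩ :=
    exists_roots (fun i => (hab i).2) hb3
      (fun v₁ v₂ => bezForm_pos_of_R_pos hR2 hR1 hR0 one_ne_zero) (h 0)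
  have key : ∀ s t : ℝ, 0 ≤ s → 0 ≤ t → s ≠ t → 0 < s + t := by
    intro s t hs ht hst
    refine lt_of_le_of_ne (by positivity) fun h => hst ?_
    have h1 : s = 0 := by linarith
    have h2 : t = 0 := by linarith
    rw [h1, h2]
  have pxy := key x y hx hy hxy
  have pyz := key y z hy hz hyz
  have pxz := key x z hx hz hxz
  refine ⟨hab, hb3, ?_, ?_, ?_, hR2, hR1, hR0⟩
  · rw [e2]; exact mul_pos hb3 (by linarith)
  · rw [e1]
    refine mul_pos hb3 ?_
    rcases hx.eq_or_lt with rfl | hx'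
    · have := mul_pos (by linarith : 0 < y) (by linarith : 0 < z)
      linarith
    · have := mul_pos hx' pyz
      have := mul_nonneg hy hz
      linarith
  · rw [e0, e1, e2, show b 3 * (x * y + y * z + x * z) * (b 3 * (x + y + z))
      - b 3 * (x * y * z) * b 3 = b 3 ^ 2 * ((x + y) * (y + z) * (x + z)) by ring]
    positivity

end

/-! ### Positivity -/

/-- A quotient of two polynomials that are positive at `1`. -/
def IsPos (Z : RatFunc ℝ) : Prop := ∃ p q : Polynomial ℝ, 0 < p.eval 1 ∧ 0 < q.eval 1 ∧
  Z = algebraMap (Polynomial ℝ) (RatFunc ℝ) p / algebraMap (Polynomial ℝ) (RatFunc ℝ) q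

theorem algebraMap_ne_zero_of_eval_pos {p : Polynomial ℝ} (hp : 0 < p.eval 1) :
    algebraMap (Polynomial ℝ) (RatFunc ℝ) p ≠ 0 :=
  RatFunc.algebraMap_ne_zero (by rintro rfl; simp at hp)

/-- Positivity at the single point `s = 1` is stable under sums and inverses, which keeps every
denominator in the network manipulations non-zero. -/
theorem IsPos.ne_zero {Z : RatFunc ℝ} (h : IsPos Z) : Z ≠ 0 := by
  obtain ⟨p, q, hp, hq, rfl⟩ := h
  exact div_ne_zero (algebraMap_ne_zero_of_eval_pos hp) (algebraMap_ne_zero_of_eval_pos hq)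

theorem IsPos.inv {Z : RatFunc ℝ} (h : IsPos Z) : IsPos Z⁻¹ := by
  obtain ⟨p, q, hp, hq, rfl⟩ := h
  exact ⟨q, p, hq, hp, inv_div _ _⟩

theorem IsPos.add {Z W : RatFunc ℝ} (h : IsPos Z) (h' : IsPos W) : IsPos (Z + W) := by
  obtain ⟨p, q, hp, hq, rfl⟩ := h
  obtain ⟨p', q', hp', hq', rfl⟩ := h'
  refine ⟨p * q' + q * p', q * q', ?_, ?_, ?_⟩
  · simp only [Polynomial.eval_add, Polynomial.eval_mul]; positivity
  · simp only [Polynomial.eval_mul]; positivity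
  · rw [div_add_div _ _ (algebraMap_ne_zero_of_eval_pos hq) (algebraMap_ne_zero_of_eval_pos hq')]
    simp

theorem isPos_C {r : ℝ} (hr : 0 < r) : IsPos (RatFunc.C r) :=
  ⟨Polynomial.C r, 1, by simpa, by simp, by simp⟩

theorem isPos_quad_div {c d : Fin 3 → ℝ} (hc : 0 < c 0 + c 1 + c 2) (hd : 0 < d 0 + d 1 + d 2) :
    IsPos (quad c / quad d) := by
  refine ⟨cubicPoly ![c 0, c 1, c 2, 0], cubicPoly ![d 0, d 1, d 2, 0], ?_, ?_, ?_⟩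
  · simp [cubicPoly]; linarith
  · simp [cubicPoly]; linarith
  · rw [quad_eq_cubic, quad_eq_cubic, algebraMap_cubicPoly, algebraMap_cubicPoly]

theorem quad_ne_zero_of_sum_pos {c : Fin 3 → ℝ} (hc : 0 < c 0 + c 1 + c 2) : quad c ≠ 0 := by
  by_contra h
  have h2 := (isPos_quad_div (d := ![1, 0, 0]) hc (by simp)).ne_zero
  rw [h, zero_div] at h2
  exact h2 rfl

theorem exists_pos_of_sum_pos {c : Fin 3 → ℝ} (hc : 0 < c 0 + c 1 + c 2) : ∃ j, 0 < c j := by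
  by_contra! h
  linarith [h 0, h 1, h 2]

theorem lin_eq_quad (p q : ℝ) : lin p q = quad ![q, p, 0] := by simp [lin, quad]

theorem lin_ne_zero_of_sum_pos {p q : ℝ} (h : 0 < p + q) : lin p q ≠ 0 := by
  rw [lin_eq_quad]; exact quad_ne_zero_of_sum_pos (by simpa [add_comm] using h)

/-! ### Classes of impedances with few storage elements -/

/-- Bilinear impedances; `σ = 1` for the inductive and `σ = -1` for the capacitive ones. -/
def ClassOne (σ : ℝ) (Z : RatFunc ℝ) : Prop := ∃ p q t u : ℝ, 0 ≤ p ∧ 0 ≤ q ∧ 0 ≤ t ∧ 0 ≤ u ∧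
  0 < p + q ∧ 0 < t + u ∧ 0 ≤ σ * (p * u - t * q) ∧ Z = lin p q / lin t u

/-- Biquadratic impedances with semidefinite Bezoutian (two storage elements of one kind). -/
def ClassTwo (σ : ℝ) (Z : RatFunc ℝ) : Prop := ∃ c d : Fin 3 → ℝ, (∀ j, 0 ≤ c j) ∧ (∀ j, 0 ≤ d j) ∧
  0 < c 0 + c 1 + c 2 ∧ 0 < d 0 + d 1 + d 2 ∧
  (∀ v w : ℝ, 0 ≤ σ * (α₁ c d * v ^ 2 + 2 * α₂ c d * v * w + α₃ c d * w ^ 2)) ∧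
  Z = quad c / quad d

/-- Regular biquadratic impedances (one inductor and one capacitor). -/
def ClassReg (Z : RatFunc ℝ) : Prop := ∃ c d : Fin 3 → ℝ, (∀ j, 0 ≤ c j) ∧ (∀ j, 0 ≤ d j) ∧
  0 < c 0 + c 1 + c 2 ∧ 0 < d 0 + d 1 + d 2 ∧ IsRegular c d ∧ α₁ c d * α₃ c d ≤ α₂ c d ^ 2 ∧
  Z = quad c / quad d

/-- Bicubic impedances with semidefinite Bezoutian (three storage elements of one kind). -/
def ClassThree (σ : ℝ) (Z : RatFunc ℝ) : Prop := ∃ a b : Fin 4 → ℝ, (∀ i, 0 ≤ a i ∧ 0 ≤ b i) ∧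
  (∃ i, 0 < a i) ∧ (∃ i, 0 < b i) ∧ (∀ v₀ v₁ v₂ : ℝ, 0 ≤ -(σ * bezForm a b v₀ v₁ v₂)) ∧
  Z = cubic a / cubic b

section

variable {σ r R : ℝ} {Z W : RatFunc ℝ}

theorem ClassOne.isPos (h : ClassOne σ Z) : IsPos Z := by
  obtain ⟨p, q, t, u, hp, hq, ht, hu, hpq, htu, hs, rfl⟩ := h
  rw [lin_eq_quad, lin_eq_quad]
  exact isPos_quad_div (by simpa [add_comm] using hpq) (by simpa [add_comm] using htu)

theorem ClassTwo.isPos (h : ClassTwo σ Z) : IsPos Z := by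
  obtain ⟨c, d, hc, hd, hc', hd', hs, rfl⟩ := h
  exact isPos_quad_div hc' hd'

theorem ClassReg.isPos (h : ClassReg Z) : IsPos Z := by
  obtain ⟨c, d, hc, hd, hc', hd', hs, h, rfl⟩ := h
  exact isPos_quad_div hc' hd'

theorem ClassOne.inv (h : ClassOne σ Z) : ClassOne (-σ) Z⁻¹ := by
  obtain ⟨p, q, t, u, hp, hq, ht, hu, hpq, htu, hs, rfl⟩ := h
  exact ⟨t, u, p, q, ht, hu, hp, hq, htu, hpq, by linarith, inv_div _ _⟩

theorem ClassTwo.inv (h : ClassTwo σ Z) : ClassTwo (-σ) Z⁻¹ := by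
  obtain ⟨c, d, hc, hd, hc', hd', hs, rfl⟩ := h
  refine ⟨d, c, hd, hc, hd', hc', fun v w => (hs v w).trans_eq ?_, inv_div _ _⟩
  simp only [α₁, α₂, α₃]; ring

theorem ClassReg.inv (h : ClassReg Z) : ClassReg Z⁻¹ := by
  obtain ⟨c, d, hc, hd, hc', hd', hs, h, rfl⟩ := h
  refine ⟨d, c, hd, hc, hd', hc', ?_, ?_, inv_div _ _⟩
  · rcases hs with ⟨h1, h2⟩ | ⟨h1, h2⟩ | ⟨h1, h2⟩ | ⟨h1, h2⟩
    · refine Or.inr (Or.inr (Or.inl ?_))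
      simp only [lam₁, lam₄, α₁, α₂] at *
      constructor <;> linarith
    · refine Or.inr (Or.inr (Or.inr ?_))
      simp only [lam₂, lam₃, α₃, α₂] at *
      constructor <;> linarith
    · refine Or.inl ?_
      simp only [lam₁, lam₄, α₁, α₂] at *
      constructor <;> linarith
    · refine Or.inr (Or.inl ?_)
      simp only [lam₂, lam₃, α₃, α₂] at *
      constructor <;> linarith
  · simp only [α₁, α₂, α₃] at *; linarith

theorem ClassThree.inv (h : ClassThree σ Z) : ClassThree (-σ) Z⁻¹ := by
  obtain ⟨a, b, hab, ha, hb, hs, rfl⟩ := h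
  refine ⟨b, a, fun i => (hab i).symm, hb, ha, fun v₀ v₁ v₂ => (hs v₀ v₁ v₂).trans_eq ?_,
    inv_div _ _⟩
  simp only [bezForm, bezoutian, Matrix.of_apply, Matrix.cons_val]; ring

/-! #### Scaling -/

theorem ClassOne.smul (hr : 0 < r) (h : ClassOne σ Z) : ClassOne σ (RatFunc.C r * Z) := by
  obtain ⟨p, q, t, u, hp, hq, ht, hu, hpq, htu, hs, rfl⟩ := h
  refine ⟨r * p, r * q, t, u, by positivity, by positivity, ht, hu, ?_, htu, ?_, ?_⟩
  · rw [← mul_add]; positivity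
  · have := mul_nonneg hr.le hs
    linarith
  · rw [← mul_div_assoc]; congr 1; simp only [lin, map_mul]; ring

theorem quad_smul (r : ℝ) (c : Fin 3 → ℝ) : quad (r • c) = RatFunc.C r * quad c := by
  simp [quad]; ring

theorem ClassTwo.smul (hr : 0 < r) (h : ClassTwo σ Z) : ClassTwo σ (RatFunc.C r * Z) := by
  obtain ⟨c, d, hc, hd, hc', hd', hs, rfl⟩ := h
  refine ⟨r • c, d, fun j => mul_nonneg hr.le (hc j), hd, ?_, hd', fun v w => ?_, ?_⟩
  · simp only [Pi.smul_apply, smul_eq_mul]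
    have := mul_pos hr hc'
    linarith
  · have := mul_nonneg hr.le (hs v w)
    have e := one_smul ℝ d
    rw [← e, α₁_smul, α₂_smul, α₃_smul]
    linarith
  · rw [quad_smul, mul_div_assoc]

theorem ClassReg.smul (hr : 0 < r) (h : ClassReg Z) : ClassReg (RatFunc.C r * Z) := by
  obtain ⟨c, d, hc, hd, hc', hd', hs, h, rfl⟩ := h
  refine ⟨r • c, d, fun j => mul_nonneg hr.le (hc j), hd, ?_, hd', ?_, ?_, ?_⟩
  · simp only [Pi.smul_apply, smul_eq_mul]
    have := mul_pos hr hc'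
    linarith
  · rw [← one_smul ℝ d]
    simp only [IsRegular, lam₁_smul, lam₂_smul, lam₃_smul, lam₄_smul, α₂_smul, ← mul_neg]
    rcases hs with ⟨h1, h2⟩ | ⟨h1, h2⟩ | ⟨h1, h2⟩ | ⟨h1, h2⟩
    · left; constructor <;> positivity
    · right; left; constructor <;> positivity
    · right; right; left; constructor <;> positivity
    · right; right; right; constructor <;> positivity
  · rw [← one_smul ℝ d, α₁_smul, α₂_smul, α₃_smul]
    have := mul_le_mul_of_nonneg_left h (sq_nonneg r)
    linarith
  · rw [quad_smul, mul_div_assoc]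

/-! #### The substitution `s ↦ 1 / s` -/

theorem ClassTwo.freqInv (h : ClassTwo σ Z) : ClassTwo (-σ) (freqInv Z) := by
  obtain ⟨c, d, hc, hd, hc', hd', hs, rfl⟩ := h
  have hrev : ∀ c : Fin 3 → ℝ, (∀ j, 0 ≤ c j) → ∀ j, 0 ≤ (![c 2, c 1, c 0] : Fin 3 → ℝ) j := by
    intro c hc j
    fin_cases j
    exacts [hc 2, hc 1, hc 0]
  refine ⟨_, _, hrev c hc, hrev d hd, ?_, ?_, fun v w => (hs w v).trans_eq ?_,
    freqInv_quad_div c d⟩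
  · simp only [Matrix.cons_val]; linarith
  · simp only [Matrix.cons_val]; linarith
  · simp only [α₁, α₂, α₃, Matrix.cons_val]; ring

theorem ClassReg.freqInv (h : ClassReg Z) : ClassReg (freqInv Z) := by
  obtain ⟨c, d, hc, hd, hc', hd', hs, h, rfl⟩ := h
  have hrev : ∀ c : Fin 3 → ℝ, (∀ j, 0 ≤ c j) → ∀ j, 0 ≤ (![c 2, c 1, c 0] : Fin 3 → ℝ) j := by
    intro c hc j
    fin_cases j
    exacts [hc 2, hc 1, hc 0]
  refine ⟨_, _, hrev c hc, hrev d hd, ?_, ?_, ?_, ?_, freqInv_quad_div c d⟩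
  · simp only [Matrix.cons_val]; linarith
  · simp only [Matrix.cons_val]; linarith
  · rcases hs with ⟨h1, h2⟩ | ⟨h1, h2⟩ | ⟨h1, h2⟩ | ⟨h1, h2⟩
    · refine Or.inr (Or.inl ?_)
      simp only [lam₁, lam₃, α₁, α₂, α₃, Matrix.cons_val] at *
      constructor <;> linarith
    · refine Or.inl ?_
      simp only [lam₁, lam₃, α₁, α₂, α₃, Matrix.cons_val] at *
      constructor <;> linarith
    · refine Or.inr (Or.inr (Or.inr ?_))
      simp only [lam₂, lam₄, α₁, α₂, α₃, Matrix.cons_val] at *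
      constructor <;> linarith
    · refine Or.inr (Or.inr (Or.inl ?_))
      simp only [lam₂, lam₄, α₁, α₂, α₃, Matrix.cons_val] at *
      constructor <;> linarith
  · simp only [α₁, α₂, α₃, Matrix.cons_val] at *; linarith

theorem ClassOne.freqInv (h : ClassOne σ Z) : ClassOne (-σ) (freqInv Z) := by
  obtain ⟨p, q, t, u, hp, hq, ht, hu, hpq, htu, hs, rfl⟩ := h
  refine ⟨q, p, u, t, hq, hp, hu, ht, by linarith, by linarith, by linarith, ?_⟩
  have hX : (RatFunc.X : RatFunc ℝ) ≠ 0 := RatFunc.X_ne_zero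
  have e : ∀ p q, SPImpedance.freqInv (lin p q) = lin q p / RatFunc.X := fun p q => by
    simp [lin]; field_simp; ring
  rw [map_div₀, e, e, div_div_div_cancel_right₀ hX]

/-! #### Series resistors -/

theorem ClassOne.C_add (hR : 0 ≤ R) (h : ClassOne σ Z) : ClassOne σ (RatFunc.C R + Z) := by
  obtain ⟨p, q, t, u, hp, hq, ht, hu, hpq, htu, hs, rfl⟩ := h
  refine ⟨p + R * t, q + R * u, t, u, by positivity, by positivity, ht, hu, ?_, htu, by linarith, ?_⟩
  · have := mul_nonneg hR htu.le
    linarith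
  · have := lin_ne_zero_of_sum_pos htu
    field_simp
    simp only [lin, map_mul, map_add]; ring

theorem quad_add_mul (c d : Fin 3 → ℝ) (hd : quad d ≠ 0) :
    RatFunc.C R + quad c / quad d = quad (c + R • d) / quad d := by
  field_simp
  simp [quad]; ring

theorem α_add_smul (c d : Fin 3 → ℝ) (R : ℝ) : α₁ (c + R • d) d = α₁ c d ∧
    α₂ (c + R • d) d = α₂ c d ∧ α₃ (c + R • d) d = α₃ c d := by
  simp only [α₁, α₂, α₃, Pi.add_apply, Pi.smul_apply, smul_eq_mul]
  refine ⟨?_, ?_, ?_⟩ <;> ring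

theorem ClassTwo.C_add (hR : 0 ≤ R) (h : ClassTwo σ Z) : ClassTwo σ (RatFunc.C R + Z) := by
  obtain ⟨c, d, hc, hd, hc', hd', hs, rfl⟩ := h
  refine ⟨c + R • d, d, fun j => add_nonneg (hc j) (mul_nonneg hR (hd j)), hd, ?_, hd', ?_,
    quad_add_mul c d (quad_ne_zero_of_sum_pos hd')⟩
  · simp only [Pi.add_apply, Pi.smul_apply, smul_eq_mul]
    have := mul_nonneg hR hd'.le
    linarith
  · obtain ⟨h1, h2, h3⟩ := α_add_smul c d R
    rwa [h1, h2, h3]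

/-- From `c₁λ₃ = -α₂α₃ - d₁λ₂`, where `c₁α₃ ≥ c₂α₂ ≥ 0`; the case `c₁ = 0` is direct. This is the
sign that makes regularity survive a series resistor. -/
theorem lam₃_nonpos {c d : Fin 3 → ℝ} (hc : ∀ j, 0 ≤ c j) (hd : ∀ j, 0 ≤ d j)
    (h₂ : 0 ≤ lam₂ c d) (hα : 0 ≤ α₂ c d) : lam₃ c d ≤ 0 := by
  have hc0 := hc 0
  have hc1 := hc 1
  have hc2 := hc 2
  have hd0 := hd 0
  have hd1 := hd 1
  have hd2 := hd 2
  have key : c 1 * lam₃ c d = -(α₃ c d * α₂ c d) - d 1 * lam₂ c d := by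
    simp only [lam₂, lam₃, α₂, α₃]; ring
  have h13 : 0 ≤ c 1 * α₃ c d := by
    have := mul_nonneg hc2 hα
    unfold lam₂ at h₂
    linarith
  rcases hc1.eq_or_lt with h | h
  · have h2 : c 2 * α₂ c d = 0 := by
      refine le_antisymm ?_ (by positivity)
      unfold lam₂ at h₂
      rw [← h] at h₂
      linarith
    have h3 : α₃ c d = c 2 * d 1 := by unfold α₃; rw [← h]; ring
    rcases mul_eq_zero.1 h2 with h4 | h4
    · have : 0 ≤ c 0 * d 2 := by positivity
      have h5 : α₂ c d = -(c 0 * d 2) := by unfold α₂; rw [h4]; ring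
      have h6 : α₂ c d = 0 := by linarith
      unfold lam₃
      rw [h6, h3, h4]
      simp
    · unfold lam₃
      rw [h4, h3]
      have : 0 ≤ d 1 * (c 2 * d 1) := by positivity
      linarith
  · have h3 : 0 ≤ α₃ c d := nonneg_of_mul_nonneg_right h13 h
    have : c 1 * lam₃ c d ≤ 0 := by
      rw [key]
      have := mul_nonneg h3 hα
      have := mul_nonneg hd1 h₂
      linarith
    exact nonpos_of_mul_nonpos_right this h

theorem lam₁_nonpos {c d : Fin 3 → ℝ} (hc : ∀ j, 0 ≤ c j) (hd : ∀ j, 0 ≤ d j)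
    (h₄ : 0 ≤ lam₄ c d) (hα : 0 ≤ -α₂ c d) : lam₁ c d ≤ 0 := by
  have hrev : ∀ c : Fin 3 → ℝ, (∀ j, 0 ≤ c j) → ∀ j, 0 ≤ (![c 2, c 1, c 0] : Fin 3 → ℝ) j := by
    intro c hc j
    fin_cases j
    exacts [hc 2, hc 1, hc 0]
  have := lam₃_nonpos (hrev c hc) (hrev d hd)
  simp only [lam₁, lam₂, lam₃, lam₄, α₁, α₂, α₃, Matrix.cons_val] at *
  linarith [this (by linarith) (by linarith)]

/-- The `αᵢ`, `λ₁` and `λ₃` do not change, while `λ₂` becomes `λ₂ - Rλ₃` and `λ₄` becomes `λ₄ -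
Rλ₁`; the subtracted terms are non-positive where it matters. -/
theorem IsRegular.add_smul {c d : Fin 3 → ℝ} (hc : ∀ j, 0 ≤ c j) (hd : ∀ j, 0 ≤ d j)
    (hR : 0 ≤ R) (h : IsRegular c d) : IsRegular (c + R • d) d := by
  obtain ⟨e1, e2, e3⟩ := α_add_smul c d R
  have l1 : lam₁ (c + R • d) d = lam₁ c d := by simp only [lam₁, e1, e2]
  have l3 : lam₃ (c + R • d) d = lam₃ c d := by simp only [lam₃, e3, e2]
  have l2 : lam₂ (c + R • d) d = lam₂ c d - R * lam₃ c d := by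
    simp only [lam₂, lam₃, e3, e2, Pi.add_apply, Pi.smul_apply, smul_eq_mul]; ring
  have l4 : lam₄ (c + R • d) d = lam₄ c d - R * lam₁ c d := by
    simp only [lam₄, lam₁, e1, e2, Pi.add_apply, Pi.smul_apply, smul_eq_mul]; ring
  simp only [IsRegular, l1, l2, l3, l4, e2]
  rcases h with h | h | h | h
  · exact Or.inl h
  · exact Or.inr (Or.inl h)
  · refine Or.inr (Or.inr (Or.inl ⟨?_, h.2⟩))
    have := mul_nonneg hR (sub_nonneg.2 (lam₁_nonpos hc hd h.1 h.2))
    linarith [h.1]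
  · refine Or.inr (Or.inr (Or.inr ⟨?_, h.2⟩))
    have := mul_nonneg hR (sub_nonneg.2 (lam₃_nonpos hc hd h.1 h.2))
    linarith [h.1]

theorem ClassReg.C_add (hR : 0 ≤ R) (h : ClassReg Z) : ClassReg (RatFunc.C R + Z) := by
  obtain ⟨c, d, hc, hd, hc', hd', hs, h, rfl⟩ := h
  refine ⟨c + R • d, d, fun j => add_nonneg (hc j) (mul_nonneg hR (hd j)), hd, ?_, hd',
    hs.add_smul hc hd hR, ?_, quad_add_mul c d (quad_ne_zero_of_sum_pos hd')⟩
  · simp only [Pi.add_apply, Pi.smul_apply, smul_eq_mul]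
    have := mul_nonneg hR hd'.le
    linarith
  · obtain ⟨h1, h2, h3⟩ := α_add_smul c d R
    rwa [h1, h2, h3]

theorem ClassThree.C_add (hR : 0 ≤ R) (h : ClassThree σ Z) : ClassThree σ (RatFunc.C R + Z) := by
  obtain ⟨a, b, hab, ⟨i, hi⟩, ⟨j, hj⟩, hs, rfl⟩ := h
  refine ⟨a + R • b, b, fun i => ⟨add_nonneg (hab i).1 (mul_nonneg hR (hab i).2), (hab i).2⟩,
    ⟨i, add_pos_of_pos_of_nonneg hi (mul_nonneg hR (hab i).2)⟩, ⟨j, hj⟩,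
    fun v₀ v₁ v₂ => (hs v₀ v₁ v₂).trans_eq ?_, ?_⟩
  · simp only [bezForm, bezoutian, Matrix.of_apply, Matrix.cons_val, Pi.add_apply, Pi.smul_apply,
      smul_eq_mul]
    ring
  · have := cubic_ne_zero hj.ne'
    field_simp
    simp [cubic]; ring

/-! #### Series connections -/

theorem ClassOne.add (h : ClassOne σ Z) (h' : ClassOne σ W) : ClassTwo σ (Z + W) := by
  obtain ⟨p, q, t, u, hp, hq, ht, hu, hpq, htu, hs, rfl⟩ := h
  obtain ⟨p', q', t', u', hp', hq', ht', hu', hpq', htu', hs', rfl⟩ := h'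
  refine ⟨![q * u' + q' * u, p * u' + q * t' + p' * u + q' * t, p * t' + p' * t],
    ![u * u', t * u' + u * t', t * t'], ?_, ?_, ?_, ?_, fun v w => ?_, ?_⟩
  · intro j; fin_cases j <;> simp <;> positivity
  · intro j; fin_cases j <;> simp <;> positivity
  · simp only [Matrix.cons_val]
    have := mul_pos hpq htu'
    have := mul_pos hpq' htu
    linarith
  · simp only [Matrix.cons_val]
    have := mul_pos htu htu'
    linarith
  · have h1 := mul_nonneg hs (sq_nonneg (u' * v + t' * w))
    have h2 := mul_nonneg hs' (sq_nonneg (u * v + t * w))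
    refine (add_nonneg h1 h2).trans_eq ?_
    simp only [α₁, α₂, α₃, Matrix.cons_val]
    ring
  · have n1 := lin_ne_zero_of_sum_pos htu
    have n2 := lin_ne_zero_of_sum_pos htu'
    have e : quad ![u * u', t * u' + u * t', t * t'] = lin t u * lin t' u' := by
      simp [quad, lin]; ring
    rw [e]
    field_simp
    simp [quad, lin]; ring

theorem ClassOne.add_classTwo (h : ClassOne σ Z) (h' : ClassTwo σ W) : ClassThree σ (Z + W) := by
  obtain ⟨p, q, t, u, hp, hq, ht, hu, hpq, htu, hs, rfl⟩ := h
  obtain ⟨c, d, hc, hd, hc', hd', hs', rfl⟩ := h'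
  have hc0 := hc 0
  have hc1 := hc 1
  have hc2 := hc 2
  have hd0 := hd 0
  have hd1 := hd 1
  have hd2 := hd 2
  set a : Fin 4 → ℝ := ![q * d 0 + u * c 0, p * d 0 + q * d 1 + t * c 0 + u * c 1,
      p * d 1 + q * d 2 + t * c 1 + u * c 2, p * d 2 + t * c 2] with ha
  set b : Fin 4 → ℝ := ![u * d 0, t * d 0 + u * d 1, t * d 1 + u * d 2, t * d 2] with hb
  have hab : ∀ i, 0 ≤ a i ∧ 0 ≤ b i := by
    intro i; fin_cases i <;> simp [ha, hb] <;> constructor <;> positivity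
  have n1 := lin_ne_zero_of_sum_pos htu
  have n2 := quad_ne_zero_of_sum_pos hd'
  have hsum : ∀ f : Fin 4 → ℝ, 0 < f 0 + f 1 + f 2 + f 3 → ∃ i, 0 < f i := by
    intro f hf
    by_contra! h
    linarith [h 0, h 1, h 2, h 3]
  refine ⟨a, b, hab, hsum a ?_, hsum b ?_, fun v₀ v₁ v₂ => ?_, ?_⟩
  · simp only [ha, Matrix.cons_val]
    have := mul_pos hpq hd'
    have := mul_pos htu hc'
    linarith
  · simp only [hb, Matrix.cons_val]
    have := mul_pos htu hd'
    linarith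
  · have h1 := hs' (u * v₀ + t * v₁) (u * v₁ + t * v₂)
    have h2 := mul_nonneg hs (sq_nonneg (d 0 * v₀ + d 1 * v₁ + d 2 * v₂))
    refine (add_nonneg h1 h2).trans_eq ?_
    simp only [bezForm, bezoutian, α₁, α₂, α₃, ha, hb, Matrix.of_apply, Matrix.cons_val]
    ring
  · have e : cubic b = lin t u * quad d := by
      simp [cubic, quad, lin, hb]; ring
    rw [e]
    field_simp
    simp [cubic, quad, lin, ha]; ring

/-- The two expressions are `λ₁` and `λ₂` of `ps/(qs + u) + r/(ts + v)` when `α₂ ≥ 0`. If `ut ≤ vq`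
the first is non-negative, otherwise the second. -/
theorem lam_nonneg_of_series {p q r t u v : ℝ} (hp : 0 ≤ p) (hq : 0 ≤ q) (hr : 0 ≤ r)
    (ht : 0 ≤ t) (hu : 0 ≤ u) (hv : 0 ≤ v) (h : 0 ≤ u * t * (p * v - q * r)) :
    0 ≤ u * (q * p * v ^ 3 - u ^ 2 * t ^ 2 * r) ∨
      0 ≤ t * q * r * (2 * p * u * t - p * v * q - q ^ 2 * r) := by
  rcases hu.eq_or_lt with rfl | hu'
  · left; simp
  rcases ht.eq_or_lt with rfl | ht'
  · right; simp
  rcases hq.eq_or_lt with rfl | hq'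
  · right; simp
  have h1 : 0 ≤ p * v - q * r := nonneg_of_mul_nonneg_right h (by positivity)
  rcases le_total (u * t) (v * q) with h2 | h2
  · left
    refine mul_nonneg hu (nonneg_of_mul_nonneg_right (a := q) ?_ hq')
    have h3 : (u * t) ^ 2 ≤ (v * q) ^ 2 := by gcongr
    have h4 : 0 ≤ (u * t) ^ 2 * (p * v - q * r) := by positivity
    have h5 : 0 ≤ p * v * ((v * q) ^ 2 - (u * t) ^ 2) :=
      mul_nonneg (by positivity) (sub_nonneg.2 h3)
    linarith
  · right
    refine mul_nonneg (by positivity) ?_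
    have h4 := mul_nonneg hq h1
    have h5 := mul_nonneg hp (sub_nonneg.2 h2)
    linarith

theorem isRegular_series {p q r t u v : ℝ} (hp : 0 ≤ p) (hq : 0 ≤ q) (hr : 0 ≤ r) (ht : 0 ≤ t)
    (hu : 0 ≤ u) (hv : 0 ≤ v) :
    IsRegular ![u * r, p * v + q * r, p * t] ![u * v, q * v + u * t, q * t] := by
  have e2 : α₂ ![u * r, p * v + q * r, p * t] ![u * v, q * v + u * t, q * t] =
      u * t * (p * v - q * r) := by
    simp only [α₂, Matrix.cons_val]; ring
  simp only [IsRegular, e2]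
  simp only [lam₁, lam₂, lam₃, lam₄, α₁, α₂, α₃, Matrix.cons_val]
  rcases le_total 0 (u * t * (p * v - q * r)) with h | h
  · rcases lam_nonneg_of_series hp hq hr ht hu hv h with h1 | h1
    · exact Or.inl ⟨h1.trans_eq (by ring), h⟩
    · exact Or.inr (Or.inr (Or.inr ⟨h1.trans_eq (by ring), h⟩))
  · rcases lam_nonneg_of_series hr hv hp hu ht hq (by linarith) with h1 | h1
    · exact Or.inr (Or.inl ⟨h1.trans_eq (by ring), by linarith⟩)
    · exact Or.inr (Or.inr (Or.inl ⟨h1.trans_eq (by ring), by linarith⟩))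

/-- Splitting off the value at `s = 0`, and in the next lemma the value at infinity, as a series
resistor brings inductive and capacitive branches to the shapes used in `ClassReg.of_series`. -/
theorem lin_div_eq_at_zero {p q t u : ℝ} (hu : u ≠ 0) :
    lin p q / lin t u = RatFunc.C (q / u) + lin ((p * u - t * q) / u) 0 / lin t u := by
  have n1 := C_ne_zero' hu
  have n2 : lin t u ≠ 0 := lin_ne_zero (Or.inr hu)
  rw [map_div₀]
  field_simp
  simp only [lin, map_div₀, map_sub, map_mul, map_zero]
  field_simp
  ring

theorem lin_div_eq_at_infty {p q t u : ℝ} (ht : t ≠ 0) :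
    lin p q / lin t u = RatFunc.C (p / t) + lin 0 ((t * q - p * u) / t) / lin t u := by
  have n1 := C_ne_zero' ht
  have n2 : lin t u ≠ 0 := lin_ne_zero (Or.inl ht)
  rw [map_div₀]
  field_simp
  simp only [lin, map_div₀, map_sub, map_mul, map_zero]
  field_simp
  ring

/-- A bilinear impedance is a resistor, or the reciprocal of a conductance plus a series connection
of a resistor and one storage element. -/
theorem ClassOne.eq_C_or_lt (h : ClassOne σ Z) (hσ : σ = 1 ∨ σ = -1) :
    (∃ ρ, 0 < ρ ∧ Z = RatFunc.C ρ) ∨ ∃ p q t u : ℝ, 0 ≤ p ∧ 0 ≤ q ∧ 0 ≤ t ∧ 0 ≤ u ∧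
      0 < σ * (p * u - t * q) ∧ Z = lin p q / lin t u := by
  obtain ⟨p, q, t, u, hp, hq, ht, hu, hpq, htu, hs, rfl⟩ := h
  rcases hs.eq_or_lt with h0 | h0
  · left
    have hσ0 : σ ≠ 0 := by rcases hσ with rfl | rfl <;> norm_num
    have h1 : p * u - t * q = 0 := (mul_eq_zero.1 h0.symm).resolve_left hσ0
    refine ⟨(p + q) / (t + u), by positivity, ?_⟩
    have n1 := lin_ne_zero_of_sum_pos htu
    have n2 := C_ne_zero' htu.ne'
    rw [map_div₀, div_eq_div_iff n1 n2]
    have e : RatFunc.C (p * u) = RatFunc.C (t * q) := by rw [sub_eq_zero.1 h1]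
    simp only [map_mul] at e
    simp only [lin, map_add]
    linear_combination (RatFunc.X - 1) * e
  · exact Or.inr ⟨p, q, t, u, hp, hq, ht, hu, h0, rfl⟩

theorem ClassReg.of_series {p q r t u v : ℝ} (hp : 0 ≤ p) (hq : 0 ≤ q) (hr : 0 ≤ r) (ht : 0 ≤ t)
    (hu : 0 ≤ u) (hv : 0 ≤ v) (hp' : 0 < p) (hr' : 0 < r) (hqu : 0 < q + u) (htv : 0 < t + v) :
    ClassReg (lin p 0 / lin q u + lin 0 r / lin t v) := by
  refine ⟨![u * r, p * v + q * r, p * t], ![u * v, q * v + u * t, q * t], ?_, ?_, ?_, ?_,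
    isRegular_series hp hq hr ht hu hv, ?_, ?_⟩
  · intro j; fin_cases j <;> simp <;> positivity
  · intro j; fin_cases j <;> simp <;> positivity
  · simp only [Matrix.cons_val]
    have := mul_pos hp' htv
    have := mul_pos hr' hqu
    linarith
  · simp only [Matrix.cons_val]
    have := mul_pos hqu htv
    linarith
  · have : 0 ≤ p * u * (t * r) * (q * v - u * t) ^ 2 := by positivity
    simp only [α₁, α₂, α₃, Matrix.cons_val]
    linarith
  · have n1 := lin_ne_zero_of_sum_pos hqu
    have n2 := lin_ne_zero_of_sum_pos htv
    have e : quad ![u * v, q * v + u * t, q * t] = lin q u * lin t v := by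
      simp [quad, lin]; ring
    rw [e]
    field_simp
    simp [quad, lin]; ring

theorem ClassReg.of_classOne (h : ClassOne σ Z) (hσ : σ = 1 ∨ σ = -1) : ClassReg Z := by
  obtain ⟨p, q, t, u, hp, hq, ht, hu, hpq, htu, hs, rfl⟩ := h
  refine ⟨![q, p, 0], ![u, t, 0], ?_, ?_, ?_, ?_, ?_, ?_, ?_⟩
  · intro j; fin_cases j <;> simp [hp, hq]
  · intro j; fin_cases j <;> simp [ht, hu]
  · simpa [add_comm] using hpq
  · simpa [add_comm] using htu
  · have e2 : α₂ ![q, p, 0] ![u, t, 0] = 0 := by simp [α₂]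
    simp only [IsRegular, lam₁, lam₂, lam₃, lam₄, e2]
    simp only [α₁, α₃, Matrix.cons_val]
    rcases hσ with rfl | rfl
    · left; have := mul_nonneg ht hs; constructor <;> linarith
    · right; right; left; have := mul_nonneg hp hs; constructor <;> linarith
  · simp [α₁, α₂, α₃]
  · rw [lin_eq_quad, lin_eq_quad]

theorem ClassOne.add_classOne_neg (h : ClassOne 1 Z) (h' : ClassOne (-1) W) :
    ClassReg (Z + W) := by
  rcases h.eq_C_or_lt (Or.inl rfl) with ⟨ρ, hρ, rfl⟩ | ⟨p, q, t, u, hp, hq, ht, hu, hs, rfl⟩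
  · exact (ClassReg.of_classOne h' (Or.inr rfl)).C_add hρ.le
  rcases h'.eq_C_or_lt (Or.inr rfl) with
    ⟨ρ, hρ, rfl⟩ | ⟨p', q', t', u', hp', hq', ht', hu', hs', rfl⟩
  · rw [add_comm]
    exact (ClassReg.of_classOne h (Or.inl rfl)).C_add hρ.le
  have k1 : 0 < p * u - t * q := by linarith
  have k2 : 0 < t' * q' - p' * u' := by linarith
  have hu0 : 0 < u := by
    refine lt_of_le_of_ne hu fun h => ?_
    rw [← h] at k1
    have := mul_nonneg ht hq
    linarith
  have ht0 : 0 < t' := by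
    refine lt_of_le_of_ne ht' fun h => ?_
    rw [← h] at k2
    have := mul_nonneg hp' hu'
    linarith
  rw [lin_div_eq_at_zero hu0.ne', lin_div_eq_at_infty ht0.ne', add_assoc, add_left_comm (lin _ _ / _)]
  exact ((ClassReg.of_series (by positivity) ht (by positivity) ht' hu hu' (by positivity)
    (by positivity) (by positivity) (by positivity)).C_add (by positivity)).C_add (by positivity)

end

/-! ### Three storage elements, not all of one kind -/

/-- A resistor in series with a parallel connection of an impedance with one and an impedance with
two storage elements. For `σ = 1` there are one capacitor and two inductors, for `σ = -1` two
capacitors and one inductor. -/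
def Core (σ : ℝ) (Z : RatFunc ℝ) : Prop := ∃ (R : ℝ) (Z₁ Z₂ : RatFunc ℝ), 0 ≤ R ∧
  ((ClassOne σ Z₁ ∧ ClassReg Z₂) ∨ (ClassOne (-σ) Z₁ ∧ ClassTwo σ Z₂)) ∧
  Z = RatFunc.C R + (Z₁⁻¹ + Z₂⁻¹)⁻¹

/-- Impedances with three storage elements, not all of one kind. -/
def ClassMixed (σ : ℝ) (Z : RatFunc ℝ) : Prop := Core σ Z ∨ Core (-σ) Z⁻¹

section

variable {σ r R : ℝ} {Z W : RatFunc ℝ}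

theorem ClassMixed.inv (h : ClassMixed σ Z) : ClassMixed (-σ) Z⁻¹ := by
  rcases h with h | h
  · right; simpa using h
  · left; exact h

theorem Core.freqInv (h : Core σ Z) : Core (-σ) (freqInv Z) := by
  obtain ⟨R, Z₁, Z₂, hR, h, rfl⟩ := h
  refine ⟨R, SPImpedance.freqInv Z₁, SPImpedance.freqInv Z₂, hR, ?_, by simp⟩
  rcases h with ⟨h1, h2⟩ | ⟨h1, h2⟩
  · exact Or.inl ⟨h1.freqInv, h2.freqInv⟩
  · exact Or.inr ⟨h1.freqInv, h2.freqInv⟩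

theorem ClassTwo.parallel (hr : 0 ≤ r) (h : ClassTwo σ Z) :
    ClassTwo σ (RatFunc.C r + Z⁻¹)⁻¹ := by
  simpa using (h.inv.C_add hr).inv

theorem ClassReg.parallel (hr : 0 ≤ r) (h : ClassReg Z) : ClassReg (RatFunc.C r + Z⁻¹)⁻¹ :=
  (h.inv.C_add hr).inv

/-- A resistor across the whole core moves inside it: with `D = 1/Z₁ + 1/Z₂` and `κ = 1 + rR`, `(r +
(R + D⁻¹)⁻¹)⁻¹ = R/κ + (κ²(D + r/κ))⁻¹`. The conductance `r/κ` is absorbed by `Z₂`, and both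
branches are scaled by `κ⁻²`. -/
theorem Core.parallel (hr : 0 < r) (h : Core σ Z) : Core σ (RatFunc.C r + Z⁻¹)⁻¹ := by
  obtain ⟨R, Z₁, Z₂, hR, h, rfl⟩ := h
  have hpos : 0 < 1 + r * R := by positivity
  have p1 : IsPos Z₁ := by
    rcases h with h | h
    exacts [h.1.isPos, h.1.isPos]
  have p2 : IsPos Z₂ := by
    rcases h with h | h
    exacts [h.2.isPos, h.2.isPos]
  have pD := p1.inv.add p2.inv
  refine ⟨R / (1 + r * R), RatFunc.C (1 / (1 + r * R) ^ 2) * Z₁,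
    RatFunc.C (1 / (1 + r * R) ^ 2) * (RatFunc.C (r / (1 + r * R)) + Z₂⁻¹)⁻¹,
    by positivity, ?_, ?_⟩
  · rcases h with ⟨h1, h2⟩ | ⟨h1, h2⟩
    · exact Or.inl ⟨h1.smul (by positivity), (h2.parallel (by positivity)).smul (by positivity)⟩
    · exact Or.inr ⟨h1.smul (by positivity), (h2.parallel (by positivity)).smul (by positivity)⟩
  · have e : (RatFunc.C (1 / (1 + r * R) ^ 2) * Z₁)⁻¹ +
        (RatFunc.C (1 / (1 + r * R) ^ 2) * (RatFunc.C (r / (1 + r * R)) + Z₂⁻¹)⁻¹)⁻¹ =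
        RatFunc.C ((1 + r * R) ^ 2) * ((Z₁⁻¹ + Z₂⁻¹) + RatFunc.C (r / (1 + r * R))) := by
      rw [mul_inv, mul_inv, inv_inv, ← map_inv₀, one_div, inv_inv]
      ring
    rw [e]
    generalize Z₁⁻¹ + Z₂⁻¹ = D at *
    have nD := pD.ne_zero
    have n1 := C_ne_zero' hpos.ne'
    have n2 : D + RatFunc.C (r / (1 + r * R)) ≠ 0 := (pD.add (isPos_C (by positivity))).ne_zero
    have n3 : RatFunc.C R + D⁻¹ ≠ 0 := by
      rcases hR.eq_or_lt with rfl | hR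
      · simpa using nD
      · exact ((isPos_C hR).add pD.inv).ne_zero
    have n4 : RatFunc.C r + (RatFunc.C R + D⁻¹)⁻¹ ≠ 0 := by
      have : IsPos (RatFunc.C R + D⁻¹) := by
        rcases hR.eq_or_lt with rfl | hR
        · simpa using pD.inv
        · exact (isPos_C hR).add pD.inv
      exact ((isPos_C hr).add this.inv).ne_zero
    have f1 : RatFunc.C R + D⁻¹ = (RatFunc.C R * D + 1) / D := by field_simp
    have n5 : RatFunc.C R * D + 1 ≠ 0 := by
      intro h0; rw [f1, h0, zero_div] at n3; exact n3 rfl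
    have f2 : RatFunc.C r + (RatFunc.C R + D⁻¹)⁻¹ =
        (RatFunc.C (1 + r * R) * D + RatFunc.C r) / (RatFunc.C R * D + 1) := by
      rw [f1, inv_div, map_add, map_mul, map_one, eq_div_iff n5, add_mul, div_mul_cancel₀ _ n5]
      ring
    have n6 : RatFunc.C (1 + r * R) * D + RatFunc.C r ≠ 0 := by
      intro h0; rw [f2, h0, zero_div] at n4; exact n4 rfl
    have f3 : D + RatFunc.C (r / (1 + r * R)) =
        (RatFunc.C (1 + r * R) * D + RatFunc.C r) / RatFunc.C (1 + r * R) := by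
      rw [map_div₀]; field_simp
    rw [f2, f3, inv_div, map_div₀, map_pow]
    generalize hQ : RatFunc.C (1 + r * R) * D + RatFunc.C r = Q at *
    field_simp
    rw [← hQ]
    simp only [map_add, map_mul, map_one]
    ring

theorem Core.C_add (hr : 0 ≤ r) (h : Core σ Z) : Core σ (RatFunc.C r + Z) := by
  obtain ⟨R, Z₁, Z₂, hR, h, rfl⟩ := h
  exact ⟨r + R, Z₁, Z₂, by positivity, h, by rw [map_add, add_assoc]⟩

theorem ClassMixed.C_add (hr : 0 < r) (h : ClassMixed σ Z) : ClassMixed σ (RatFunc.C r + Z) := by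
  rcases h with h | h
  · exact Or.inl (h.C_add hr.le)
  · right
    simpa using h.parallel hr

theorem ClassOne.add_classReg (h : ClassOne σ Z) (h' : ClassReg W) : ClassMixed σ (Z + W) :=
  Or.inr ⟨0, Z⁻¹, W⁻¹, le_rfl, Or.inl ⟨h.inv, h'.inv⟩, by simp⟩

theorem ClassOne.add_classTwo_neg (h : ClassOne (-σ) Z) (h' : ClassTwo σ W) :
    ClassMixed σ (Z + W) :=
  Or.inr ⟨0, Z⁻¹, W⁻¹, le_rfl, Or.inr ⟨h.inv, h'.inv⟩, by simp⟩

/-! ### The class of a network -/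

/-- The class of impedances attached to `m` capacitors and `n` inductors, for `m + n ≤ 3`. -/
def NetworkClass : ℕ → ℕ → RatFunc ℝ → Prop
  | 0, 0 => fun Z => ∃ R, 0 < R ∧ Z = RatFunc.C R
  | 0, 1 => ClassOne 1
  | 1, 0 => ClassOne (-1)
  | 1, 1 => ClassReg
  | 0, 2 => ClassTwo 1
  | 2, 0 => ClassTwo (-1)
  | 0, 3 => ClassThree 1
  | 3, 0 => ClassThree (-1)
  | 1, 2 => ClassMixed 1
  | 2, 1 => ClassMixed (-1)
  | _, _ => fun _ => True

theorem NetworkClass.inv {m n : ℕ} (hmn : m + n ≤ 3) (h : NetworkClass m n Z) :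
    NetworkClass n m Z⁻¹ := by
  have hm : m ≤ 3 := by omega
  have hn : n ≤ 3 := by omega
  interval_cases m <;> interval_cases n <;> simp only [NetworkClass] at h ⊢ <;> try omega
  · obtain ⟨R, hR, rfl⟩ := h
    exact ⟨R⁻¹, inv_pos.2 hR, by simp⟩
  · exact h.inv
  · exact h.inv
  · exact h.inv
  · simpa using h.inv
  · exact h.inv
  · exact h.inv
  · simpa using h.inv
  · simpa using h.inv
  · simpa using h.inv

theorem NetworkClass.add {m n m' n' : ℕ} (hmn : m + m' + (n + n') ≤ 3)
    (h : NetworkClass m n Z) (h' : NetworkClass m' n' W) :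
    NetworkClass (m + m') (n + n') (Z + W) := by
  -- With at most three storage elements in total, the smaller summand has at most one: it is a
  -- resistor or a bilinear branch.
  wlog hle : m + n ≤ m' + n' generalizing m n m' n' Z W
  · rw [add_comm m, add_comm n, add_comm Z]
    exact this (by omega) h' h (by omega)
  rcases Nat.eq_zero_or_pos (m + n) with h0 | h0
  · obtain ⟨rfl, rfl⟩ : m = 0 ∧ n = 0 := by omega
    obtain ⟨R, hR, rfl⟩ := h
    rw [zero_add, zero_add]
    have hm : m' ≤ 3 := by omega
    have hn : n' ≤ 3 := by omega
    interval_cases m' <;> interval_cases n' <;> simp only [NetworkClass] at h' ⊢ <;> try omega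
    · obtain ⟨R', hR', rfl⟩ := h'
      exact ⟨R + R', by positivity, by simp⟩
    · exact h'.C_add hR.le
    · exact h'.C_add hR.le
    · exact h'.C_add hR.le
    · exact h'.C_add hR.le
    · exact h'.C_add hR.le
    · exact h'.C_add hR
    · exact h'.C_add hR.le
    · exact h'.C_add hR
    · exact h'.C_add hR.le
  · obtain ⟨rfl, rfl⟩ | ⟨rfl, rfl⟩ : (m = 0 ∧ n = 1) ∨ (m = 1 ∧ n = 0) := by omega
    · have hm : m' ≤ 2 := by omega
      have hn : n' ≤ 2 := by omega
      interval_cases m' <;> interval_cases n' <;> simp only [NetworkClass] at h h' ⊢ <;> try omega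
      · exact h.add h'
      · exact h.add_classTwo h'
      · exact h.add_classOne_neg h'
      · exact h.add_classReg h'
      · exact ClassOne.add_classTwo_neg (by simpa using h) h'
    · have hm : m' ≤ 2 := by omega
      have hn : n' ≤ 2 := by omega
      interval_cases m' <;> interval_cases n' <;> simp only [NetworkClass] at h h' ⊢ <;> try omega
      · rw [add_comm]; exact h'.add_classOne_neg h
      · exact h.add_classTwo_neg h'
      · exact h.add h'
      · exact h.add_classReg h'
      · exact h.add_classTwo h'

/-- A parallel connection is the inverse of the sum of the inverses, so compatibility with inversion
and series connection suffices. -/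
theorem Network.networkClass (N : Network) (hN : N.numCapacitors + N.numInductors ≤ 3) :
    NetworkClass N.numCapacitors N.numInductors N.impedance := by
  induction N with
  | resistor R hR => exact ⟨R, hR, rfl⟩
  | inductor L hL =>
    refine ⟨L, 0, 0, 1, hL.le, le_rfl, le_rfl, zero_le_one, by simpa, by simp, by simpa using hL.le, ?_⟩
    simp [lin, Network.impedance]
  | capacitor C hC =>
    refine ⟨0, 1, C, 0, le_rfl, zero_le_one, hC.le, le_rfl, by simp, by simpa, by simpa using hC.le, ?_⟩
    simp [lin, Network.impedance]
  | series N₁ N₂ h₁ h₂ =>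
    simp only [Network.numCapacitors, Network.numInductors] at hN ⊢
    exact (h₁ (by omega)).add (by omega) (h₂ (by omega))
  | parallel N₁ N₂ h₁ h₂ =>
    simp only [Network.numCapacitors, Network.numInductors] at hN ⊢
    exact (((h₁ (by omega)).inv (by omega)).add (by omega)
      ((h₂ (by omega)).inv (by omega))).inv (by omega)

/-! ### Generic impedances satisfy the boundary conditions -/

/-- As formal cubics, two quadratics have both leading coefficients zero, so their resultant
vanishes. -/
theorem not_generic_quad_div (c d : Fin 3 → ℝ) : ¬ Generic (quad c / quad d) := by
  intro h
  refine h ![c 0, c 1, c 2, 0] ![d 0, d 1, d 2, 0] (by rw [quad_eq_cubic, quad_eq_cubic]) ?_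
  rw [R₀_eq, Matrix.det_fin_three]
  simp [bezoutian]

theorem ClassReg.not_generic (h : ClassReg Z) : ¬ Generic Z := by
  obtain ⟨c, d, -, -, -, -, -, -, rfl⟩ := h
  exact not_generic_quad_div c d

theorem ClassTwo.not_generic (h : ClassTwo σ Z) : ¬ Generic Z := by
  obtain ⟨c, d, -, -, -, -, -, rfl⟩ := h
  exact not_generic_quad_div c d

theorem ClassOne.not_generic (h : ClassOne σ Z) : ¬ Generic Z := by
  obtain ⟨p, q, t, u, -, -, -, -, -, -, -, rfl⟩ := h
  rw [lin_eq_quad, lin_eq_quad]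
  exact not_generic_quad_div _ _

theorem not_generic_C (r : ℝ) : ¬ Generic (RatFunc.C r) := by
  have : RatFunc.C r = quad ![r, 0, 0] / quad ![1, 0, 0] := by simp [quad]
  rw [this]
  exact not_generic_quad_div _ _

/-- The admittance tends to `t/p` at infinity. This conductance is split off to be absorbed by the
other branch, which leaves `L(s + x)` with `x = q/p`. The capacitive analogue splits off the value
at `s = 0`. -/
theorem inv_lin_div_of_inductive {p q t u : ℝ} (hp : 0 < p) (h : 0 < p * u - t * q)
    (n : lin p q ≠ 0) : (lin p q / lin t u)⁻¹ = RatFunc.C (t / p) +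
      (RatFunc.C (p ^ 2 / (p * u - t * q) * (q / p)) +
        RatFunc.C (p ^ 2 / (p * u - t * q)) * RatFunc.X)⁻¹ := by
  have n1 := C_ne_zero' hp.ne'
  have n2 := C_ne_zero' h.ne'
  have e : RatFunc.C (p ^ 2 / (p * u - t * q) * (q / p)) +
        RatFunc.C (p ^ 2 / (p * u - t * q)) * RatFunc.X =
        RatFunc.C p * lin p q / RatFunc.C (p * u - t * q) := by
    simp only [map_mul, map_div₀, map_pow, lin]
    field_simp
    ring
  rw [e, inv_div, inv_div, map_div₀]
  field_simp
  simp only [lin, map_sub, map_mul]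
  ring

theorem inv_lin_div_of_capacitive {p q t u : ℝ} (hq : 0 < q) (h : 0 < t * q - p * u)
    (n : lin p q ≠ 0) : (lin p q / lin t u)⁻¹ = RatFunc.C (u / q) +
      (RatFunc.C (p / q / ((t * q - p * u) / q ^ 2)) +
        (RatFunc.C ((t * q - p * u) / q ^ 2) * RatFunc.X)⁻¹)⁻¹ := by
  have n1 := C_ne_zero' hq.ne'
  have n2 := C_ne_zero' h.ne'
  have nX : (RatFunc.X : RatFunc ℝ) ≠ 0 := RatFunc.X_ne_zero
  have e : RatFunc.C (p / q / ((t * q - p * u) / q ^ 2)) +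
        (RatFunc.C ((t * q - p * u) / q ^ 2) * RatFunc.X)⁻¹ =
        RatFunc.C q * lin p q / (RatFunc.C (t * q - p * u) * RatFunc.X) := by
    simp only [map_div₀, map_pow, lin]
    field_simp
  rw [e, inv_div, inv_div, map_div₀]
  field_simp
  simp only [lin, map_sub, map_mul]
  ring

/-- In a generic core, the branch with one storage element is not a resistor. -/
theorem not_generic_core_of_C {ρ : ℝ} {Z₂ : RatFunc ℝ} (hR : 0 ≤ R) (hρ : 0 < ρ)
    (h : ClassReg Z₂ ∨ ClassTwo σ Z₂) :
    ¬ Generic (RatFunc.C R + ((RatFunc.C ρ)⁻¹ + Z₂⁻¹)⁻¹) := by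
  rw [← map_inv₀]
  rcases h with h | h
  · exact ((h.parallel (inv_pos.2 hρ).le).C_add hR).not_generic
  · exact ((h.parallel (inv_pos.2 hρ).le).C_add hR).not_generic

theorem exists_regularCond_or_C5 (hZ : Generic Z) (h : Core 1 Z) :
    ∃ (x : ℝ) (a b : Fin 4 → ℝ), 0 ≤ x ∧ FormOne Z a b ∧ (RegularCond a b x ∨ C5 a b x) := by
  obtain ⟨R, Z₁, Z₂, hR, ⟨h1, h2⟩ | ⟨h1, h2⟩, rfl⟩ := h
  · rcases h1.eq_C_or_lt (Or.inl rfl) with ⟨ρ, hρ, rfl⟩ | ⟨p, q, t, u, hp, hq, ht, hu, hs, rfl⟩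
    · exact absurd hZ (not_generic_core_of_C (σ := 1) hR hρ (Or.inl h2))
    have k1 : 0 < p * u - t * q := by linarith
    have hp0 : 0 < p := by
      refine lt_of_le_of_ne hp fun h => ?_
      rw [← h] at k1
      have := mul_nonneg ht hq
      linarith
    have hL : 0 < p ^ 2 / (p * u - t * q) := by positivity
    have hx : 0 ≤ q / p := by positivity
    rw [inv_lin_div_of_inductive hp0 k1 (lin_ne_zero (Or.inl hp0.ne')),
      add_comm (RatFunc.C (t / p)), add_assoc, ← inv_inv (RatFunc.C (t / p) + Z₂⁻¹)] at hZ ⊢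
    obtain ⟨c, d, hc, hd, hc', hd', hreg, hα, e⟩ := h2.parallel (r := t / p) (by positivity)
    rw [e, ← cubic_shunt hx hL hc hd (exists_pos_of_sum_pos hc') (exists_pos_of_sum_pos hd')]
      at hZ ⊢
    exact ⟨q / p, _, _, hx, ⟨shuntDen_ne_zero hx hL hc hd (exists_pos_of_sum_pos hd'), rfl⟩,
      Or.inl (regularCond_shunt hx hR hL hc hd hreg hα (hZ _ _ rfl))⟩
  · rcases h1.eq_C_or_lt (Or.inr rfl) with ⟨ρ, hρ, rfl⟩ | ⟨p, q, t, u, hp, hq, ht, hu, hs, rfl⟩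
    · exact absurd hZ (not_generic_core_of_C hR hρ (Or.inr h2))
    have k1 : 0 < t * q - p * u := by linarith
    have hq0 : 0 < q := by
      refine lt_of_le_of_ne hq fun h => ?_
      rw [← h] at k1
      have := mul_nonneg hp hu
      linarith
    have hK : 0 < (t * q - p * u) / q ^ 2 := by positivity
    have hx : 0 ≤ p / q := by positivity
    rw [inv_lin_div_of_capacitive hq0 k1 (lin_ne_zero (Or.inr hq0.ne')),
      add_comm (RatFunc.C (u / q)), add_assoc, ← inv_inv (RatFunc.C (u / q) + Z₂⁻¹)] at hZ ⊢
    obtain ⟨c, d, hc, hd, hc', hd', hα, e⟩ := h2.parallel (r := u / q) (by positivity)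
    rw [e, ← cubic_shunt' hx hK hc hd (exists_pos_of_sum_pos hc') (exists_pos_of_sum_pos hd')]
      at hZ ⊢
    have h0 := hZ _ _ rfl
    have h₁ : 0 ≤ α₁ c d := by simpa using hα 1 0
    have h₃ : 0 ≤ α₃ c d := by simpa using hα 0 1
    -- Semidefiniteness gives the discriminant inequality through the test vector `(-α₂, α₁)`. If
    -- `α₁ = 0`, the vector `(-(α₃ + 1), α₂)` gives `-(α₃ + 2)α₂² ≥ 0`, hence `α₂ = 0`.
    have hle : α₂ c d ^ 2 ≤ α₁ c d * α₃ c d := by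
      rcases h₁.eq_or_lt with h | h
      · have k1 := hα (-(α₃ c d + 1)) (α₂ c d)
        rw [← h] at k1 ⊢
        nlinarith [sq_nonneg (α₂ c d)]
      · have k1 := hα (-α₂ c d) (α₁ c d)
        have : 0 ≤ α₁ c d * (α₁ c d * α₃ c d - α₂ c d ^ 2) := by linarith
        linarith [nonneg_of_mul_nonneg_right this h]
    have hlt : α₂ c d ^ 2 < α₁ c d * α₃ c d := by
      refine lt_of_le_of_ne hle fun h => h0 ?_
      rw [R₀_shunt', h]
      ring
    obtain ⟨hl, he⟩ := lam₁_nonneg_of_α_lt hc hd h₃ hlt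
    exact ⟨p / q, _, _, hx, ⟨shuntDen'_ne_zero hx hK hc hd (exists_pos_of_sum_pos hd'), rfl⟩,
      Or.inr (C5_shunt' hx hR hK hc hd hl he hle h0)⟩

theorem exists_boundaryCond_of_core (hZ : Generic Z) (h : Core 1 Z) :
    ∃ (x : ℝ) (a b : Fin 4 → ℝ), 0 ≤ x ∧ FormOne Z a b ∧ BoundaryCond a b x := by
  obtain ⟨x, a, b, hx, hf, h⟩ := exists_regularCond_or_C5 hZ h
  obtain ⟨y, hy, hy'⟩ : ∃ y, 0 ≤ y ∧ BoundaryCond a b y := by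
    rcases h with h | h
    · exact exists_boundaryCond_of_regularCond hx h
    · exact exists_boundaryCond_of_C5 hx h
  exact ⟨y, a, b, hy, hf, hy'⟩

/-- Frequency inversion exchanges capacitors and inductors. The form (F1) of the inverted impedance,
with coefficients reversed back, is (F2) for `1/Z`; the positive coefficient of `a` that (F2) asks
for exists because `R₀ ≠ 0`. -/
theorem exists_boundaryCond_of_core_neg (hZ : Generic Z) (h : Core (-1) Z) :
    ∃ (x : ℝ) (a b : Fin 4 → ℝ), 0 ≤ x ∧ FormTwo Z⁻¹ a b ∧ BoundaryCond a b x := by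
  obtain ⟨x, a, b, hx, ⟨hb, e⟩, hB⟩ :=
    exists_boundaryCond_of_core hZ.freqInv (by simpa using h.freqInv)
  have hpos : (∀ i, 0 ≤ a i ∧ 0 ≤ b i) ∧ 0 < R₀ a b := by
    rcases hB with hB | hB | hB | hB | hB <;> exact ⟨hB.1.1, hB.1.2.2.2.2⟩
  refine ⟨x, a, b, hx, ⟨?_, ?_⟩, hB⟩
  · by_contra! hle
    have h0 : ∀ i, a i = 0 := fun i => le_antisymm (hle i) (hpos.1 i).1
    refine hpos.2.ne' ?_
    rw [R₀_eq, Matrix.det_fin_three]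
    simp [bezoutian, h0]
  · rw [← freqInv_freqInv Z, e, freqInv_cubic_div, inv_div]

end

end SPImpedance

end

/-! ### The characterization of bicubics in `𝒵₃` -/

theorem theorem28 (Z : RatFunc ℝ) (hZ : SPImpedance.IsBicubic Z) :
    Z ∈ SPImpedance.storageSet 3 ↔
      ((∃ x : ℝ, 0 ≤ x ∧ ∃ Y : RatFunc ℝ, (Y = Z ∨ Y = 1 / Z) ∧ ∃ a b : Fin 4 → ℝ,
          (SPImpedance.FormOne Y a b ∨ SPImpedance.FormTwo Y a b) ∧
            SPImpedance.BoundaryCond a b x) ∨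
        (∃ Y : RatFunc ℝ, (Y = Z ∨ Y = 1 / Z) ∧ ∃ a b : Fin 4 → ℝ,
          SPImpedance.FormOne Y a b ∧ SPImpedance.C6 a b)) := by
  have hg := hZ.generic
  constructor
  · rintro ⟨m, n, hmn, N, hm, hn, rfl⟩
    -- The class is taken at the actual element counts of `N`, which may lie below `m` and `n`;
    -- counts with a total of at most two contradict genericity.
    have hN := N.networkClass (by omega)
    have hm : N.numCapacitors ≤ 3 := by omega
    have hn : N.numInductors ≤ 3 := by omega
    have hsum : N.numCapacitors + N.numInductors ≤ 3 := by omega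
    generalize N.numCapacitors = k at *
    generalize N.numInductors = l at *
    generalize N.impedance = Z at *
    simp only [one_div]
    have three : ∀ {W}, SPImpedance.Generic W → SPImpedance.ClassThree (-1) W →
        ∃ a b, SPImpedance.FormOne W a b ∧ SPImpedance.C6 a b := by
      rintro W hW ⟨a, b, hab, -, hb, hs, rfl⟩
      exact ⟨a, b, ⟨hb, rfl⟩, SPImpedance.C6_of_bezForm_nonneg hab
        (fun v₀ v₁ v₂ => by simpa using hs v₀ v₁ v₂) (hW _ _ rfl)⟩
    interval_cases k <;> interval_cases l <;> simp only [SPImpedance.NetworkClass] at hN <;>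
      try omega
    · obtain ⟨R, -, rfl⟩ := hN
      exact absurd hg (SPImpedance.not_generic_C R)
    · exact absurd hg hN.not_generic
    · exact absurd hg hN.not_generic
    -- Three inductors: the dual network has three capacitors, so (C6) is obtained for `1/Z`.
    · obtain ⟨a, b, hf, h6⟩ := three hg.inv hN.inv
      exact Or.inr ⟨_, Or.inr rfl, a, b, hf, h6⟩
    · exact absurd hg hN.not_generic
    · exact absurd hg hN.not_generic
    · rcases hN with hN | hN
      · obtain ⟨x, a, b, hx, hf, hB⟩ := SPImpedance.exists_boundaryCond_of_core hg hN
        exact Or.inl ⟨x, hx, _, Or.inl rfl, a, b, Or.inl hf, hB⟩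
      · obtain ⟨x, a, b, hx, hf, hB⟩ := SPImpedance.exists_boundaryCond_of_core_neg hg.inv hN
        exact Or.inl ⟨x, hx, _, Or.inl rfl, a, b, Or.inr (by simpa using hf), hB⟩
    · exact absurd hg hN.not_generic
    · rcases hN with hN | hN
      · obtain ⟨x, a, b, hx, hf, hB⟩ := SPImpedance.exists_boundaryCond_of_core_neg hg hN
        exact Or.inl ⟨x, hx, _, Or.inr rfl, a, b, Or.inr hf, hB⟩
      · obtain ⟨x, a, b, hx, hf, hB⟩ :=
          SPImpedance.exists_boundaryCond_of_core hg.inv (by simpa using hN)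
        exact Or.inl ⟨x, hx, _, Or.inr rfl, a, b, Or.inl hf, hB⟩
    · obtain ⟨a, b, hf, h6⟩ := three hg hN
      exact Or.inr ⟨_, Or.inl rfl, a, b, hf, h6⟩
  · rintro (⟨x, hx, Y, hY, a, b, hf, hB⟩ | ⟨Y, hY, a, b, ⟨-, hf⟩, h6⟩)
    · exact SPImpedance.mem_storageSet_of_boundaryCond hx hY hf hB
    · have hm := SPImpedance.mem_impedanceSet_of_C6 h6
      rw [← hf] at hm
      rcases hY with rfl | rfl
      · exact ⟨3, 0, rfl, hm⟩
      · refine ⟨0, 3, rfl, ?_⟩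
        have := SPImpedance.inv_mem_impedanceSet hm
        rwa [one_div, inv_inv] at this
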